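/- Let $N\ge 2$ and $G=\mathrm{PGL}_N$ over $\mathbb C$, with $T$ the diagonal torus and $N_\pm$ the upper and lower unitriangular subgroups ($N_+$ also written $N$). A subscript $1$ on a group of $\mathbb C[[t^{-1}]]$-points denotes the first congruence subgroup (elements congruent to $1$ modulo $t^{-1}$). For a coweight $\mu$ of $\mathrm{PGL}_N$ (a class in $\mathbb Z^N/\mathbb Z(1,\dots,1)$) let $$\mathrm{Gr}_\mu = N_1[[t^{-1}]]\,T_1[[t^{-1}]]\,t^\mu\,N_{-,1}[[t^{-1}]]\subset \mathrm{PGL}_N((t^{-1})),$$ an affine scheme over $\mathbb C$ (of infinite type). Let $\pi: N((t^{-1}))\,T_1[[t^{-1}]]\,t^\mu\,N_-((t^{-1}))\to \mathrm{Gr}_\mu$ be the projection, $\pi(g)=n\,g\,n_-$ for the unique $n\in N[t]$, $n_-\in N_-[t]$ with $n g n_-\in\mathrm{Gr}_\mu$. The Poisson structure on $\mathrm{Gr}_\mu$ is the one induced on $N[t]\times N_-[t]$-invariant functions by the rational $r$-matrix bracket $$\{g_{ij}(z),g_{kl}(w)\}=\frac{g_{kj}(z)g_{il}(w)-g_{kj}(w)g_{il}(z)}{z-w}.$$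 Let $\alpha=\varepsilon_a-\varepsilon_b$, $1\le a<b\le N$, be a positive coroot, $k=b-a$, and let $\mathbb G_\alpha\cong\mathbb G_a^{k}$ be the additive group of vectors $v=(v_j)_{a\le j<b}$, embedded by $x_{-\alpha}(v)=1+\sum_{j} v_j E_{bj}$. Let $\Phi_\alpha:\mathrm{Gr}_\mu\to\mathfrak G_\alpha^*\cong\mathbb A^k$, where $\mathfrak G_\alpha=\mathrm{Lie}(\mathbb G_\alpha)$, send $u\,h\,t^\mu u_-$ to $(u_{jb}^{(1)})_{a\le j<b}$, where $u_{jb}^{(1)}$ is the coefficient of $t^{-1}$ in the entry $u_{jb}$, and let $\chi_\alpha\in\mathfrak G_\alpha^*$ have component $1$ at $j=a$ and $0$ at the other $j$. Then for every coweight $\mu$ and every positive coroot $\alpha$: 1. The bracket makes $\mathrm{Gr}_\mu$ a Poisson scheme. The formula $v\cdot g=\pi(x_{-\alpha}(v)g)$ is well defined and gives an algebraic action of $\mathbb G_\alpha$ on $\mathrm{Gr}_\mu$. It is Hamiltonian with moment map $\Phi_\alpha$: it is by Poisson automorphisms, $\Phi_\alpha$ is $\mathbb G_\alpha$-equivariant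 (that is, invariant, the coadjoint action being trivial), and the derivative at $v=0$ of $f(v\cdot g)$ in the $j$-th coordinate direction is $\{\Phi_{\alpha,j},f\}$. 2. $\mathbb G_\alpha$ acts freely on $\Phi_\alpha^{-1}(\chi_\alpha)$, and the map $\Phi_\alpha^{-1}(\chi_\alpha)\to\mathrm{Spec}\,\mathcal O(\Phi_\alpha^{-1}(\chi_\alpha))^{\mathbb G_\alpha}$ is a quotient: on $R$-points, for every commutative $\mathbb C$-algebra $R$, it is surjective with fibres the $\mathbb G_\alpha(R)$-orbits. The bracket of $\mathrm{Gr}_\mu$ induces a Poisson structure on this quotient $\mathrm{Gr}_\mu/\!\!/\!\!/_{\chi_\alpha}\mathbb G_\alpha:=\Phi_\alpha^{-1}(\chi_\alpha)/\mathbb G_\alpha$, and there is an isomorphism of Poisson schemes $$\mathrm{Gr}_{\mu+\alpha}\;\cong\;\mathrm{Gr}_\mu/\!\!/\!\!/_{\chi_\alpha}\mathbb G_\alpha .$$ -/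

import Mathlib

open scoped Matrix MatrixGroups

noncomputable section

namespace GrSlice

/-! ## Laurent series in `t⁻¹`

`LaurentSeries R` is used as `R((t⁻¹))`: its uniformizer is `t⁻¹`, so that the coefficient of
`t ^ m` in `f` is `f.coeff (-m)`. -/

section Series

variable {R : Type*} [CommRing R]

/-- The monomial `t ^ m` of `R((t⁻¹))`. -/
def tPow (R : Type*) [CommRing R] (m : ℤ) : LaurentSeries R :=
  HahnSeries.single (-m) 1

/-- The series `∑_{r ≥ 0} c r * t ^ (-(r + 1))` of `t⁻¹R[[t⁻¹]]`. -/
def principal (c : ℕ → R) : LaurentSeries R :=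
  HahnSeries.ofPowerSeries ℤ R (PowerSeries.X * PowerSeries.mk c)

/-- The projection of `R((t⁻¹)) = R[t] ⊕ t⁻¹R[[t⁻¹]]` onto the second summand. -/
def trunc (f : LaurentSeries R) : LaurentSeries R :=
  principal fun r => f.coeff ((r : ℤ) + 1)

/-- The series lies in `R[t]`. -/
def IsPoly (f : LaurentSeries R) : Prop :=
  ∀ m : ℤ, 0 < m → f.coeff m = 0

/-- Upper unitriangular with polynomial entries: the elements of `N[t]`. -/
def IsUpperPoly {n : ℕ} (M : Matrix (Fin n) (Fin n) (LaurentSeries R)) : Prop :=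
  ∀ i j, IsPoly (M i j) ∧ M i i = 1 ∧ (j < i → M i j = 0)

/-- Lower unitriangular with polynomial entries: the elements of `N₋[t]`. -/
def IsLowerPoly {n : ℕ} (M : Matrix (Fin n) (Fin n) (LaurentSeries R)) : Prop :=
  ∀ i j, IsPoly (M i j) ∧ M i i = 1 ∧ (i < j → M i j = 0)

theorem isUnit_tPow (m : ℤ) : IsUnit (tPow R m) := by
  refine IsUnit.of_mul_eq_one (tPow R (-m)) ?_
  simp [tPow, HahnSeries.single_mul_single]

theorem isUnit_one_add_principal (c : ℕ → R) : IsUnit (1 + principal c) := by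
  have h : IsUnit (1 + PowerSeries.X * PowerSeries.mk c : PowerSeries R) := by
    rw [PowerSeries.isUnit_iff_constantCoeff]
    simp
  simpa [principal] using h.map (HahnSeries.ofPowerSeries ℤ R)

end Series

/-! ## The slice `Gr_μ = N₁[[t⁻¹]] T₁[[t⁻¹]] t^μ N₋,₁[[t⁻¹]]` of `PGL_{n+1}((t⁻¹))` -/

/-- The coordinates on `Gr_μ`. A point of `Gr_μ` is `u h t^μ l` with `u` upper unitriangular,
`h` diagonal and `l` lower unitriangular, all congruent to `1` modulo `t⁻¹`, where `h` is taken
modulo scalars and is normalized by `h 0 = 1`. The coordinates are the coefficients of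
`t ^ (-(r + 1))` in the entries `u i j` (`i < j`), in the entries `h (i + 1)`,
and in the entries `l i j` (`j < i`). -/
inductive Coord (n : ℕ) : Type
  | up (i j : Fin (n + 1)) (hij : i < j) (r : ℕ) : Coord n
  | tor (i : Fin n) (r : ℕ) : Coord n
  | low (i j : Fin (n + 1)) (hij : j < i) (r : ℕ) : Coord n

section Points

variable {n : ℕ} {R : Type*} [CommRing R]

/-- The upper unitriangular factor, as a matrix. -/
def upMat (x : Coord n → R) : Matrix (Fin (n + 1)) (Fin (n + 1)) (LaurentSeries R) :=
  fun i j => if h : i < j then principal fun r => x (.up i j h r) else if i = j then 1 else 0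

/-- The lower unitriangular factor, as a matrix. -/
def lowMat (x : Coord n → R) : Matrix (Fin (n + 1)) (Fin (n + 1)) (LaurentSeries R) :=
  fun i j => if h : j < i then principal fun r => x (.low i j h r) else if i = j then 1 else 0

/-- The diagonal entries of the torus factor `h`. -/
def torEntry (x : Coord n → R) : Fin (n + 1) → LaurentSeries R :=
  Fin.cons 1 fun i => 1 + principal fun r => x (.tor i r)

/-- The matrix `h t^μ`. -/
def torMat (μ : Fin (n + 1) → ℤ) (x : Coord n → R) :
    Matrix (Fin (n + 1)) (Fin (n + 1)) (LaurentSeries R) :=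
  Matrix.diagonal fun i => torEntry x i * tPow R (μ i)

theorem isUnit_det_upMat (x : Coord n → R) : IsUnit (upMat x).det := by
  have h : (upMat x).BlockTriangular id := by
    intro i j hij
    have h1 : ¬ i < j := not_lt.mpr (le_of_lt hij)
    have h2 : i ≠ j := ne_of_gt hij
    simp [upMat, h1, h2]
  rw [Matrix.det_of_isUpperTriangular h]
  simp [upMat]

theorem isUnit_det_lowMat (x : Coord n → R) : IsUnit (lowMat x).det := by
  have h : (lowMat x).BlockTriangular OrderDual.toDual := by
    intro i j hij
    have hij' : i < j := hij
    have h1 : ¬ j < i := not_lt.mpr (le_of_lt hij')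
    have h2 : i ≠ j := ne_of_lt hij'
    simp [lowMat, h1, h2]
  rw [Matrix.det_of_isLowerTriangular _ h]
  simp [lowMat]

theorem isUnit_det_torMat (μ : Fin (n + 1) → ℤ) (x : Coord n → R) :
    IsUnit (torMat μ x).det := by
  rw [torMat, Matrix.det_diagonal, IsUnit.prod_univ_iff]
  intro i
  refine IsUnit.mul ?_ (isUnit_tPow _)
  refine Fin.cases ?_ (fun i => ?_) i
  · simp [torEntry]
  · simpa [torEntry] using isUnit_one_add_principal _

/-- The upper unitriangular factor `u ∈ N₁[[t⁻¹]]`. -/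
def upGL (x : Coord n → R) : GL (Fin (n + 1)) (LaurentSeries R) :=
  Matrix.GeneralLinearGroup.mk'' (upMat x) (isUnit_det_upMat x)

/-- The lower unitriangular factor `l ∈ N₋,₁[[t⁻¹]]`. -/
def lowGL (x : Coord n → R) : GL (Fin (n + 1)) (LaurentSeries R) :=
  Matrix.GeneralLinearGroup.mk'' (lowMat x) (isUnit_det_lowMat x)

/-- The factor `h t^μ`. -/
def torGL (μ : Fin (n + 1) → ℤ) (x : Coord n → R) : GL (Fin (n + 1)) (LaurentSeries R) :=
  Matrix.GeneralLinearGroup.mk'' (torMat μ x) (isUnit_det_torMat μ x)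

/-- The matrix `u h t^μ l`. -/
def sliceGL (μ : Fin (n + 1) → ℤ) (x : Coord n → R) : GL (Fin (n + 1)) (LaurentSeries R) :=
  upGL x * torGL μ x * lowGL x

/-- The point of `Gr_μ(R) ⊆ PGL_{n+1}(R((t⁻¹)))` with coordinates `x`. The coweight of
`PGL_{n+1}` is the class of the integer vector `μ` modulo constant vectors. -/
def slicePoint (μ : Fin (n + 1) → ℤ) (x : Coord n → R) :
    PGL(Fin (n + 1), LaurentSeries R) :=
  Matrix.ProjGenLinGroup.mk (sliceGL μ x)

/-- `y` is the projection `π(g) = n g n₋` of `g` to `Gr_μ`, for some `n ∈ N[t]` and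
`n₋ ∈ N₋[t]`. -/
def IsProjection (μ : Fin (n + 1) → ℤ) (g : PGL(Fin (n + 1), LaurentSeries R))
    (y : Coord n → R) : Prop :=
  ∃ p q : GL (Fin (n + 1)) (LaurentSeries R), IsUpperPoly p.1 ∧ IsLowerPoly q.1 ∧
    slicePoint μ y = Matrix.ProjGenLinGroup.mk p * g * Matrix.ProjGenLinGroup.mk q

end Points

/-! ## The Poisson structure

On the loop group one has the bracket of the rational `r`-matrix,
`{g(z) ⊗ g(w)} = [P / (z - w), g(z) ⊗ g(w)]` with `P` the permutation matrix; in matrix entries,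
`{g i j (z), g k l (w)} = (g k j (z) g i l (w) - g k j (w) g i l (z)) / (z - w)`.
The slice is the quotient `N[t] \ N((t⁻¹)) T₁[[t⁻¹]] t^μ N₋((t⁻¹)) / N₋[t]`, and its functions,
the functions invariant under `N[t] × N₋[t]`, are closed under this bracket. In terms of the
left and right gradients of such a function `f`, that is
`∑_{a,b,r} (L(E_ba t^r) f) E_ab t^(-r-1)` and `∑_{a,b,r} (R(E_ba t^r) f) E_ab t^(-r-1)`
over `r ≥ 0`, where `L(X)` and `R(X)` are the derivatives along the tangent vectors `X g` and
`g X`, the vector field `{·, f}` is `(left gradient) g - g (right gradient)`. -/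

/-- The coordinate ring of `Gr_μ`. -/
abbrev CoordRing (n : ℕ) : Type := MvPolynomial (Coord n) ℂ

/-- Matrices with entries in `𝒪((t⁻¹))`, where `𝒪` is the coordinate ring. -/
abbrev LoopMat (n : ℕ) : Type :=
  Matrix (Fin (n + 1)) (Fin (n + 1)) (LaurentSeries (CoordRing n))

section Poisson

variable {n : ℕ}

/-- The universal point of `Gr_μ`. -/
abbrev univ (n : ℕ) : Coord n → CoordRing n := MvPolynomial.X

/-- The strictly upper triangular part. -/
def upperPart (Z : LoopMat n) : LoopMat n := fun i j => if i < j then Z i j else 0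

/-- The strictly lower triangular part. -/
def lowerPart (Z : LoopMat n) : LoopMat n := fun i j => if j < i then Z i j else 0

/-- For a tangent vector `Y = δg` at the universal point `g = u d l`, `d = h t^μ`, the matrix
`u⁻¹ δg l⁻¹ d⁻¹ = u⁻¹ δu + δd d⁻¹ + d δl l⁻¹ d⁻¹`. -/
def gaussPart (μ : Fin (n + 1) → ℤ) (Y : LoopMat n) : LoopMat n :=
  (upGL (univ n))⁻¹.1 * Y * (lowGL (univ n))⁻¹.1 * (torGL μ (univ n))⁻¹.1

/-- The variation of `u` along `Y`, made tangent to `N₁[[t⁻¹]]` by a variation in `𝔫[t] u`. -/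
def varUp (μ : Fin (n + 1) → ℤ) (Y : LoopMat n) : LoopMat n :=
  ((upGL (univ n)).1 * upperPart (gaussPart μ Y) * (upGL (univ n))⁻¹.1).map trunc *
    (upGL (univ n)).1

/-- The variation of `l` along `Y`, made tangent to `N₋,₁[[t⁻¹]]` by a variation in `l 𝔫₋[t]`. -/
def varLow (μ : Fin (n + 1) → ℤ) (Y : LoopMat n) : LoopMat n :=
  (lowGL (univ n)).1 *
    ((lowGL (univ n))⁻¹.1 * ((torGL μ (univ n))⁻¹.1 * lowerPart (gaussPart μ Y) *
      (torGL μ (univ n)).1) * (lowGL (univ n)).1).map trunc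

/-- The variation of the entry `h i` along `Y`, with the normalization `h 0 = 1`. -/
def varTor (μ : Fin (n + 1) → ℤ) (Y : LoopMat n) (i : Fin (n + 1)) :
    LaurentSeries (CoordRing n) :=
  torEntry (univ n) i * trunc (gaussPart μ Y i i - gaussPart μ Y 0 0)

/-- The vector field on `Gr_μ` which is the image under the differential of
`π : N((t⁻¹)) T₁[[t⁻¹]] t^μ N₋((t⁻¹)) → Gr_μ` of the field `Y` of tangent vectors along
`Gr_μ`. -/
def vectorField (μ : Fin (n + 1) → ℤ) (Y : LoopMat n) :
    Derivation ℂ (CoordRing n) (CoordRing n) :=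
  MvPolynomial.mkDerivation ℂ fun c => match c with
    | .up i j _ r => (varUp μ Y i j).coeff ((r : ℤ) + 1)
    | .tor i r => (varTor μ Y i.succ).coeff ((r : ℤ) + 1)
    | .low i j _ r => (varLow μ Y i j).coeff ((r : ℤ) + 1)

/-- The matrix `t ^ r E_ab`. -/
def loopE (r : ℕ) (a b : Fin (n + 1)) : LoopMat n :=
  Matrix.single a b (tPow (CoordRing n) r)

/-- The principal part of the left gradient. -/
def gradLeft (μ : Fin (n + 1) → ℤ) (f : CoordRing n) : LoopMat n :=
  fun a b => principal fun r => vectorField μ (loopE r b a * (sliceGL μ (univ n)).1) f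

/-- The principal part of the right gradient. -/
def gradRight (μ : Fin (n + 1) → ℤ) (f : CoordRing n) : LoopMat n :=
  fun a b => principal fun r => vectorField μ ((sliceGL μ (univ n)).1 * loopE r b a) f

/-- The vector field `{·, f}`. -/
def hamiltonianField (μ : Fin (n + 1) → ℤ) (f : CoordRing n) :
    Derivation ℂ (CoordRing n) (CoordRing n) :=
  vectorField μ (gradLeft μ f * (sliceGL μ (univ n)).1 - (sliceGL μ (univ n)).1 * gradRight μ f)

/-- The Poisson bracket `{f, g}` of functions on `Gr_μ`. -/
def bracket (μ : Fin (n + 1) → ℤ) (f g : CoordRing n) : CoordRing n :=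
  hamiltonianField μ g f

/-- A Poisson bracket on a commutative `ℂ`-algebra. -/
structure IsPoissonBracket {A : Type*} [CommRing A] [Algebra ℂ A] (B : A → A → A) : Prop where
  add_left : ∀ f g h, B (f + g) h = B f h + B g h
  smul_left : ∀ (c : ℂ) f g, B (c • f) g = c • B f g
  leibniz : ∀ f g h, B (f * g) h = f * B g h + g * B f h
  skew : ∀ f g, B f g = -B g f
  jacobi : ∀ f g h, B f (B g h) + B g (B h f) + B h (B f g) = 0

end Poisson

/-! ## The group `G_α` and its action

A positive coroot of `PGL_{n+1}` is `α = ε_a - ε_b` with `a < b`, and `G_α` is the additive group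
of vectors indexed by `a ≤ j < b`. -/

/-- The index set `{j : a ≤ j < b}`. -/
abbrev Root {n : ℕ} (a b : Fin (n + 1)) : Type := {j : Fin (n + 1) // a ≤ j ∧ j < b}

/-- The coroot `ε_a - ε_b`. -/
def coroot {n : ℕ} (a b : Fin (n + 1)) : Fin (n + 1) → ℤ := Pi.single a 1 - Pi.single b 1

section Action

variable {n : ℕ} {a b : Fin (n + 1)}

/-- The matrix `1 + ∑_j v_j E_bj`. -/
def transMat {R : Type*} [CommRing R] (v : Root a b → R) :
    Matrix (Fin (n + 1)) (Fin (n + 1)) (LaurentSeries R) :=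
  1 + ∑ j : Root a b, Matrix.single b j.1 (HahnSeries.C (v j))

theorem isUnit_det_transMat {R : Type*} [CommRing R] (v : Root a b → R) :
    IsUnit (transMat v).det := by
  have hs : ∀ i j, i ≤ j → (∑ k : Root a b, Matrix.single b k.1 (HahnSeries.C (v k)) :
      Matrix (Fin (n + 1)) (Fin (n + 1)) (LaurentSeries R)) i j = 0 := by
    intro i j hij
    rw [Matrix.sum_apply]
    refine Finset.sum_eq_zero fun k _ => ?_
    rw [Matrix.single_apply, if_neg]
    rintro ⟨rfl, rfl⟩
    exact absurd k.2.2 (not_lt.mpr hij)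
  have h : (transMat v).BlockTriangular OrderDual.toDual := by
    intro i j hij
    have hij' : i < j := hij
    simp only [transMat, Matrix.add_apply, hs i j hij'.le, Matrix.one_apply_ne hij'.ne, add_zero]
  rw [Matrix.det_of_isLowerTriangular _ h]
  have hd : ∀ i, transMat v i i = 1 := by
    intro i
    rw [transMat, Matrix.add_apply, hs i i le_rfl, Matrix.one_apply_eq, add_zero]
  simp [hd]

/-- The homomorphism `x_{-α}` from `G_α` to `PGL_{n+1}((t⁻¹))`. -/
def translation {R : Type*} [CommRing R] (v : Root a b → R) :
    PGL(Fin (n + 1), LaurentSeries R) :=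
  Matrix.ProjGenLinGroup.mk
    (Matrix.GeneralLinearGroup.mk'' (transMat v) (isUnit_det_transMat v))

/-- A morphism `G_α × Gr_μ → Gr_μ`, given by polynomials in the coordinates. -/
abbrev ActionMap (n : ℕ) (a b : Fin (n + 1)) : Type :=
  Coord n → MvPolynomial (Root a b ⊕ Coord n) ℂ

/-- The value of the morphism at an `R`-point `(v, x)`. -/
def ActionMap.act (ρ : ActionMap n a b) {R : Type*} [CommRing R] [Algebra ℂ R]
    (v : Root a b → R) (x : Coord n → R) : Coord n → R :=
  fun c => MvPolynomial.aeval (Sum.elim v x) (ρ c)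

/-- `ρ` is an action of the group scheme `G_α` on `Gr_μ`, and it is the action
`v · g = π (x_{-α}(v) g)`, where the projection exists and is unique at all points. -/
structure IsTranslationAction (μ : Fin (n + 1) → ℤ) (ρ : ActionMap n a b) : Prop where
  isProjection : ∀ (R : Type) [CommRing R] [Algebra ℂ R] (v : Root a b → R) (x : Coord n → R),
    IsProjection μ (translation v * slicePoint μ x) (ρ.act v x)
  unique : ∀ (R : Type) [CommRing R] [Algebra ℂ R] (v : Root a b → R) (x y : Coord n → R),
    IsProjection μ (translation v * slicePoint μ x) y → y = ρ.act v x
  zero_act : ∀ (R : Type) [CommRing R] [Algebra ℂ R] (x : Coord n → R),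
    ρ.act (0 : Root a b → R) x = x
  add_act : ∀ (R : Type) [CommRing R] [Algebra ℂ R] (v w : Root a b → R) (x : Coord n → R),
    ρ.act (v + w) x = ρ.act v (ρ.act w x)

/-- The pullback of functions along the action of `v ∈ G_α(ℂ)`. -/
def ActionMap.pullback (ρ : ActionMap n a b) (v : Root a b → ℂ) :
    CoordRing n →ₐ[ℂ] CoordRing n :=
  MvPolynomial.aeval (ρ.act (fun j => MvPolynomial.C (v j)) (univ n))

/-- The derivative at `v = 0` of `v ↦ f (v · x)` in the direction of the `j`-th basis vector of
the Lie algebra of `G_α`. -/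
def ActionMap.infinitesimal (ρ : ActionMap n a b) (j : Root a b) (f : CoordRing n) :
    CoordRing n :=
  MvPolynomial.aeval (Sum.elim 0 (univ n))
    (MvPolynomial.pderiv (Sum.inl j) (MvPolynomial.aeval ρ f))

/-- The `j`-th component of the moment map `Φ_α`: the coefficient of `t⁻¹` in the entry `u j b` of
the upper unitriangular factor. -/
def momentCoord (j : Root a b) : Coord n := .up j.1 b j.2.2 0

/-- The action `ρ` on `Gr_μ` is Hamiltonian with moment map `Φ_α : Gr_μ → 𝔊_α^*`: the group acts
by Poisson automorphisms, `Φ_α` is equivariant (the coadjoint action of `G_α` is trivial), and the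
infinitesimal action is by the Hamiltonian vector fields `{Φ_α,j, ·}`. -/
structure IsHamiltonian (μ : Fin (n + 1) → ℤ) (ρ : ActionMap n a b) : Prop where
  pullback_bracket : ∀ (v : Root a b → ℂ) (f g : CoordRing n),
    ρ.pullback v (bracket μ f g) = bracket μ (ρ.pullback v f) (ρ.pullback v g)
  equivariant : ∀ (R : Type) [CommRing R] [Algebra ℂ R] (v : Root a b → R) (x : Coord n → R)
    (j : Root a b), ρ.act v x (momentCoord j) = x (momentCoord j)
  infinitesimal_eq : ∀ (j : Root a b) (f : CoordRing n),
    ρ.infinitesimal j f = bracket μ (MvPolynomial.X (momentCoord j)) f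

/-! ## Hamiltonian reduction at the character `χ_α` -/

/-- The character `χ_α`: its component at `j = a` is `1`, the others vanish. -/
def chi (j : Root a b) : ℂ := if j.1 = a then 1 else 0

/-- The ideal of `Φ_α⁻¹(χ_α)` in the coordinate ring of `Gr_μ`. -/
def levelIdeal (a b : Fin (n + 1)) : Ideal (CoordRing n) :=
  Ideal.span (Set.range fun j : Root a b =>
    MvPolynomial.X (momentCoord j) - MvPolynomial.C (chi j))

/-- The `R`-point `x` of `Gr_μ` lies in `Φ_α⁻¹(χ_α)`. -/
def OnLevel (a b : Fin (n + 1)) {R : Type*} [CommRing R] [Algebra ℂ R] (x : Coord n → R) : Prop :=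
  ∀ j : Root a b, x (momentCoord j) = algebraMap ℂ R (chi j)

/-- The functions on `Gr_μ` whose restriction to `Φ_α⁻¹(χ_α)` is `G_α`-invariant. -/
def ActionMap.invariants (ρ : ActionMap n a b) : Subalgebra ℂ (CoordRing n) where
  carrier := {f | ∀ (R : Type) [CommRing R] [Algebra ℂ R] (v : Root a b → R) (x : Coord n → R),
    OnLevel a b x → MvPolynomial.aeval (ρ.act v x) f = MvPolynomial.aeval x f}
  mul_mem' := by
    intro f g hf hg R _ _ v x hx
    rw [map_mul, map_mul, hf R v x hx, hg R v x hx]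
  add_mem' := by
    intro f g hf hg R _ _ v x hx
    rw [map_add, map_add, hf R v x hx, hg R v x hx]
  algebraMap_mem' := by
    intro c R _ _ v x _
    rw [AlgHom.commutes, AlgHom.commutes]

/-- The coordinate ring `𝒪(Φ_α⁻¹(χ_α))^{G_α}` of the reduction `Gr_μ ⫽_{χ_α} G_α`. -/
abbrev ActionMap.reducedRing (ρ : ActionMap n a b) :
    Subalgebra ℂ (CoordRing n ⧸ levelIdeal a b) :=
  ρ.invariants.map (Ideal.Quotient.mkₐ ℂ (levelIdeal a b))

/-- The class of an element of `invariants` in the reduced ring. -/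
def ActionMap.toReduced (ρ : ActionMap n a b) (f : ρ.invariants) : ρ.reducedRing :=
  ⟨Ideal.Quotient.mkₐ ℂ (levelIdeal a b) f.1, Subalgebra.mem_map.mpr ⟨f.1, f.2, rfl⟩⟩

/-- The group `G_α` acts freely on `Φ_α⁻¹(χ_α)`, and the spectrum of the invariant functions is the
quotient: the map from `Φ_α⁻¹(χ_α)` to it is surjective on `R`-points, with the orbits of `G_α(R)`
as fibres. -/
structure IsFreeQuotient (ρ : ActionMap n a b) : Prop where
  free : ∀ (R : Type) [CommRing R] [Algebra ℂ R] (v : Root a b → R) (x : Coord n → R),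
    OnLevel a b x → ρ.act v x = x → v = 0
  fibre : ∀ (R : Type) [CommRing R] [Algebra ℂ R] (x y : Coord n → R),
    OnLevel a b x → OnLevel a b y →
    (∀ f ∈ ρ.invariants, MvPolynomial.aeval x f = MvPolynomial.aeval y f) →
    ∃ v : Root a b → R, ρ.act v x = y
  surjective : ∀ (R : Type) [CommRing R] [Algebra ℂ R] (φ : ρ.reducedRing →ₐ[ℂ] R),
    ∃ x : Coord n → R, OnLevel a b x ∧
      ∀ f : ρ.invariants, φ (ρ.toReduced f) = MvPolynomial.aeval x f.1

/-- `B` is the bracket on the reduction that is induced by the bracket of `Gr_μ`. -/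
def IsReducedBracket (μ : Fin (n + 1) → ℤ) (ρ : ActionMap n a b)
    (B : ρ.reducedRing → ρ.reducedRing → ρ.reducedRing) : Prop :=
  ∀ f g : ρ.invariants, (B (ρ.toReduced f) (ρ.toReduced g)).1 =
    Ideal.Quotient.mkₐ ℂ (levelIdeal a b) (bracket μ f.1 g.1)

end Action

end GrSlice

end

/-!
The theorem is proved by calculus with matrices over `R((t⁻¹))`. These carry the symmetric form
`res (X Y)`, the coefficient of `t⁻¹` in `tr (X Y)`, and they are the direct sum of the isotropic
subrings of matrices over `t⁻¹R[[t⁻¹]]` and over `R[t]`; a ring with such data is a `SplitTrace`.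

*The Poisson structure.* Every function `f` on `Gr_μ` has a gradient `grad f` at the universal point
`g`: the derivative of `f` along any derivation `D` is `res (D g · grad f)`
(`IsDerivAlong.map_eq_res`), and `grad f` is orthogonal to `𝔫[t] g`, `g 𝔫₋[t]` and the scalar
directions. With `P` the projection to `t⁻¹R[[t⁻¹]]` and `w = grad f`, the Hamiltonian field of `f`
moves `g` along `P (g w) g - g P (w g)`, up to a scalar (`dmap_hamiltonianField_sliceMat`), and the
bracket `{h, f}` is the pairing of this tangent vector with `grad h` (`bracket_eq_br`). The Jacobi
identity then follows from the modified Yang–Baxter identity of the splitting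
(`SplitTrace.yangBaxter`, `SplitTrace.HamiltonianFamily.jacobi`).

*The action.* A matrix congruent to `1` modulo `t⁻¹` has a Gauss decomposition (`exists_gauss`), and
conjugation by the constant matrix `x_{-α}(v)` preserves such matrices. Hence `x_{-α}(v) g` returns
to the slice after multiplication by an element of `N₋[t]` alone, and the point is unique because
polynomial matrices congruent to `1` modulo `t⁻¹` are trivial (`Related.eq_of_upper`). The
infinitesimal action is the pairing of gradients with `E_bj g`, which is also the field of the
coordinate `u_jb^{(1)}` (`infinitesimal_eq_bracket`). Constant matrices commute with the splitting,
so the action preserves the bracket (`Related.bracket_eq`).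

*The reduction.* The starting point is the identity
`1 + t⁻¹ E_ab = w⁻¹ (1 - t E_ab) t^α (1 + t E_ba)` in the `SL₂` of the root, with `w` a
representative of the reflection (`leftInv_mul_rightInv`). On the level set `1 + t⁻¹ E_ab` is the
relevant part of the factor `u`, and the factor `t^α` changes `μ` into `μ + α`. The precise
statement is that a point `x` of the level set and a point `z` of `Gr_{μ+α}` correspond to each
other when
`S(x) = w⁻¹ (1 - t E_ab + k) S(z) q`, up to a scalar, with `q ∈ N₋[t]` and a constant matrix `k`
supported in row `a` to the right of `a` and in column `b` above `a` (`Corresponds`). Every `x` has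
a unique `z`, and every `z` has some `x` (`exists_corresponds_of_onLevel`, `Corresponds.unique`,
`exists_corresponds`). Conjugation by `w` takes the matrices `1 + k` into `N` times the root group,
and two points `x` with the same `z` differ by a unique element of the root group
(`Corresponds.exists_act_eq`, `Corresponds.eq_zero_of_act_eq`). So the level set is `G_α × Gr_{μ+α}`
(`exists_trivialization`), which gives the free quotient and the isomorphism of coordinate rings
(`reducedEquiv`).

The brackets of `F₁` and `F₂`, invariant on the level set, are compared with the bracket on
`Gr_{μ+α}` along this universal family (`mk_bracket`). By the equation for `S(x)` the gradients can
be transported from `z` to `x`. The transported gradient of a function and the original one agree on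
variations within the level set, and the only obstacle to equality of the brackets is that
conjugation by `1 - t E_ab + k` does not preserve the splitting and that `k` varies. Both effects
are constant matrices of the shape of `k`; conjugated by `w` they lie in the sum of `𝔫` and the Lie
algebra of the root group, to which the gradient of an invariant function is orthogonal
(`exists_polyPart_gaugeMat_conj`, `res_weylInv_mul_corrMat_mul`).
-/

open scoped Matrix MatrixGroups
noncomputable section
namespace GrSlice
/-! ### Coefficients of Laurent series in `t⁻¹` -/

section SeriesCoeff

variable {R S : Type*} [CommRing R] [CommRing S]

/-- The series lies in `t ^ (-k) R[[t⁻¹]]`. -/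
def OrdGe (k : ℤ) (f : LaurentSeries R) : Prop := ∀ m, m < k → f.coeff m = 0

theorem exists_ordGe (f : LaurentSeries R) : ∃ k, OrdGe k f :=
  ⟨f.order, fun _ hm => HahnSeries.coeff_eq_zero_of_lt_order hm⟩

theorem coeff_mul_eq_sum {f g : LaurentSeries R} {k l : ℤ} (hf : OrdGe k f) (hg : OrdGe l g)
    (m : ℤ) : (f * g).coeff m = ∑ i ∈ Finset.Icc k (m - l), f.coeff i * g.coeff (m - i) := by
  have hs : (Set.Ici k).IsPWO := (bddBelow_Ici (a := k)).isWF.isPWO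
  have hf' : f.support ⊆ Set.Ici k := by
    intro i hi
    by_contra h
    exact hi (hf i (not_le.mp h))
  have ht : (Set.Ici l).IsPWO := (bddBelow_Ici (a := l)).isWF.isPWO
  have hg' : g.support ⊆ Set.Ici l := by
    intro i hi
    by_contra h
    exact hi (hg i (not_le.mp h))
  rw [HahnSeries.coeff_mul_left' hs hf']
  symm
  refine Finset.sum_bij_ne_zero (fun i _ _ => (i, m - i)) ?_ ?_ ?_ ?_
  · intro i hi h
    rw [Finset.mem_antidiagonal]
    exact ⟨(Finset.mem_Icc.mp hi).1, fun h0 => h (by rw [h0, mul_zero]), by simp⟩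
  · intro i _ _ j _ _ h
    exact congrArg Prod.fst h
  · rintro ⟨i, j⟩ hij h
    rw [Finset.mem_antidiagonal] at hij
    obtain ⟨h1, h2, h3⟩ := hij
    have h3' : i + j = m := h3
    have h2' : l ≤ j := hg' h2
    have h1' : k ≤ i := h1
    obtain rfl : j = m - i := by omega
    exact ⟨i, Finset.mem_Icc.mpr ⟨h1', by omega⟩, h, rfl⟩
  · intro i _ _
    rfl

theorem coeff_principal (c : ℕ → R) (m : ℤ) :
    (principal c).coeff m = if 0 < m then c (m - 1).toNat else 0 := by
  rw [principal]
  have h := PowerSeries.coeff_coe (PowerSeries.X * PowerSeries.mk c) m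
  rw [h]
  split_ifs with h1 h2 h2
  · omega
  · rfl
  · obtain ⟨r, rfl⟩ : ∃ r : ℕ, m = r + 1 := ⟨(m - 1).toNat, by omega⟩
    have e : ((r : ℤ) + 1).natAbs = r + 1 := by omega
    rw [e, PowerSeries.coeff_succ_X_mul, PowerSeries.coeff_mk]
    congr 1
    omega
  · obtain rfl : m = 0 := by omega
    simp

@[simp] theorem coeff_principal_succ (c : ℕ → R) (r : ℕ) :
    (principal c).coeff ((r : ℤ) + 1) = c r := by
  rw [coeff_principal, if_pos (by omega)]
  congr 1
  omega

theorem coeff_trunc (f : LaurentSeries R) (m : ℤ) :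
    (trunc f).coeff m = if 0 < m then f.coeff m else 0 := by
  rw [trunc, coeff_principal]
  split_ifs with h
  · congr 1
    omega
  · rfl

theorem principal_coeff_of_ordGe {f : LaurentSeries R} (h : OrdGe 1 f) :
    principal (fun r => f.coeff ((r : ℤ) + 1)) = f := by
  change trunc f = f
  ext m
  rw [coeff_trunc]
  split_ifs with hm
  · rfl
  · exact (h m (by omega)).symm

theorem trunc_eq_self {f : LaurentSeries R} (h : OrdGe 1 f) : trunc f = f :=
  principal_coeff_of_ordGe h

theorem trunc_eq_zero {f : LaurentSeries R} (h : IsPoly f) : trunc f = 0 := by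
  ext m
  rw [coeff_trunc]
  split_ifs with hm
  · exact h m hm
  · rfl

theorem ordGe_trunc (f : LaurentSeries R) : OrdGe 1 (trunc f) := by
  intro m hm
  rw [coeff_trunc, if_neg (by omega)]

theorem ordGe_principal (c : ℕ → R) : OrdGe 1 (principal c) := by
  intro m hm
  rw [coeff_principal, if_neg (by omega)]

theorem isPoly_sub_trunc (f : LaurentSeries R) : IsPoly (f - trunc f) := by
  intro m hm
  rw [HahnSeries.coeff_sub, coeff_trunc, if_pos hm, sub_self]

theorem trunc_add (f g : LaurentSeries R) : trunc (f + g) = trunc f + trunc g := by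
  ext m
  simp only [coeff_trunc, HahnSeries.coeff_add]
  split_ifs <;> simp

theorem trunc_zero : trunc (0 : LaurentSeries R) = 0 := by
  ext m
  simp [coeff_trunc]

theorem OrdGe.mono {f : LaurentSeries R} {k l : ℤ} (h : OrdGe k f) (hl : l ≤ k) : OrdGe l f :=
  fun m hm => h m (by omega)

theorem ordGe_zero (k : ℤ) : OrdGe k (0 : LaurentSeries R) := fun _ _ => rfl

theorem OrdGe.add {f g : LaurentSeries R} {k : ℤ} (hf : OrdGe k f) (hg : OrdGe k g) :
    OrdGe k (f + g) := fun m hm => by rw [HahnSeries.coeff_add, hf m hm, hg m hm, add_zero]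

theorem OrdGe.neg {f : LaurentSeries R} {k : ℤ} (hf : OrdGe k f) : OrdGe k (-f) :=
  fun m hm => by rw [HahnSeries.coeff_neg, hf m hm, neg_zero]

theorem OrdGe.sub {f g : LaurentSeries R} {k : ℤ} (hf : OrdGe k f) (hg : OrdGe k g) :
    OrdGe k (f - g) := by
  rw [sub_eq_add_neg]
  exact hf.add hg.neg

theorem OrdGe.sum {ι : Type*} {s : Finset ι} {f : ι → LaurentSeries R} {k : ℤ}
    (h : ∀ i ∈ s, OrdGe k (f i)) : OrdGe k (∑ i ∈ s, f i) := by
  intro m hm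
  rw [HahnSeries.coeff_sum]
  exact Finset.sum_eq_zero fun i hi => h i hi m hm

theorem OrdGe.mul {f g : LaurentSeries R} {k l : ℤ} (hf : OrdGe k f) (hg : OrdGe l g) :
    OrdGe (k + l) (f * g) := by
  intro m hm
  rw [coeff_mul_eq_sum hf hg, Finset.Icc_eq_empty (by omega), Finset.sum_empty]

theorem OrdGe.mul' {f g : LaurentSeries R} {k l p : ℤ} (hf : OrdGe k f) (hg : OrdGe l g)
    (h : p ≤ k + l) : OrdGe p (f * g) :=
  (hf.mul hg).mono h

theorem ordGe_one : OrdGe 0 (1 : LaurentSeries R) := by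
  intro m hm
  rw [HahnSeries.coeff_one, if_neg (by omega)]

theorem isPoly_zero : IsPoly (0 : LaurentSeries R) := fun _ _ => rfl

theorem isPoly_one : IsPoly (1 : LaurentSeries R) := by
  intro m hm
  rw [HahnSeries.coeff_one, if_neg (by omega)]

theorem isPoly_C (r : R) : IsPoly (HahnSeries.C r : LaurentSeries R) := by
  intro m hm
  rw [HahnSeries.C_apply, HahnSeries.coeff_single_of_ne (by omega)]

theorem IsPoly.add {f g : LaurentSeries R} (hf : IsPoly f) (hg : IsPoly g) : IsPoly (f + g) :=
  fun m hm => by rw [HahnSeries.coeff_add, hf m hm, hg m hm, add_zero]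

theorem IsPoly.neg {f : LaurentSeries R} (hf : IsPoly f) : IsPoly (-f) :=
  fun m hm => by rw [HahnSeries.coeff_neg, hf m hm, neg_zero]

theorem IsPoly.mul {f g : LaurentSeries R} (hf : IsPoly f) (hg : IsPoly g) : IsPoly (f * g) := by
  intro m hm
  obtain ⟨k, hk⟩ := exists_ordGe f
  obtain ⟨l, hl⟩ := exists_ordGe g
  rw [coeff_mul_eq_sum hk hl]
  refine Finset.sum_eq_zero fun i _ => ?_
  rcases lt_or_ge 0 i with h | h
  · rw [hf i h, zero_mul]
  · rw [hg _ (by omega), mul_zero]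

theorem eq_zero_of_isPoly_of_ordGe {f : LaurentSeries R} (hf : IsPoly f) (hg : OrdGe 1 f) :
    f = 0 := by
  ext m
  rcases lt_or_ge 0 m with h | h
  · exact hf m h
  · exact hg m (by omega)

/-- The subring `R[[t⁻¹]]`. -/
def integralSubring (R : Type*) [CommRing R] : Subring (LaurentSeries R) where
  carrier := {f | OrdGe 0 f}
  mul_mem' hf hg := hf.mul' hg (by omega)
  one_mem' := ordGe_one
  add_mem' hf hg := hf.add hg
  zero_mem' := ordGe_zero 0
  neg_mem' hf := hf.neg

/-- The subring `R[t]`. -/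
def polySubring (R : Type*) [CommRing R] : Subring (LaurentSeries R) where
  carrier := {f | IsPoly f}
  mul_mem' hf hg := hf.mul hg
  one_mem' := isPoly_one
  add_mem' hf hg := hf.add hg
  zero_mem' := isPoly_zero
  neg_mem' hf := hf.neg

/-- A unit of the form `1 + f` with `f ∈ t⁻¹R[[t⁻¹]]` has an inverse of the same form. -/
theorem exists_inv_of_ordGe_sub_one {f : LaurentSeries R} (h : OrdGe 1 (f - 1)) :
    ∃ g, f * g = 1 ∧ OrdGe 1 (g - 1) := by
  obtain ⟨c, hc⟩ : ∃ c : ℕ → R, f = 1 + principal c :=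
    ⟨_, by rw [principal_coeff_of_ordGe h]; ring⟩
  set p : PowerSeries R := 1 + PowerSeries.X * PowerSeries.mk c with hp
  have hu : IsUnit p := by
    rw [PowerSeries.isUnit_iff_constantCoeff]
    simp [hp]
  obtain ⟨q, hq⟩ := hu.exists_right_inv
  have hf : f = HahnSeries.ofPowerSeries ℤ R p := by
    rw [hc, hp, map_add, map_one, principal]
  refine ⟨HahnSeries.ofPowerSeries ℤ R q, by rw [hf, ← map_mul, hq, map_one], ?_⟩
  have h0 : OrdGe 0 (HahnSeries.ofPowerSeries ℤ R q) := by
    intro m hm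
    have := PowerSeries.coeff_coe q m
    rw [this, if_pos hm]
  have e : HahnSeries.ofPowerSeries ℤ R q - 1 = -((f - 1) * HahnSeries.ofPowerSeries ℤ R q) := by
    rw [sub_mul, hf, ← map_mul, hq, map_one]
    ring
  rw [e]
  exact (h.mul' h0 (by omega)).neg

theorem tPow_zero : tPow R 0 = 1 := rfl

theorem tPow_mul_tPow (m k : ℤ) : tPow R m * tPow R k = tPow R (m + k) := by
  rw [tPow, tPow, tPow, HahnSeries.single_mul_single, mul_one]
  congr 2
  ring

theorem coeff_tPow_mul (m : ℤ) (f : LaurentSeries R) (i : ℤ) :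
    (tPow R m * f).coeff i = f.coeff (i + m) := by
  have := HahnSeries.coeff_single_mul_add (Γ := ℤ) (r := (1 : R)) (x := f) (a := i + m) (b := -m)
  rw [one_mul, add_neg_cancel_right] at this
  exact this

theorem ordGe_tPow_mul {f : LaurentSeries R} {k : ℤ} (m : ℤ) (h : OrdGe (k + m) f) :
    OrdGe k (tPow R m * f) := by
  intro i hi
  rw [coeff_tPow_mul]
  exact h _ (by omega)

theorem isPoly_tPow {m : ℤ} (h : 0 ≤ m) : IsPoly (tPow R m) := by
  intro i hi
  rw [tPow, HahnSeries.coeff_single_of_ne (by omega)]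

theorem coeff_one_isPoly {f : LaurentSeries R} (hf : IsPoly f) : f.coeff 1 = 0 :=
  hf 1 (by omega)

/-- The map on Laurent series that applies an additive map to the coefficients. -/
def cmap (φ : R →+ S) : LaurentSeries R →+ LaurentSeries S where
  toFun f := f.map φ
  map_zero' := by ext; simp
  map_add' f g := by ext; simp

@[simp] theorem coeff_cmap (φ : R →+ S) (f : LaurentSeries R) (m : ℤ) :
    (cmap φ f).coeff m = φ (f.coeff m) := rfl

/-- The ring homomorphism on Laurent series induced by a homomorphism of coefficient rings. -/
def lmap (θ : R →+* S) : LaurentSeries R →+* LaurentSeries S where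
  toFun f := f.map θ
  map_zero' := by ext; simp
  map_add' f g := by ext; simp
  map_one' := by
    ext m
    simp only [HahnSeries.map_coeff, HahnSeries.coeff_one]
    split_ifs <;> simp
  map_mul' f g := HahnSeries.map_mul θ.toNonUnitalRingHom

@[simp] theorem coeff_lmap (θ : R →+* S) (f : LaurentSeries R) (m : ℤ) :
    (lmap θ f).coeff m = θ (f.coeff m) := rfl

theorem OrdGe.cmap {f : LaurentSeries R} {k : ℤ} (h : OrdGe k f) (φ : R →+ S) :
    OrdGe k (cmap φ f) := fun m hm => by rw [coeff_cmap, h m hm, map_zero]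

theorem OrdGe.lmap {f : LaurentSeries R} {k : ℤ} (h : OrdGe k f) (φ : R →+* S) :
    OrdGe k (lmap φ f) := fun m hm => by rw [coeff_lmap, h m hm, map_zero]

theorem IsPoly.cmap {f : LaurentSeries R} (h : IsPoly f) (φ : R →+ S) :
    IsPoly (cmap φ f) := fun m hm => by rw [coeff_cmap, h m hm, map_zero]

theorem IsPoly.lmap {f : LaurentSeries R} (h : IsPoly f) (φ : R →+* S) :
    IsPoly (lmap φ f) := fun m hm => by rw [coeff_lmap, h m hm, map_zero]

/-- A derivation along a ring homomorphism acts on Laurent series by the Leibniz rule. -/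
theorem cmap_mul {θ : R →+* S} {D : R →+ S} (hD : ∀ a b, D (a * b) = θ a * D b + D a * θ b)
    (f g : LaurentSeries R) : cmap D (f * g) = lmap θ f * cmap D g + cmap D f * lmap θ g := by
  ext m
  obtain ⟨k, hk⟩ := exists_ordGe f
  obtain ⟨l, hl⟩ := exists_ordGe g
  rw [coeff_cmap, HahnSeries.coeff_add, coeff_mul_eq_sum hk hl,
    coeff_mul_eq_sum (hk.lmap θ) (hl.cmap D), coeff_mul_eq_sum (hk.cmap D) (hl.lmap θ), map_sum,
    ← Finset.sum_add_distrib]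
  exact Finset.sum_congr rfl fun i _ => hD _ _

theorem trunc_cmap (φ : R →+ S) (f : LaurentSeries R) : trunc (cmap φ f) = cmap φ (trunc f) := by
  ext m
  simp only [coeff_trunc, coeff_cmap]
  split_ifs <;> simp

theorem trunc_lmap (φ : R →+* S) (f : LaurentSeries R) : trunc (lmap φ f) = lmap φ (trunc f) := by
  ext m
  simp only [coeff_trunc, coeff_lmap]
  split_ifs <;> simp

@[simp] theorem lmap_tPow (φ : R →+* S) (m : ℤ) : lmap φ (tPow R m) = tPow S m := by
  ext i
  rw [coeff_lmap, tPow, tPow, HahnSeries.coeff_single, HahnSeries.coeff_single]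
  split_ifs <;> simp

@[simp] theorem lmap_C (φ : R →+* S) (r : R) :
    lmap φ (HahnSeries.C r) = HahnSeries.C (φ r) := by
  ext i
  rw [coeff_lmap, HahnSeries.C_apply, HahnSeries.C_apply, HahnSeries.coeff_single,
    HahnSeries.coeff_single]
  split_ifs <;> simp

theorem lmap_principal (φ : R →+* S) (c : ℕ → R) :
    lmap φ (principal c) = principal fun r => φ (c r) := by
  ext i
  rw [coeff_lmap, coeff_principal, coeff_principal]
  split_ifs <;> simp

end SeriesCoeff
/-! ### Brackets defined by a split trace form -/

/-- A ring with a trace form `τ` and an additive projection `P` such that the image and the kernel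
of `P` are subrings isotropic for `τ`. The example is a matrix ring over `R((t⁻¹))` with the
residue of the trace and the projection to the principal parts; the splitting is the one which
defines the rational `r`-matrix. -/
structure SplitTrace (M A : Type*) [Ring M] [CommRing A] where
  /-- The trace form. -/
  τ : M →+ A
  /-- The projection. -/
  P : M →+ M
  comm : ∀ x y, τ (x * y) = τ (y * x)
  mul_P : ∀ x y, P (P x * P y) = P x * P y
  mul_Q : ∀ x y, P ((x - P x) * (y - P y)) = 0
  isotropic_P : ∀ x y, τ (P x * P y) = 0
  isotropic_Q : ∀ x y, τ ((x - P x) * (y - P y)) = 0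

namespace SplitTrace

variable {M A : Type*} [Ring M] [CommRing A] (s : SplitTrace M A)

/-- The tangent vector at `g` which the `r`-matrix bracket attaches to the gradient `w`. -/
def field (g w : M) : M := s.P (g * w) * g - g * s.P (w * g)

/-- The `r`-matrix bracket at `g` of functions with gradients `v` and `w`. -/
def br (g v w : M) : A := s.τ (s.field g w * v)

theorem τ_P_mul (x y : M) : s.τ (s.P x * y) + s.τ (x * s.P y) = s.τ (x * y) := by
  have h1 := s.isotropic_P x y
  have h2 := s.isotropic_Q x y
  simp only [mul_sub, sub_mul, map_sub] at h2
  linear_combination h1 - h2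

theorem br_eq (g v w : M) :
    s.br g v w = s.τ (s.P (g * w) * (g * v)) - s.τ (s.P (w * g) * (v * g)) := by
  rw [br, field, sub_mul, map_sub, mul_assoc, mul_assoc, s.comm g, mul_assoc]

theorem br_skew (g v w : M) : s.br g v w = -s.br g w v := by
  have h1 := s.τ_P_mul (g * w) (g * v)
  have h2 := s.τ_P_mul (w * g) (v * g)
  have h3 := s.comm g (w * (g * v))
  have h4 := s.comm (g * w) (s.P (g * v))
  have h5 := s.comm (w * g) (s.P (v * g))
  simp only [mul_assoc] at h1 h2 h3 h4 h5
  rw [br_eq, br_eq]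
  linear_combination h1 - h2 - h4 + h5 + h3

/-- The modified Yang–Baxter identity for the splitting, contracted with three elements. The right
hand side is the invariant three-form, so that it takes the same value on the arguments `g w`
and `w g`, whose contributions to the Jacobi identity have opposite signs. -/
theorem yangBaxter (x y z : M) :
    (s.τ (s.P x * (z * y - y * z)) + s.τ (y * (s.P z * s.P x - s.P x * s.P z))) +
    (s.τ (s.P y * (x * z - z * x)) + s.τ (z * (s.P x * s.P y - s.P y * s.P x))) +
    (s.τ (s.P z * (y * x - x * y)) + s.τ (x * (s.P y * s.P z - s.P z * s.P y))) =
    - s.τ (x * (y * z - z * y)) := by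
  have hP : ∀ a b c, s.τ (s.P a * (s.P b * s.P c)) = 0 := by
    intro a b c
    rw [← s.mul_P b c]
    exact s.isotropic_P _ _
  have hQ : ∀ a b c, s.τ ((a - s.P a) * ((b - s.P b) * (c - s.P c))) = 0 := by
    intro a b c
    have := s.isotropic_Q a ((b - s.P b) * (c - s.P c))
    rwa [s.mul_Q, sub_zero] at this
  have p1 := hP x y z
  have p2 := hP x z y
  have q1 := hQ x y z
  have q2 := hQ x z y
  have rot : ∀ a b c, s.τ (a * (b * c)) = s.τ (b * (c * a)) := by
    intro a b c
    rw [s.comm, mul_assoc]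
  have rot' : ∀ a b c, s.τ (a * (b * c)) = s.τ (c * (a * b)) := by
    intro a b c
    rw [← mul_assoc, s.comm]
  simp only [mul_sub, sub_mul, map_sub] at q1 q2 ⊢
  linear_combination q1 + p1 - q2 - p2 + rot' y (s.P z) (s.P x) - rot y (s.P x) (s.P z)
    + rot (s.P y) x z - rot' (s.P y) z x + rot z (s.P x) (s.P y) - rot' z (s.P y) (s.P x)
    + rot' (s.P z) y x - rot (s.P z) x y

variable {s}

/-- Gradients may be replaced one after the other by gradients that agree on the directions in
which the other Hamiltonian field points. -/
theorem br_eq_of_orthogonal {g v v' w w' : M} (h1 : s.τ (s.field g w * (v - v')) = 0)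
    (h2 : s.τ (s.field g v' * (w - w')) = 0) : s.br g v w = s.br g v' w' := by
  rw [mul_sub, map_sub, sub_eq_zero] at h1 h2
  calc s.br g v w = s.br g v' w := h1
    _ = -s.br g w v' := s.br_skew _ _ _
    _ = -s.br g w' v' := congrArg Neg.neg h2
    _ = s.br g v' w' := (s.br_skew _ _ _).symm

/-- The field at `g = y g' q` of a gradient transported from `g'`. The projection need not commute
with the conjugations by `y` and `q`; the defects `a` and `b` enter as a left and a right
translation. -/
theorem field_conj {g g' y yi q qi a b w : M} (hg : g = y * g' * q) (hy : yi * y = 1)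
    (hq : q * qi = 1) (ha : s.P (y * (g' * w) * yi) = y * s.P (g' * w) * yi - a)
    (hb : s.P (qi * (w * g') * q) = qi * s.P (w * g') * q - b) :
    s.field g (qi * w * yi) = y * s.field g' w * q - a * g + g * b := by
  have e1 : g * (qi * w * yi) = y * (g' * w) * yi := by
    rw [hg]
    calc y * g' * q * (qi * w * yi) = y * g' * (q * qi) * w * yi := by noncomm_ring
      _ = _ := by rw [hq]; noncomm_ring
  have e2 : qi * w * yi * g = qi * (w * g') * q := by
    rw [hg]
    calc qi * w * yi * (y * g' * q) = qi * w * (yi * y) * g' * q := by noncomm_ring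
      _ = _ := by rw [hy]; noncomm_ring
  rw [field, e1, e2, ha, hb, field]
  have e3 : y * s.P (g' * w) * yi * g = y * s.P (g' * w) * g' * q := by
    rw [hg]
    calc y * s.P (g' * w) * yi * (y * g' * q) = y * s.P (g' * w) * (yi * y) * g' * q := by
          noncomm_ring
      _ = _ := by rw [hy]; noncomm_ring
  have e4 : g * (qi * s.P (w * g') * q) = y * g' * s.P (w * g') * q := by
    rw [hg]
    calc y * g' * q * (qi * s.P (w * g') * q) = y * g' * (q * qi) * s.P (w * g') * q := by
          noncomm_ring
      _ = _ := by rw [hq]; noncomm_ring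
  rw [sub_mul, mul_sub, e3, e4]
  noncomm_ring

/-- The bracket is invariant under transport from `g'` to `g = y g' q` when the defects of the
projection are orthogonal to the other gradient. -/
theorem br_conj {g g' y yi q qi a b v w : M} (hg : g = y * g' * q) (hy : yi * y = 1)
    (hq : q * qi = 1) (ha : s.P (y * (g' * w) * yi) = y * s.P (g' * w) * yi - a)
    (hb : s.P (qi * (w * g') * q) = qi * s.P (w * g') * q - b)
    (ha' : s.τ (a * (y * (g' * v) * yi)) = 0) (hb' : s.τ (b * (qi * (v * g') * q)) = 0) :
    s.br g (qi * v * yi) (qi * w * yi) = s.br g' v w := by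
  rw [br, br, field_conj hg hy hq ha hb, add_mul, sub_mul, map_add, map_sub]
  have e1 : a * g * (qi * v * yi) = a * (y * (g' * v) * yi) := by
    rw [hg]
    calc a * (y * g' * q) * (qi * v * yi) = a * (y * g' * (q * qi) * v * yi) := by noncomm_ring
      _ = _ := by rw [hq]; noncomm_ring
  have e2 : s.τ (g * b * (qi * v * yi)) = s.τ (b * (qi * (v * g') * q)) := by
    rw [mul_assoc, s.comm, hg]
    congr 1
    calc b * (qi * v * yi) * (y * g' * q) = b * (qi * v * (yi * y) * g' * q) := by noncomm_ring
      _ = _ := by rw [hy]; noncomm_ring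
  have e3 : s.τ (y * s.field g' w * q * (qi * v * yi)) = s.τ (s.field g' w * v) := by
    calc s.τ (y * s.field g' w * q * (qi * v * yi))
        = s.τ (y * (s.field g' w * (q * qi) * v * yi)) := by congr 1; noncomm_ring
      _ = s.τ (s.field g' w * (q * qi) * v * yi * y) := s.comm _ _
      _ = s.τ (s.field g' w * (q * qi) * v * (yi * y)) := by congr 1; noncomm_ring
      _ = _ := by rw [hq, hy]; simp
  rw [e1, e2, e3, ha', hb']
  ring

variable (s)

/-- A family of functions `f i` with gradients `w i` at the universal point `g`, together with their
Hamiltonian derivations: `d i` acts on functions, `D i` on matrices. The derivations move `g` along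
`field g (w i)` up to the central direction `c i * g`, to which the gradients are orthogonal. -/
structure HamiltonianFamily {I : Type*} (Z : Subring M) (g : M) (w : I → M) (f : I → A)
    (d : I → A →+ A) (D : I → M →+ M) (c : I → M) : Prop where
  central : ∀ z ∈ Z, ∀ x, z * x = x * z
  mem : ∀ i, c i ∈ Z
  map_mem : ∀ i j, D i (c j) ∈ Z
  leibniz : ∀ i x y, D i (x * y) = x * D i y + D i x * y
  map_P : ∀ i x, D i (s.P x) = s.P (D i x)
  map_τ : ∀ i x, d i (s.τ x) = s.τ (D i x)
  map_g : ∀ i, D i g = s.field g (w i) - c i * g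
  trace_zero : ∀ z ∈ Z, ∀ j, s.τ (z * (g * w j)) = 0
  map_f : ∀ i j, d i (f j) = s.τ (D i g * w j)
  commutator : ∀ i k j, d i (d k (f j)) - d k (d i (f j)) =
    s.τ ((D i (D k g) - D k (D i g)) * w j)

variable {s} {I : Type*} {Z : Subring M} {g : M} {w : I → M} {f : I → A}
    {d : I → A →+ A} {D : I → M →+ M} {c : I → M}

/-- The part of `d i (br g (w j) (w k))` in which the second derivatives of `f j` enter. -/
def secondOrder (s : SplitTrace M A) (g : M) (w : I → M) (D : I → M →+ M) (i j k : I) : A :=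
  s.τ (D i (g * w j) * s.P (g * w k)) - s.τ (D i (w j * g) * s.P (w k * g))

namespace HamiltonianFamily

variable (h : s.HamiltonianFamily Z g w f d D c)
include h

/-- The symmetry of the second derivatives of `f j`, in terms of the derivatives of its gradient. -/
theorem hessian_sub (i j k : I) :
    s.τ (s.field g (w k) * D i (w j)) - s.τ (s.field g (w i) * D k (w j)) =
      s.τ (c i * s.field g (w k) * w j) - s.τ (c k * s.field g (w i) * w j) := by
  have e : ∀ i j, d i (f j) = s.τ (s.field g (w i) * w j) := by
    intro i j
    have := h.trace_zero _ (h.mem i) j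
    rw [h.map_f, h.map_g, sub_mul, map_sub, mul_assoc (c i), this, sub_zero]
  have h1 := h.commutator i k j
  rw [e k j, e i j, h.map_τ, h.map_τ, h.leibniz, h.leibniz, map_add, map_add, h.map_g k, h.map_g i,
    map_sub, map_sub, h.leibniz, h.leibniz, h.map_g k, h.map_g i] at h1
  have t1 := h.trace_zero _ (h.map_mem i k) j
  have t2 := h.trace_zero _ (h.map_mem k i) j
  have t3 := h.trace_zero _ (Z.mul_mem (h.mem k) (h.mem i)) j
  have t4 := h.trace_zero _ (Z.mul_mem (h.mem i) (h.mem k)) j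
  simp only [mul_sub, sub_mul, add_mul, map_add, map_sub, mul_assoc] at h1 t1 t2 t3 t4 ⊢
  linear_combination h1 - t1 + t2 + t3 - t4

/-- The symmetry of the second derivatives replaces the terms with derivatives of `w j` by terms
without derivatives. -/
theorem secondOrder_sub (i j k : I) :
    secondOrder s g w D i j k - secondOrder s g w D k j i =
      s.τ (g * w j * (s.P (g * w k) * s.P (g * w i) - s.P (g * w i) * s.P (g * w k))) -
      s.τ (w j * g * (s.P (w k * g) * s.P (w i * g) - s.P (w i * g) * s.P (w k * g))) := by
  have h1 := h.hessian_sub i j k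
  rw [secondOrder, secondOrder, h.leibniz, h.leibniz, h.leibniz, h.leibniz, h.map_g i, h.map_g k]
  have ci := h.central _ (h.mem i) (s.P (g * w k))
  have ck := h.central _ (h.mem k) (s.P (g * w i))
  rw [field, field] at h1 ⊢
  generalize s.P (g * w k) = lk at *
  generalize s.P (g * w i) = li at *
  generalize s.P (w k * g) = rk at *
  generalize s.P (w i * g) = ri at *
  have e1 := s.comm (g * D i (w j)) lk
  have e2 := s.comm (g * D k (w j)) li
  have e3 := s.comm (D i (w j)) (g * rk)
  have e4 := s.comm (D k (w j)) (g * ri)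
  have e5 := s.comm li (g * w j * lk)
  have e6 := s.comm lk (g * w j * li)
  have e7 := s.comm (g * ri) (w j * lk)
  have e8 := s.comm (g * rk) (w j * li)
  have e9 := s.comm (c i * (g * w j)) lk
  have e10 := s.comm (c k * (g * w j)) li
  rw [← mul_assoc lk (c i), ← ci] at e9
  rw [← mul_assoc li (c k), ← ck] at e10
  have e11 := s.comm (w j) (c i * g * rk)
  have e12 := s.comm (w j) (c k * g * ri)
  simp only [mul_sub, sub_mul, add_mul, map_add, map_sub, mul_assoc] at *
  linear_combination h1 + e1 - e2 - e3 + e4 + e5 - e6 - e7 + e8 - e9 + e10 + e11 - e12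

/-- The derivative of `w k` cancels between the left and the right translates; what is left are
terms of the Yang–Baxter identity at the arguments `g w` and `w g`. -/
theorem first_order (i j k : I) :
    s.τ (D i (g * w k) * (g * w j)) - s.τ (D i (w k * g) * (w j * g)) =
      s.τ (s.P (g * w i) * (g * w k * (g * w j) - g * w j * (g * w k))) -
      s.τ (s.P (w i * g) * (w k * g * (w j * g) - w j * g * (w k * g))) := by
  have ci := h.central _ (h.mem i) (w k)
  have cg := h.central _ (h.mem i) g
  rw [h.leibniz, h.leibniz, h.map_g, field]
  generalize s.P (g * w i) = li at *
  generalize s.P (w i * g) = ri at *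
  have e1 := s.comm g (D i (w k) * (g * w j))
  have e2 := s.comm g (ri * (w k * (g * w j)))
  have e3 := s.comm (w k) (li * (g * (w j * g)))
  have e4 := s.comm (w k * g) (ri * (w j * g))
  have e5 := s.comm g (c i * (w k * (g * w j)))
  rw [← mul_assoc g (c i), ← cg] at e5
  have e6 : s.τ (w k * (c i * (g * (w j * g)))) = s.τ (c i * (w k * (g * (w j * g)))) := by
    rw [← mul_assoc, ← ci, mul_assoc]
  simp only [mul_sub, sub_mul, add_mul, map_add, map_sub, mul_assoc] at *
  linear_combination e1 - e2 - e3 + e4 - e5 + e6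

/-- The Jacobi identity: the second derivatives cancel, and what remains is the difference of the
Yang–Baxter identities for `g w` and for `w g`. -/
theorem jacobi (i j k : I) :
    d i (s.br g (w j) (w k)) + d j (s.br g (w k) (w i)) + d k (s.br g (w i) (w j)) = 0 := by
  have key : ∀ i j k, d i (s.br g (w j) (w k)) =
      s.τ (D i (g * w k) * (g * w j)) - s.τ (D i (w k * g) * (w j * g)) +
      (secondOrder s g w D i j k - secondOrder s g w D i k j) := by
    intro i j k
    rw [br_eq, map_sub, h.map_τ, h.map_τ,
      h.leibniz i (s.P (g * w k)), h.leibniz i (s.P (w k * g)), h.map_P, h.map_P, map_add, map_add,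
      secondOrder, secondOrder]
    have e1 := s.τ_P_mul (D i (g * w k)) (g * w j)
    have e2 := s.τ_P_mul (D i (w k * g)) (w j * g)
    have e3 := s.comm (s.P (g * w k)) (D i (g * w j))
    have e4 := s.comm (s.P (w k * g)) (D i (w j * g))
    linear_combination e1 - e2 + e3 - e4
  have y1 := s.yangBaxter (g * w i) (g * w j) (g * w k)
  have y2 := s.yangBaxter (w i * g) (w j * g) (w k * g)
  have a1 := h.secondOrder_sub i j k
  have a2 := h.secondOrder_sub j k i
  have a3 := h.secondOrder_sub k i j
  have b1 := h.first_order i j k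
  have b2 := h.first_order j k i
  have b3 := h.first_order k i j
  have e1 := s.comm g (w i * (g * w j * (g * w k)))
  have e2 := s.comm g (w i * (g * w k * (g * w j)))
  have e3 : s.τ (g * w i * (g * w j * (g * w k) - g * w k * (g * w j))) =
      s.τ (w i * g * (w j * g * (w k * g) - w k * g * (w j * g))) := by
    simp only [mul_sub, map_sub, mul_assoc] at e1 e2 ⊢
    linear_combination e1 - e2
  rw [key, key, key, b1, b2, b3]
  linear_combination a1 + a2 + a3 + y1 - y2 - e3

end HamiltonianFamily

end SplitTrace
/-! ### Matrices of Laurent series -/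

section LoopMatrices

/-- Square matrices of size `n + 1` with entries in `R((t⁻¹))`. -/
abbrev LMat (n : ℕ) (R : Type*) [CommRing R] : Type _ :=
  Matrix (Fin (n + 1)) (Fin (n + 1)) (LaurentSeries R)

variable {n : ℕ} {R S : Type*} [CommRing R] [CommRing S]

/-- The projection of a matrix to its principal part. -/
def truncMat : LMat n R →+ LMat n R where
  toFun X := X.map trunc
  map_zero' := by
    ext1 i j
    exact trunc_zero
  map_add' X Y := by
    ext1 i j
    exact trunc_add _ _

@[simp] theorem truncMat_apply (X : LMat n R) (i j) : truncMat X i j = trunc (X i j) := rfl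

/-- All entries lie in `R[t]`. -/
def PolyMat (X : LMat n R) : Prop := ∀ i j, IsPoly (X i j)

/-- All entries lie in `t ^ (-k) R[[t⁻¹]]`. -/
def MatGe (k : ℤ) (X : LMat n R) : Prop := ∀ i j, OrdGe k (X i j)

/-- The matrix is congruent to `1` modulo `t⁻¹`. -/
def CloseToOne (X : LMat n R) : Prop := MatGe 1 (X - 1)

/-- The matrix is upper triangular. -/
def UpperTri (X : LMat n R) : Prop := ∀ i j, j < i → X i j = 0

/-- The matrix is lower triangular. -/
def LowerTri (X : LMat n R) : Prop := ∀ i j, i < j → X i j = 0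

/-- The matrix is strictly upper triangular. -/
def StrictUpper (X : LMat n R) : Prop := ∀ i j, j ≤ i → X i j = 0

/-- The matrix is strictly lower triangular. -/
def StrictLower (X : LMat n R) : Prop := ∀ i j, i ≤ j → X i j = 0

/-- The matrix is upper unitriangular. -/
def UpperUni (X : LMat n R) : Prop := UpperTri X ∧ ∀ i, X i i = 1

/-- The matrix is lower unitriangular. -/
def LowerUni (X : LMat n R) : Prop := LowerTri X ∧ ∀ i, X i i = 1

/-- The strictly lower triangular entries are polynomial: `X` is orthogonal to `𝔫[t]`. -/
def LowerIsPoly (X : LMat n R) : Prop := ∀ i j, j < i → IsPoly (X i j)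

/-- The strictly upper triangular entries are polynomial: `X` is orthogonal to `𝔫₋[t]`. -/
def UpperIsPoly (X : LMat n R) : Prop := ∀ i j, i < j → IsPoly (X i j)

theorem PolyMat.mul {X Y : LMat n R} (hX : PolyMat X) (hY : PolyMat Y) : PolyMat (X * Y) := by
  intro i j
  rw [Matrix.mul_apply]
  exact (polySubring R).sum_mem fun k _ => (hX i k).mul (hY k j)

theorem PolyMat.add {X Y : LMat n R} (hX : PolyMat X) (hY : PolyMat Y) : PolyMat (X + Y) :=
  fun i j => (hX i j).add (hY i j)

theorem PolyMat.neg {X : LMat n R} (hX : PolyMat X) : PolyMat (-X) :=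
  fun i j => (hX i j).neg

theorem PolyMat.sub {X Y : LMat n R} (hX : PolyMat X) (hY : PolyMat Y) : PolyMat (X - Y) := by
  rw [sub_eq_add_neg]
  exact hX.add hY.neg

theorem polyMat_one : PolyMat (1 : LMat n R) := by
  intro i j
  rw [Matrix.one_apply]
  split_ifs
  · exact isPoly_one
  · exact isPoly_zero

theorem MatGe.mul {X Y : LMat n R} {k l : ℤ} (hX : MatGe k X) (hY : MatGe l Y) :
    MatGe (k + l) (X * Y) := by
  intro i j
  rw [Matrix.mul_apply]
  exact OrdGe.sum fun p _ => (hX i p).mul (hY p j)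

theorem MatGe.mono {X : LMat n R} {k l : ℤ} (h : MatGe k X) (hl : l ≤ k) : MatGe l X :=
  fun i j => (h i j).mono hl

theorem MatGe.add {X Y : LMat n R} {k : ℤ} (hX : MatGe k X) (hY : MatGe k Y) :
    MatGe k (X + Y) := fun i j => (hX i j).add (hY i j)

theorem MatGe.neg {X : LMat n R} {k : ℤ} (hX : MatGe k X) : MatGe k (-X) :=
  fun i j => (hX i j).neg

theorem MatGe.sub {X Y : LMat n R} {k : ℤ} (hX : MatGe k X) (hY : MatGe k Y) :
    MatGe k (X - Y) := by
  rw [sub_eq_add_neg]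
  exact hX.add hY.neg

theorem matGe_one : MatGe 0 (1 : LMat n R) := by
  intro i j
  rw [Matrix.one_apply]
  split_ifs
  · exact ordGe_one
  · exact ordGe_zero 0

theorem truncMat_eq_self {X : LMat n R} (h : MatGe 1 X) : truncMat X = X := by
  ext1 i j
  exact trunc_eq_self (h i j)

theorem truncMat_eq_zero {X : LMat n R} (h : PolyMat X) : truncMat X = 0 := by
  ext1 i j
  exact trunc_eq_zero (h i j)

theorem matGe_truncMat (X : LMat n R) : MatGe 1 (truncMat X) := fun _ _ => ordGe_trunc _

theorem polyMat_sub_truncMat (X : LMat n R) : PolyMat (X - truncMat X) :=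
  fun _ _ => isPoly_sub_trunc _

theorem coeff_one_trace_of_matGe {X : LMat n R} (h : MatGe 2 X) : (X.trace).coeff 1 = 0 := by
  rw [Matrix.trace, HahnSeries.coeff_sum]
  exact Finset.sum_eq_zero fun i _ => h i i 1 (by norm_num)

theorem coeff_one_trace_of_polyMat {X : LMat n R} (h : PolyMat X) : (X.trace).coeff 1 = 0 := by
  rw [Matrix.trace, HahnSeries.coeff_sum]
  exact Finset.sum_eq_zero fun i _ => h i i 1 (by norm_num)

/-- The residue of the trace, with the projection to principal parts. -/
def residue (n : ℕ) (R : Type*) [CommRing R] : SplitTrace (LMat n R) R where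
  τ :=
    { toFun := fun X => X.trace.coeff 1
      map_zero' := by simp
      map_add' := fun X Y => by simp }
  P := truncMat
  comm X Y := by
    change (X * Y).trace.coeff 1 = (Y * X).trace.coeff 1
    rw [Matrix.trace_mul_comm]
  mul_P X Y :=
    truncMat_eq_self (((matGe_truncMat X).mul (matGe_truncMat Y)).mono (by norm_num))
  mul_Q X Y := truncMat_eq_zero ((polyMat_sub_truncMat X).mul (polyMat_sub_truncMat Y))
  isotropic_P X Y := coeff_one_trace_of_matGe ((matGe_truncMat X).mul (matGe_truncMat Y))
  isotropic_Q X Y :=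
    coeff_one_trace_of_polyMat ((polyMat_sub_truncMat X).mul (polyMat_sub_truncMat Y))

/-- The residue pairing `X ↦ [t⁻¹] tr X`. -/
abbrev res : LMat n R →+ R := (residue n R).τ

theorem res_apply (X : LMat n R) : res X = X.trace.coeff 1 := rfl

theorem residue_P (X : LMat n R) : (residue n R).P X = truncMat X := rfl

theorem res_comm (X Y : LMat n R) : res (X * Y) = res (Y * X) := (residue n R).comm X Y

theorem res_mul_single (X : LMat n R) (i j : Fin (n + 1)) (f : LaurentSeries R) :
    res (X * Matrix.single j i f) = (X i j * f).coeff 1 := by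
  rw [res_apply, Matrix.trace_mul_comm, Matrix.trace_single_mul]
  rw [mul_comm]
  simp

theorem res_eq_zero_of_trace {X : LMat n R} (h : X.trace = 0) : res X = 0 := by
  rw [res_apply, h, HahnSeries.coeff_zero]

theorem UpperTri.mul {X Y : LMat n R} (hX : UpperTri X) (hY : UpperTri Y) : UpperTri (X * Y) := by
  intro i j hij
  rw [Matrix.mul_apply]
  refine Finset.sum_eq_zero fun k _ => ?_
  rcases lt_or_ge k i with h | h
  · rw [hX i k h, zero_mul]
  · rw [hY k j (lt_of_lt_of_le hij h), mul_zero]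

theorem UpperTri.mul_diag {X Y : LMat n R} (hX : UpperTri X) (hY : UpperTri Y) (i) :
    (X * Y) i i = X i i * Y i i := by
  rw [Matrix.mul_apply]
  refine Finset.sum_eq_single i (fun k _ hk => ?_) (fun h => absurd (Finset.mem_univ i) h)
  rcases lt_or_gt_of_ne hk with h | h
  · rw [hX i k h, zero_mul]
  · rw [hY k i h, mul_zero]

theorem upperTri_transpose {X : LMat n R} : UpperTri Xᵀ ↔ LowerTri X :=
  ⟨fun h i j hij => h j i hij, fun h i j hij => h j i hij⟩

theorem LowerTri.mul {X Y : LMat n R} (hX : LowerTri X) (hY : LowerTri Y) :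
    LowerTri (X * Y) := by
  rw [← upperTri_transpose] at *
  rw [Matrix.transpose_mul]
  exact hY.mul hX

theorem LowerTri.mul_diag {X Y : LMat n R} (hX : LowerTri X) (hY : LowerTri Y) (i) :
    (X * Y) i i = X i i * Y i i := by
  rw [← upperTri_transpose] at *
  have := hY.mul_diag hX i
  rwa [← Matrix.transpose_mul, mul_comm] at this

theorem UpperUni.mul {X Y : LMat n R} (hX : UpperUni X) (hY : UpperUni Y) : UpperUni (X * Y) :=
  ⟨hX.1.mul hY.1, fun i => by rw [hX.1.mul_diag hY.1, hX.2, hY.2, one_mul]⟩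

theorem LowerUni.mul {X Y : LMat n R} (hX : LowerUni X) (hY : LowerUni Y) : LowerUni (X * Y) :=
  ⟨hX.1.mul hY.1, fun i => by rw [hX.1.mul_diag hY.1, hX.2, hY.2, one_mul]⟩

theorem StrictUpper.upperTri {X : LMat n R} (h : StrictUpper X) : UpperTri X :=
  fun i j hij => h i j hij.le

theorem StrictLower.lowerTri {X : LMat n R} (h : StrictLower X) : LowerTri X :=
  fun i j hij => h i j hij.le

theorem StrictUpper.of_upperTri {X : LMat n R} (h : UpperTri X) (hd : ∀ i, X i i = 0) :
    StrictUpper X := fun i j hij => by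
  rcases hij.lt_or_eq with h1 | rfl
  · exact h i j h1
  · exact hd _

theorem StrictLower.of_lowerTri {X : LMat n R} (h : LowerTri X) (hd : ∀ i, X i i = 0) :
    StrictLower X := fun i j hij => by
  rcases hij.lt_or_eq with h1 | rfl
  · exact h i j h1
  · exact hd _

theorem UpperTri.mul_strict {X Y : LMat n R} (hX : UpperTri X) (hY : StrictUpper Y) :
    StrictUpper (X * Y) :=
  .of_upperTri (hX.mul hY.upperTri) fun i => by
    rw [hX.mul_diag hY.upperTri, hY i i le_rfl, mul_zero]

theorem StrictUpper.mul_upperTri {X Y : LMat n R} (hX : StrictUpper X) (hY : UpperTri Y) :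
    StrictUpper (X * Y) :=
  .of_upperTri (hX.upperTri.mul hY) fun i => by
    rw [hX.upperTri.mul_diag hY, hX i i le_rfl, zero_mul]

theorem LowerTri.mul_strict {X Y : LMat n R} (hX : LowerTri X) (hY : StrictLower Y) :
    StrictLower (X * Y) :=
  .of_lowerTri (hX.mul hY.lowerTri) fun i => by
    rw [hX.mul_diag hY.lowerTri, hY i i le_rfl, mul_zero]

theorem StrictLower.mul_lowerTri {X Y : LMat n R} (hX : StrictLower X) (hY : LowerTri Y) :
    StrictLower (X * Y) :=
  .of_lowerTri (hX.lowerTri.mul hY) fun i => by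
    rw [hX.lowerTri.mul_diag hY, hX i i le_rfl, zero_mul]

theorem StrictUpper.trace_eq_zero {X : LMat n R} (h : StrictUpper X) : X.trace = 0 :=
  Finset.sum_eq_zero fun i _ => h i i le_rfl

theorem StrictLower.trace_eq_zero {X : LMat n R} (h : StrictLower X) : X.trace = 0 :=
  Finset.sum_eq_zero fun i _ => h i i le_rfl

theorem UpperUni.strictUpper_sub_one {X : LMat n R} (h : UpperUni X) : StrictUpper (X - 1) :=
  .of_upperTri (fun i j hij => by
    rw [Matrix.sub_apply, h.1 i j hij, Matrix.one_apply_ne hij.ne', sub_zero])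
    fun i => by rw [Matrix.sub_apply, h.2, Matrix.one_apply_eq, sub_self]

theorem UpperUni.det {X : LMat n R} (h : UpperUni X) : X.det = 1 := by
  rw [Matrix.det_of_isUpperTriangular (fun i j hij => h.1 i j hij)]
  exact Finset.prod_eq_one fun i _ => h.2 i

theorem lowerUni_transpose {X : LMat n R} : UpperUni Xᵀ ↔ LowerUni X := by
  rw [UpperUni, LowerUni, upperTri_transpose]
  rfl

theorem LowerUni.det {X : LMat n R} (h : LowerUni X) : X.det = 1 := by
  rw [← Matrix.det_transpose]
  exact (lowerUni_transpose.mpr h).det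

theorem UpperUni.of_mul_eq_one {X Y : LMat n R} (h : UpperUni X) (hXY : X * Y = 1) :
    UpperUni Y := by
  have hYX := mul_eq_one_comm.mp hXY
  have hY : UpperTri Y := by
    have hb : X.BlockTriangular id := fun i j hij => h.1 i j hij
    let _ : Invertible X := ⟨Y, hYX, hXY⟩
    have := Matrix.blockTriangular_inv_of_blockTriangular hb
    rw [Matrix.inv_eq_right_inv hXY] at this
    exact fun i j hij => this hij
  refine ⟨hY, fun i => ?_⟩
  have := h.1.mul_diag hY i
  rwa [hXY, Matrix.one_apply_eq, h.2, one_mul, eq_comm] at this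

theorem LowerUni.of_mul_eq_one {X Y : LMat n R} (h : LowerUni X) (hXY : X * Y = 1) :
    LowerUni Y := by
  rw [← lowerUni_transpose] at *
  refine h.of_mul_eq_one ?_
  rw [← Matrix.transpose_mul, mul_eq_one_comm.mp hXY, Matrix.transpose_one]

/-- The inverse of a matrix of determinant `1` over a subring has entries in the subring. -/
theorem mem_subring_of_mul_eq_one {A : Subring (LaurentSeries R)} {X Y : LMat n R}
    (hX : ∀ i j, X i j ∈ A) (hd : X.det = 1) (hXY : X * Y = 1) : ∀ i j, Y i j ∈ A := by
  have hY : Y = X.adjugate := by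
    calc Y = (X.adjugate * X) * Y := by rw [Matrix.adjugate_mul, hd, one_smul, one_mul]
      _ = X.adjugate := by rw [mul_assoc, hXY, mul_one]
  set X' : Matrix (Fin (n + 1)) (Fin (n + 1)) A := fun i j => ⟨X i j, hX i j⟩ with hX'
  have e : X = A.subtype.mapMatrix X' := rfl
  intro i j
  rw [hY, e, ← RingHom.map_adjugate]
  exact (X'.adjugate i j).2

theorem PolyMat.of_mul_eq_one {X Y : LMat n R} (hX : PolyMat X) (hd : X.det = 1)
    (hXY : X * Y = 1) : PolyMat Y :=
  mem_subring_of_mul_eq_one (A := polySubring R) hX hd hXY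

theorem CloseToOne.matGe {X : LMat n R} (h : CloseToOne X) : MatGe 0 X := by
  have := (MatGe.mono h (by norm_num)).add (matGe_one (n := n) (R := R))
  rwa [sub_add_cancel] at this

theorem CloseToOne.of_mul_eq_one {X Y : LMat n R} (hX : CloseToOne X) (hd : X.det = 1)
    (hXY : X * Y = 1) : CloseToOne Y := by
  have hY : MatGe 0 Y := mem_subring_of_mul_eq_one (A := integralSubring R) hX.matGe hd hXY
  have e : Y - 1 = -((X - 1) * Y) := by
    rw [sub_mul, hXY, one_mul]
    abel
  rw [CloseToOne, e]
  exact (MatGe.mono (MatGe.mul hX hY) (by norm_num)).neg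

theorem CloseToOne.mul {X Y : LMat n R} (hX : CloseToOne X) (hY : CloseToOne Y) :
    CloseToOne (X * Y) := by
  have e : X * Y - 1 = (X - 1) * Y + (Y - 1) := by noncomm_ring
  rw [CloseToOne, e]
  exact (MatGe.mono (MatGe.mul hX hY.matGe) (by norm_num)).add hY

/-- The uniqueness behind every projection to a slice: the group of `R[t]`-points meets the first
congruence subgroup trivially. -/
theorem eq_one_of_polyMat_of_closeToOne {X : LMat n R} (h : PolyMat X) (h' : CloseToOne X) :
    X = 1 := by
  rw [← sub_eq_zero]
  ext1 i j
  exact eq_zero_of_isPoly_of_ordGe (h.sub polyMat_one i j) (h' i j)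

theorem isUpperPoly_iff {X : LMat n R} : IsUpperPoly X ↔ UpperUni X ∧ PolyMat X :=
  ⟨fun h => ⟨⟨fun i j hij => (h i j).2.2 hij, fun i => (h i i).2.1⟩, fun i j => (h i j).1⟩,
    fun h i j => ⟨h.2 i j, h.1.2 i, fun hij => h.1.1 i j hij⟩⟩

theorem isLowerPoly_iff {X : LMat n R} : IsLowerPoly X ↔ LowerUni X ∧ PolyMat X :=
  ⟨fun h => ⟨⟨fun i j hij => (h i j).2.2 hij, fun i => (h i i).2.1⟩, fun i j => (h i j).1⟩,
    fun h i j => ⟨h.2 i j, h.1.2 i, fun hij => h.1.1 i j hij⟩⟩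

/-- Under the residue pairing, `LowerIsPoly` is orthogonality to `𝔫[t]`. -/
theorem res_strictUpper_mul {X Y : LMat n R} (hX : StrictUpper X) (hp : PolyMat X)
    (hY : LowerIsPoly Y) : res (X * Y) = 0 := by
  rw [res_apply, Matrix.trace, HahnSeries.coeff_sum]
  refine Finset.sum_eq_zero fun i _ => ?_
  rw [Matrix.diag_apply, Matrix.mul_apply, HahnSeries.coeff_sum]
  refine Finset.sum_eq_zero fun j _ => ?_
  rcases le_or_gt j i with h | h
  · rw [hX i j h, zero_mul, HahnSeries.coeff_zero]
  · exact coeff_one_isPoly ((hp i j).mul (hY j i h))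

/-- Under the residue pairing, `UpperIsPoly` is orthogonality to `𝔫₋[t]`. -/
theorem res_strictLower_mul {X Y : LMat n R} (hX : StrictLower X) (hp : PolyMat X)
    (hY : UpperIsPoly Y) : res (X * Y) = 0 := by
  rw [res_apply, Matrix.trace, HahnSeries.coeff_sum]
  refine Finset.sum_eq_zero fun i _ => ?_
  rw [Matrix.diag_apply, Matrix.mul_apply, HahnSeries.coeff_sum]
  refine Finset.sum_eq_zero fun j _ => ?_
  rcases le_or_gt i j with h | h
  · rw [hX i j h, zero_mul, HahnSeries.coeff_zero]
  · exact coeff_one_isPoly ((hp i j).mul (hY j i h))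

/-- The matrix of a scalar series. -/
def scal (c : LaurentSeries R) : LMat n R := Matrix.scalar (Fin (n + 1)) c

theorem scal_mul_comm (c : LaurentSeries R) (X : LMat n R) : scal c * X = X * scal c :=
  (Matrix.scalar_commute c (fun _ => mul_comm _ _) X)

theorem scal_mul_apply (c : LaurentSeries R) (X : LMat n R) (i j) :
    ((scal c : LMat n R) * X) i j = c * X i j := by
  rw [scal, Matrix.scalar_apply, Matrix.diagonal_mul]

theorem res_scal_mul {X : LMat n R} (h : X.trace = 0) (c : LaurentSeries R) :
    res (scal c * X) = 0 := by
  apply res_eq_zero_of_trace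
  have : (scal c * X).trace = c * X.trace := by
    rw [Matrix.trace, Matrix.trace, Finset.mul_sum]
    exact Finset.sum_congr rfl fun i _ => scal_mul_apply c X i i
  rw [this, h, mul_zero]

/-- The ring homomorphism on matrices induced by a homomorphism of coefficient rings. -/
def smap (θ : R →+* S) : LMat n R →+* LMat n S := (lmap θ).mapMatrix

@[simp] theorem smap_apply (θ : R →+* S) (X : LMat n R) (i j) :
    smap θ X i j = lmap θ (X i j) := rfl

/-- The map on matrices that applies an additive map to all coefficients. -/
def dmap (D : R →+ S) : LMat n R →+ LMat n S := (cmap D).mapMatrix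

@[simp] theorem dmap_apply (D : R →+ S) (X : LMat n R) (i j) :
    dmap D X i j = cmap D (X i j) := rfl

theorem dmap_mul {θ : R →+* S} {D : R →+ S} (hD : ∀ a b, D (a * b) = θ a * D b + D a * θ b)
    (X Y : LMat n R) : dmap D (X * Y) = smap θ X * dmap D Y + dmap D X * smap θ Y := by
  ext1 i j
  rw [dmap_apply, Matrix.mul_apply, map_sum, Matrix.add_apply, Matrix.mul_apply, Matrix.mul_apply,
    ← Finset.sum_add_distrib]
  exact Finset.sum_congr rfl fun k _ => cmap_mul hD _ _

theorem res_smap (θ : R →+* S) (X : LMat n R) : res (smap θ X) = θ (res X) := by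
  rw [res_apply, res_apply, Matrix.trace, Matrix.trace, HahnSeries.coeff_sum,
    HahnSeries.coeff_sum, map_sum]
  rfl

theorem res_dmap (D : R →+ S) (X : LMat n R) : res (dmap D X) = D (res X) := by
  rw [res_apply, res_apply, Matrix.trace, Matrix.trace, HahnSeries.coeff_sum,
    HahnSeries.coeff_sum, map_sum]
  rfl

theorem truncMat_smap (θ : R →+* S) (X : LMat n R) :
    truncMat (smap θ X) = smap θ (truncMat X) := by
  ext1 i j
  exact trunc_lmap θ _

theorem truncMat_dmap (D : R →+ S) (X : LMat n R) :
    truncMat (dmap D X) = dmap D (truncMat X) := by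
  ext1 i j
  exact trunc_cmap D _

end LoopMatrices
/-! ### The factors of a point of the slice -/

section SliceFactors

variable {n : ℕ} {R S : Type*} [CommRing R] [CommRing S]

theorem upperUni_upMat (x : Coord n → R) : UpperUni (upMat x) :=
  ⟨fun i j hij => by simp [upMat, not_lt.mpr hij.le, hij.ne'], fun i => by simp [upMat]⟩

theorem lowerUni_lowMat (x : Coord n → R) : LowerUni (lowMat x) :=
  ⟨fun i j hij => by simp [lowMat, not_lt.mpr hij.le, hij.ne], fun i => by simp [lowMat]⟩

theorem closeToOne_upMat (x : Coord n → R) : CloseToOne (upMat x) := by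
  intro i j
  rw [Matrix.sub_apply, upMat, Matrix.one_apply]
  split_ifs with h1 h2 h2
  · exact absurd h2 h1.ne
  · rw [sub_zero]
    exact ordGe_principal _
  · rw [sub_self]
    exact ordGe_zero 1
  · rw [sub_self]
    exact ordGe_zero 1

theorem closeToOne_lowMat (x : Coord n → R) : CloseToOne (lowMat x) := by
  intro i j
  rw [Matrix.sub_apply, lowMat, Matrix.one_apply]
  split_ifs with h1 h2 h2
  · exact absurd h2 h1.ne'
  · rw [sub_zero]
    exact ordGe_principal _
  · rw [sub_self]
    exact ordGe_zero 1
  · rw [sub_self]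
    exact ordGe_zero 1

theorem upMat_apply_of_lt (x : Coord n → R) {i j : Fin (n + 1)} (h : i < j) :
    upMat x i j = principal fun r => x (.up i j h r) := by rw [upMat, dif_pos h]

theorem lowMat_apply_of_lt (x : Coord n → R) {i j : Fin (n + 1)} (h : j < i) :
    lowMat x i j = principal fun r => x (.low i j h r) := by rw [lowMat, dif_pos h]

theorem torEntry_zero (x : Coord n → R) : torEntry x 0 = 1 := rfl

theorem torEntry_succ (x : Coord n → R) (i : Fin n) :
    torEntry x i.succ = 1 + principal fun r => x (.tor i r) := rfl

theorem ordGe_torEntry_sub_one (x : Coord n → R) (i) : OrdGe 1 (torEntry x i - 1) := by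
  refine Fin.cases ?_ (fun i => ?_) i
  · rw [torEntry_zero, sub_self]
    exact ordGe_zero 1
  · rw [torEntry_succ, add_sub_cancel_left]
    exact ordGe_principal _

theorem ordGe_torEntry (x : Coord n → R) (i) : OrdGe 0 (torEntry x i) := by
  have := ((ordGe_torEntry_sub_one x i).mono (show (0 : ℤ) ≤ 1 by norm_num)).add ordGe_one
  rwa [sub_add_cancel] at this

theorem smap_upMat (θ : R →+* S) (x : Coord n → R) : smap θ (upMat x) = upMat (θ ∘ x) := by
  ext1 i j
  rw [smap_apply, upMat, upMat]
  split_ifs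
  · rw [lmap_principal]
    rfl
  · exact map_one _
  · exact map_zero _

theorem smap_lowMat (θ : R →+* S) (x : Coord n → R) : smap θ (lowMat x) = lowMat (θ ∘ x) := by
  ext1 i j
  rw [smap_apply, lowMat, lowMat]
  split_ifs
  · rw [lmap_principal]
    rfl
  · exact map_one _
  · exact map_zero _

theorem lmap_torEntry (θ : R →+* S) (x : Coord n → R) (i) :
    lmap θ (torEntry x i) = torEntry (θ ∘ x) i := by
  refine Fin.cases ?_ (fun i => ?_) i
  · rw [torEntry_zero, torEntry_zero, map_one]
  · rw [torEntry_succ, torEntry_succ, map_add, map_one, lmap_principal]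
    rfl

theorem smap_torMat (θ : R →+* S) (μ : Fin (n + 1) → ℤ) (x : Coord n → R) :
    smap θ (torMat μ x) = torMat μ (θ ∘ x) := by
  ext1 i j
  rw [smap_apply, torMat, torMat, Matrix.diagonal_apply, Matrix.diagonal_apply]
  split_ifs
  · rw [map_mul, lmap_torEntry, lmap_tPow]
  · exact map_zero _

/-- The matrix `u h t^μ l` with coordinates `x`. -/
def sliceMat (μ : Fin (n + 1) → ℤ) (x : Coord n → R) : LMat n R :=
  upMat x * torMat μ x * lowMat x

theorem coe_sliceGL (μ : Fin (n + 1) → ℤ) (x : Coord n → R) :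
    (sliceGL μ x).1 = sliceMat μ x := rfl

theorem smap_sliceMat (θ : R →+* S) (μ : Fin (n + 1) → ℤ) (x : Coord n → R) :
    smap θ (sliceMat μ x) = sliceMat μ (θ ∘ x) := by
  rw [sliceMat, map_mul, map_mul, smap_upMat, smap_torMat, smap_lowMat, sliceMat]

theorem lowerTri_torMat (μ : Fin (n + 1) → ℤ) (x : Coord n → R) : LowerTri (torMat μ x) :=
  fun _ _ hij => Matrix.diagonal_apply_ne _ hij.ne

/-- The inverse of the upper unitriangular factor. -/
def upInv (x : Coord n → R) : LMat n R := (upGL x)⁻¹.1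

/-- The inverse of the lower unitriangular factor. -/
def lowInv (x : Coord n → R) : LMat n R := (lowGL x)⁻¹.1

/-- The inverse of the torus factor. -/
def torInv (μ : Fin (n + 1) → ℤ) (x : Coord n → R) : LMat n R := (torGL μ x)⁻¹.1

theorem upMat_mul_upInv (x : Coord n → R) : upMat x * upInv x = 1 := (upGL x).mul_inv
theorem upInv_mul_upMat (x : Coord n → R) : upInv x * upMat x = 1 := (upGL x).inv_mul
theorem lowMat_mul_lowInv (x : Coord n → R) : lowMat x * lowInv x = 1 := (lowGL x).mul_inv
theorem lowInv_mul_lowMat (x : Coord n → R) : lowInv x * lowMat x = 1 := (lowGL x).inv_mul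
theorem torMat_mul_torInv (μ : Fin (n + 1) → ℤ) (x : Coord n → R) :
    torMat μ x * torInv μ x = 1 := (torGL μ x).mul_inv
theorem torInv_mul_torMat (μ : Fin (n + 1) → ℤ) (x : Coord n → R) :
    torInv μ x * torMat μ x = 1 := (torGL μ x).inv_mul

theorem upperUni_upInv (x : Coord n → R) : UpperUni (upInv x) :=
  (upperUni_upMat x).of_mul_eq_one (upMat_mul_upInv x)

theorem lowerUni_lowInv (x : Coord n → R) : LowerUni (lowInv x) :=
  (lowerUni_lowMat x).of_mul_eq_one (lowMat_mul_lowInv x)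

theorem closeToOne_upInv (x : Coord n → R) : CloseToOne (upInv x) :=
  (closeToOne_upMat x).of_mul_eq_one (upperUni_upMat x).det (upMat_mul_upInv x)

theorem closeToOne_lowInv (x : Coord n → R) : CloseToOne (lowInv x) :=
  (closeToOne_lowMat x).of_mul_eq_one (lowerUni_lowMat x).det (lowMat_mul_lowInv x)

theorem torInv_apply_ne (μ : Fin (n + 1) → ℤ) (x : Coord n → R) {i j} (h : i ≠ j) :
    torInv μ x i j = 0 := by
  have h1 := congrFun (congrFun (torMat_mul_torInv μ x) i) j
  rw [torMat, Matrix.diagonal_mul, Matrix.one_apply_ne h] at h1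
  have hu : IsUnit (torEntry x i * tPow R (μ i)) := by
    have := isUnit_det_torMat μ x
    rw [torMat, Matrix.det_diagonal, IsUnit.prod_univ_iff] at this
    exact this i
  exact (hu.mul_right_eq_zero).mp h1

theorem lowerTri_torInv (μ : Fin (n + 1) → ℤ) (x : Coord n → R) : LowerTri (torInv μ x) :=
  fun _ _ hij => torInv_apply_ne μ x hij.ne

/-- The lower triangular factor `h t^μ l`. -/
def borMat (μ : Fin (n + 1) → ℤ) (x : Coord n → R) : LMat n R := torMat μ x * lowMat x

/-- The inverse of the lower triangular factor `h t^μ l`. -/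
def borInv (μ : Fin (n + 1) → ℤ) (x : Coord n → R) : LMat n R := lowInv x * torInv μ x

theorem borMat_mul_borInv (μ : Fin (n + 1) → ℤ) (x : Coord n → R) :
    borMat μ x * borInv μ x = 1 := by
  rw [borMat, borInv, mul_assoc, ← mul_assoc (lowMat x), lowMat_mul_lowInv, one_mul,
    torMat_mul_torInv]

theorem borInv_mul_borMat (μ : Fin (n + 1) → ℤ) (x : Coord n → R) :
    borInv μ x * borMat μ x = 1 := mul_eq_one_comm.mp (borMat_mul_borInv μ x)

theorem lowerTri_borMat (μ : Fin (n + 1) → ℤ) (x : Coord n → R) : LowerTri (borMat μ x) :=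
  (lowerTri_torMat μ x).mul (lowerUni_lowMat x).1

theorem lowerTri_borInv (μ : Fin (n + 1) → ℤ) (x : Coord n → R) : LowerTri (borInv μ x) :=
  (lowerUni_lowInv x).1.mul (lowerTri_torInv μ x)

theorem sliceMat_eq (μ : Fin (n + 1) → ℤ) (x : Coord n → R) :
    sliceMat μ x = upMat x * borMat μ x := by rw [sliceMat, borMat, mul_assoc]

end SliceFactors

/-! ### Gradients of functions on the slice -/

section Gradient

variable {n : ℕ}

theorem strictUpper_upperPart (Z : LoopMat n) : StrictUpper (upperPart Z) :=
  fun i j hij => by rw [upperPart, if_neg (not_lt.mpr hij)]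

theorem strictLower_lowerPart (Z : LoopMat n) : StrictLower (lowerPart Z) :=
  fun i j hij => by rw [lowerPart, if_neg (not_lt.mpr hij)]

theorem upperTri_sub_lowerPart (Z : LoopMat n) : UpperTri (Z - lowerPart Z) :=
  fun i j hij => by rw [Matrix.sub_apply, lowerPart, if_pos hij, sub_self]

theorem lowerTri_sub_upperPart (Z : LoopMat n) : LowerTri (Z - upperPart Z) :=
  fun i j hij => by rw [Matrix.sub_apply, upperPart, if_pos hij, sub_self]

/-- The polynomial part of a matrix of Laurent series. -/
def polyPart {R : Type*} [CommRing R] (X : LMat n R) : LMat n R := X - truncMat X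

theorem polyMat_polyPart {R : Type*} [CommRing R] (X : LMat n R) : PolyMat (polyPart X) :=
  polyMat_sub_truncMat X

theorem res_truncMat_mul {R : Type*} [CommRing R] (X Y : LMat n R) :
    res (truncMat X * Y) = res (X * polyPart Y) := by
  have h1 := (residue n R).isotropic_P X Y
  have h2 := (residue n R).isotropic_Q X Y
  simp only [residue_P, sub_mul, mul_sub, map_sub] at h1 h2
  rw [polyPart, mul_sub, map_sub]
  linear_combination h1 - h2

theorem res_mul_polyPart_of_matGe {R : Type*} [CommRing R] {X : LMat n R} (hX : MatGe 1 X)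
    (Y : LMat n R) : res (X * polyPart Y) = res (X * Y) := by
  rw [← res_truncMat_mul, truncMat_eq_self hX]

theorem res_strictUpper_mul_upperTri {R : Type*} [CommRing R] {X Y : LMat n R}
    (hX : StrictUpper X) (hY : UpperTri Y) : res (X * Y) = 0 :=
  res_eq_zero_of_trace (hX.mul_upperTri hY).trace_eq_zero

theorem res_strictLower_mul_lowerTri {R : Type*} [CommRing R] {X Y : LMat n R}
    (hX : StrictLower X) (hY : LowerTri Y) : res (X * Y) = 0 :=
  res_eq_zero_of_trace (hX.mul_lowerTri hY).trace_eq_zero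

/-- The gradient of a coordinate at the universal point `g`: the matrix `w` for which the
derivative of the coordinate along a tangent vector `Y` is the residue of `tr (Y w)`. In the
notation `g = u m` with `m = h t^μ l`, the matrix `m w u` is strictly lower triangular, diagonal or
strictly upper triangular, according to the three kinds of coordinates. -/
def gradCoord (μ : Fin (n + 1) → ℤ) : Coord n → LoopMat n
  | .up i j _ r => borInv μ (univ n) * lowerPart (upInv (univ n) *
      polyPart (upMat (univ n) * Matrix.single j i (tPow _ r)) * upMat (univ n)) * upInv (univ n)
  | .tor i r => borInv μ (univ n) *
      polyPart (Matrix.single i.succ i.succ (torEntry (univ n) i.succ * tPow _ r) -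
        Matrix.single 0 0 (torEntry (univ n) i.succ * tPow _ r)) * upInv (univ n)
  | .low i j _ r => borInv μ (univ n) * upperPart (borMat μ (univ n) *
      polyPart (Matrix.single j i (tPow _ r) * lowMat (univ n)) * borInv μ (univ n)) *
      upInv (univ n)

/-- The gradient of a function at the universal point. -/
def grad (μ : Fin (n + 1) → ℤ) : Derivation ℂ (CoordRing n) (LoopMat n) :=
  MvPolynomial.mkDerivation ℂ (gradCoord μ)

@[simp] theorem grad_X (μ : Fin (n + 1) → ℤ) (c : Coord n) :
    grad μ (MvPolynomial.X c) = gradCoord μ c := MvPolynomial.mkDerivation_X _ _ _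

theorem grad_C (μ : Fin (n + 1) → ℤ) (a : ℂ) : grad μ (MvPolynomial.C a) = 0 :=
  (grad μ).map_algebraMap a

theorem smul_mat_eq {R : Type*} [CommRing R] (a : R) (X : LMat n R) :
    a • X = scal (HahnSeries.C a) * X := by
  ext1 i j
  rw [scal_mul_apply, HahnSeries.C_mul_eq_smul, Matrix.smul_apply]

theorem mul_smul_mat {R : Type*} [CommRing R] (a : R) (X Y : LMat n R) :
    X * (a • Y) = a • (X * Y) := by
  rw [smul_mat_eq, smul_mat_eq, ← mul_assoc, ← scal_mul_comm, mul_assoc]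

theorem smul_mul_mat {R : Type*} [CommRing R] (a : R) (X Y : LMat n R) :
    (a • X) * Y = a • (X * Y) := by
  rw [smul_mat_eq, smul_mat_eq, mul_assoc]

theorem trace_mul_conj {R : Type*} [CommRing R] {U V B C : LMat n R} (h1 : V * U = 1)
    (h2 : B * C = 1) (Z : LMat n R) : (U * B * (C * Z * V)).trace = Z.trace := by
  calc (U * B * (C * Z * V)).trace = (U * (B * C * Z * V)).trace := by congr 1; noncomm_ring
    _ = (Z * (V * U)).trace := by rw [h2, one_mul, Matrix.trace_mul_comm, mul_assoc]
    _ = Z.trace := by rw [h1, mul_one]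

theorem trace_smul_mat {R : Type*} [CommRing R] (a : R) (X : LMat n R) :
    (a • X).trace = a • X.trace := Matrix.trace_smul a X

theorem trace_polyPart_single_sub {R : Type*} [CommRing R] (k l : Fin (n + 1))
    (q : LaurentSeries R) :
    (polyPart (Matrix.single k k q - Matrix.single l l q)).trace = 0 := by
  have h : ∀ k : Fin (n + 1), truncMat (Matrix.single k k q) =
      (Matrix.single k k (trunc q) : LMat n R) := by
    intro k
    ext1 a b
    rw [truncMat_apply, Matrix.single_apply, Matrix.single_apply]
    split_ifs
    · rfl
    · exact trunc_zero
  rw [polyPart, map_sub, h, h]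
  simp only [Matrix.trace_sub, Matrix.trace_single_eq_same, sub_self]

theorem res_smul {R : Type*} [CommRing R] (a : R) (X : LMat n R) : res (a • X) = a * res X := by
  rw [res_apply, Matrix.trace_smul, HahnSeries.coeff_smul, smul_eq_mul, res_apply]

end Gradient
/-! ### The gradient computes derivatives -/

section GradientFormula

variable {n : ℕ} (μ : Fin (n + 1) → ℤ)

/-- The gradients are orthogonal to the directions `𝔫[t] g`. -/
theorem lowerIsPoly_mul_gradCoord (c : Coord n) :
    LowerIsPoly (sliceMat μ (univ n) * gradCoord μ c) := by
  have key : ∀ Z : LoopMat n, sliceMat μ (univ n) * (borInv μ (univ n) * Z * upInv (univ n)) =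
      upMat (univ n) * Z * upInv (univ n) := by
    intro Z
    rw [sliceMat_eq]
    calc upMat (univ n) * borMat μ (univ n) * (borInv μ (univ n) * Z * upInv (univ n))
        = upMat (univ n) * (borMat μ (univ n) * borInv μ (univ n)) * Z * upInv (univ n) := by
          noncomm_ring
      _ = _ := by rw [borMat_mul_borInv, mul_one]
  have tri : ∀ Z : LoopMat n, UpperTri Z → UpperTri (upMat (univ n) * Z * upInv (univ n)) :=
    fun Z hZ => ((upperUni_upMat _).1.mul hZ).mul (upperUni_upInv _).1
  have of_tri : ∀ Z : LoopMat n, UpperTri Z → LowerIsPoly Z := by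
    intro Z hZ i j hij
    rw [hZ i j hij]
    exact isPoly_zero
  cases c with
  | up i j hij r =>
    rw [gradCoord, key]
    set q := polyPart (upMat (univ n) * Matrix.single j i (tPow _ r)) with hq
    set Z := upInv (univ n) * q * upMat (univ n) with hZ
    have e : upMat (univ n) * lowerPart Z * upInv (univ n) =
        q - upMat (univ n) * (Z - lowerPart Z) * upInv (univ n) := by
      have : upMat (univ n) * Z * upInv (univ n) = q := by
        rw [hZ]
        calc _ = (upMat (univ n) * upInv (univ n)) * q * (upMat (univ n) * upInv (univ n)) := by
              noncomm_ring
          _ = q := by rw [upMat_mul_upInv, one_mul, mul_one]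
      rw [mul_sub, sub_mul, this]
      abel
    intro k l hkl
    rw [e, Matrix.sub_apply, tri _ (upperTri_sub_lowerPart Z) k l hkl, sub_zero]
    exact polyMat_polyPart _ k l
  | tor i r =>
    rw [gradCoord, key]
    refine of_tri _ (tri _ fun k l hkl => ?_)
    rw [polyPart, Matrix.sub_apply, truncMat_apply, Matrix.sub_apply, Matrix.single_apply_of_ne,
      Matrix.single_apply_of_ne, sub_zero, trunc_zero, sub_zero]
    · rintro ⟨rfl, rfl⟩
      exact lt_irrefl _ hkl
    · rintro ⟨rfl, rfl⟩
      exact lt_irrefl _ hkl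
  | low i j hij r =>
    rw [gradCoord, key]
    exact of_tri _ (tri _ (strictUpper_upperPart _).upperTri)

/-- The gradients are orthogonal to the directions `g 𝔫₋[t]`. -/
theorem upperIsPoly_gradCoord_mul (c : Coord n) :
    UpperIsPoly (gradCoord μ c * sliceMat μ (univ n)) := by
  have key : ∀ Z : LoopMat n, borInv μ (univ n) * Z * upInv (univ n) * sliceMat μ (univ n) =
      borInv μ (univ n) * Z * borMat μ (univ n) := by
    intro Z
    rw [sliceMat_eq]
    calc borInv μ (univ n) * Z * upInv (univ n) * (upMat (univ n) * borMat μ (univ n))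
        = borInv μ (univ n) * Z * (upInv (univ n) * upMat (univ n)) * borMat μ (univ n) := by
          noncomm_ring
      _ = _ := by rw [upInv_mul_upMat, mul_one]
  have tri : ∀ Z : LoopMat n, LowerTri Z →
      LowerTri (borInv μ (univ n) * Z * borMat μ (univ n)) :=
    fun Z hZ => ((lowerTri_borInv μ _).mul hZ).mul (lowerTri_borMat μ _)
  have of_tri : ∀ Z : LoopMat n, LowerTri Z → UpperIsPoly Z := by
    intro Z hZ i j hij
    rw [hZ i j hij]
    exact isPoly_zero
  cases c with
  | up i j hij r =>
    rw [gradCoord, key]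
    exact of_tri _ (tri _ (strictLower_lowerPart _).lowerTri)
  | tor i r =>
    rw [gradCoord, key]
    refine of_tri _ (tri _ fun k l hkl => ?_)
    rw [polyPart, Matrix.sub_apply, truncMat_apply, Matrix.sub_apply, Matrix.single_apply_of_ne,
      Matrix.single_apply_of_ne, sub_zero, trunc_zero, sub_zero]
    · rintro ⟨rfl, rfl⟩
      exact lt_irrefl _ hkl
    · rintro ⟨rfl, rfl⟩
      exact lt_irrefl _ hkl
  | low i j hij r =>
    rw [gradCoord, key]
    set q := polyPart (Matrix.single j i (tPow _ r) * lowMat (univ n)) with hq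
    set Z := borMat μ (univ n) * q * borInv μ (univ n) with hZ
    have e : borInv μ (univ n) * upperPart Z * borMat μ (univ n) =
        q - borInv μ (univ n) * (Z - upperPart Z) * borMat μ (univ n) := by
      have : borInv μ (univ n) * Z * borMat μ (univ n) = q := by
        rw [hZ]
        calc _ = (borInv μ (univ n) * borMat μ (univ n)) * q *
              (borInv μ (univ n) * borMat μ (univ n)) := by noncomm_ring
          _ = q := by rw [borInv_mul_borMat, one_mul, mul_one]
      rw [mul_sub, sub_mul, this]
      abel
    intro k l hkl
    rw [e, Matrix.sub_apply, tri _ (lowerTri_sub_upperPart Z) k l hkl, sub_zero]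
    exact polyMat_polyPart _ k l

/-- The gradients are orthogonal to the scalar directions. -/
theorem trace_mul_gradCoord (c : Coord n) :
    (sliceMat μ (univ n) * gradCoord μ c).trace = 0 := by
  have key : ∀ Z : LoopMat n,
      (sliceMat μ (univ n) * (borInv μ (univ n) * Z * upInv (univ n))).trace = Z.trace := by
    intro Z
    rw [sliceMat_eq]
    exact trace_mul_conj (upInv_mul_upMat _) (borMat_mul_borInv μ _) Z
  cases c with
  | up i j hij r => rw [gradCoord, key, (strictLower_lowerPart _).trace_eq_zero]
  | tor i r =>
    rw [gradCoord, key]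
    exact trace_polyPart_single_sub _ _ _
  | low i j hij r => rw [gradCoord, key, (strictUpper_upperPart _).trace_eq_zero]

/-- A property of matrices holds for the gradients of all functions if it holds for those of the
coordinates and is linear. -/
theorem grad_induction {p : LoopMat n → Prop} (h0 : p 0) (hadd : ∀ X Y, p X → p Y → p (X + Y))
    (hsmul : ∀ (a : CoordRing n) X, p X → p (a • X)) (hX : ∀ c, p (gradCoord μ c))
    (f : CoordRing n) : p (grad μ f) := by
  induction f using MvPolynomial.induction_on with
  | C a => rwa [grad_C]
  | add f g hf hg => rw [map_add]; exact hadd _ _ hf hg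
  | mul_X f c hf =>
    rw [Derivation.leibniz, grad_X]
    exact hadd _ _ (hsmul _ _ (hX c)) (hsmul _ _ hf)

theorem isPoly_smul {R : Type*} [CommRing R] (a : R) {f : LaurentSeries R} (hf : IsPoly f) :
    IsPoly (a • f) := fun m hm => by rw [HahnSeries.coeff_smul, hf m hm, smul_zero]

theorem lowerIsPoly_mul_grad (f : CoordRing n) :
    LowerIsPoly (sliceMat μ (univ n) * grad μ f) := by
  refine grad_induction μ (p := fun X => LowerIsPoly (sliceMat μ (univ n) * X)) ?_ ?_ ?_
    (lowerIsPoly_mul_gradCoord μ) f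
  · rw [mul_zero]
    exact fun _ _ _ => isPoly_zero
  · intro X Y hX hY i j hij
    rw [mul_add]
    exact (hX i j hij).add (hY i j hij)
  · intro a X hX i j hij
    rw [mul_smul_mat]
    exact isPoly_smul a (hX i j hij)

theorem upperIsPoly_grad_mul (f : CoordRing n) :
    UpperIsPoly (grad μ f * sliceMat μ (univ n)) := by
  refine grad_induction μ (p := fun X => UpperIsPoly (X * sliceMat μ (univ n))) ?_ ?_ ?_
    (upperIsPoly_gradCoord_mul μ) f
  · rw [zero_mul]
    exact fun _ _ _ => isPoly_zero
  · intro X Y hX hY i j hij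
    rw [add_mul]
    exact (hX i j hij).add (hY i j hij)
  · intro a X hX i j hij
    rw [smul_mul_mat]
    exact isPoly_smul a (hX i j hij)

theorem trace_mul_grad (f : CoordRing n) : (sliceMat μ (univ n) * grad μ f).trace = 0 := by
  refine grad_induction μ (p := fun X => (sliceMat μ (univ n) * X).trace = 0) ?_ ?_ ?_
    (trace_mul_gradCoord μ) f
  · rw [mul_zero, Matrix.trace_zero]
  · intro X Y hX hY
    rw [mul_add, Matrix.trace_add, hX, hY, add_zero]
  · intro a X hX
    rw [mul_smul_mat, trace_smul_mat, hX, smul_zero]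

end GradientFormula
/-! ### Variations of the factors of a point -/

section Variation

variable {n : ℕ} {R S : Type*} [CommRing R] [CommRing S]

/-- The pairing of `X ∈ 𝔫((t⁻¹))` with the gradient of an entry of `u`. The right hand side is a
coefficient of the variation of `u` along `X`, made tangent to `N₁[[t⁻¹]]`, when `e` is `t^r` times
an elementary matrix. -/
theorem res_mul_strictLower {u ui e L X : LMat n R} (hX : StrictUpper X)
    (hZ : UpperTri (ui * polyPart (u * e) * u - L)) :
    res (X * L) = res (truncMat (u * X * ui) * u * e) := by
  have h := res_strictUpper_mul_upperTri hX hZ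
  rw [mul_sub, map_sub, sub_eq_zero] at h
  calc res (X * L) = res (X * (ui * polyPart (u * e)) * u) := by rw [← h]; congr 1; noncomm_ring
    _ = res (u * (X * (ui * polyPart (u * e)))) := res_comm _ _
    _ = res (u * X * ui * polyPart (u * e)) := by congr 1; noncomm_ring
    _ = res (truncMat (u * X * ui) * u * e) := by
          rw [← res_truncMat_mul]; congr 1; noncomm_ring

/-- The pairing of `X ∈ 𝔫₋((t⁻¹))` with the gradient of an entry of `l`, with `m = h t^μ l`. -/
theorem res_mul_strictUpper {m mi l e L X : LMat n R} (hX : StrictLower X)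
    (hZ : LowerTri (m * polyPart (e * l) * mi - L)) :
    res (X * L) = res (l * truncMat (mi * X * m) * e) := by
  have h := res_strictLower_mul_lowerTri hX hZ
  rw [mul_sub, map_sub, sub_eq_zero] at h
  calc res (X * L) = res (X * m * polyPart (e * l) * mi) := by rw [← h]; congr 1; noncomm_ring
    _ = res (mi * (X * m * polyPart (e * l))) := res_comm _ _
    _ = res (mi * X * m * polyPart (e * l)) := by congr 1; noncomm_ring
    _ = res (truncMat (mi * X * m) * (e * l)) := by rw [← res_truncMat_mul]
    _ = res (truncMat (mi * X * m) * e * l) := congrArg res (mul_assoc _ _ _).symm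
    _ = res (l * (truncMat (mi * X * m) * e)) := res_comm _ _
    _ = _ := congrArg res (mul_assoc _ _ _).symm

/-- The pairing of a variation of `u d l` with a gradient, in terms of the variations of the three
factors. -/
theorem res_variation {u ui d di l li du dd dl : LMat n R} (hu : ui * u = 1) (hl : l * li = 1)
    (hd : d * di = 1) (L : LMat n R) :
    res ((u * (d * dl + dd * l) + du * (d * l)) * ((li * di) * L * ui)) =
      res (ui * du * L) + res (dd * di * L) + res (d * dl * li * di * L) := by
  have e1 : (u * (d * dl + dd * l) + du * (d * l)) * ((li * di) * L * ui) =
      (u * (d * dl * li * di + dd * (l * li) * di) + du * (d * (l * li) * di)) * L * ui := by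
    noncomm_ring
  have e2 : (u * (d * dl * li * di + dd * (l * li) * di) + du * (d * (l * li) * di)) * L =
      u * (d * dl * li * di * L + dd * di * L) + du * L := by
    rw [hl, mul_one, mul_one, hd]; noncomm_ring
  have e3 : ui * (u * (d * dl * li * di * L + dd * di * L) + du * L) =
      d * dl * li * di * L + dd * di * L + ui * du * L := by
    rw [mul_add, ← mul_assoc, hu, one_mul]; noncomm_ring
  rw [e1, e2, res_comm, e3, map_add, map_add]
  ring

theorem coeff_mul_tPow_one (f : LaurentSeries R) (r : ℕ) :
    (f * tPow R r).coeff 1 = f.coeff ((r : ℤ) + 1) := by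
  rw [mul_comm, coeff_tPow_mul, add_comm]

theorem smap_smul (θ : R →+* S) (a : R) (X : LMat n R) : smap θ (a • X) = θ a • smap θ X := by
  ext1 i j
  ext m
  exact map_mul θ _ _

theorem smap_single (θ : R →+* S) (i j) (f : LaurentSeries R) :
    smap θ (Matrix.single i j f : LMat n R) = Matrix.single i j (lmap θ f) := by
  ext1 k l
  rw [smap_apply, Matrix.single_apply, Matrix.single_apply]
  split_ifs
  · rfl
  · exact map_zero _

theorem smap_polyPart (θ : R →+* S) (X : LMat n R) :
    smap θ (polyPart X) = polyPart (smap θ X) := by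
  rw [polyPart, polyPart, map_sub, truncMat_smap]

theorem UpperTri.smap {X : LMat n R} (h : UpperTri X) (θ : R →+* S) : UpperTri (smap θ X) :=
  fun i j hij => by rw [smap_apply, h i j hij, map_zero]

theorem LowerTri.smap {X : LMat n R} (h : LowerTri X) (θ : R →+* S) : LowerTri (smap θ X) :=
  fun i j hij => by rw [smap_apply, h i j hij, map_zero]

theorem StrictUpper.smap {X : LMat n R} (h : StrictUpper X) (θ : R →+* S) :
    StrictUpper (smap θ X) :=
  fun i j hij => by rw [smap_apply, h i j hij, map_zero]

theorem StrictLower.smap {X : LMat n R} (h : StrictLower X) (θ : R →+* S) :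
    StrictLower (smap θ X) :=
  fun i j hij => by rw [smap_apply, h i j hij, map_zero]

theorem smap_conj_borInv {θ : CoordRing n →+* S} (μ : Fin (n + 1) → ℤ) (L : LoopMat n) :
    smap θ (borInv μ (univ n) * L * upInv (univ n)) =
      (smap θ (lowInv (univ n)) * smap θ (torInv μ (univ n))) * smap θ L *
        smap θ (upInv (univ n)) := by
  rw [map_mul, map_mul, borInv, map_mul]

end Variation

/-! ### Derivations of the coordinate ring -/

section DerivationFormula

variable {n : ℕ} {E : Type*} [CommRing E]

/-- `D` is a derivation of the coordinate ring, along the homomorphism `θ`, which kills the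
constants. -/
structure IsDerivAlong (θ : CoordRing n →+* E) (D : CoordRing n →+ E) : Prop where
  leibniz : ∀ f g, D (f * g) = θ f * D g + D f * θ g
  map_C : ∀ a : ℂ, D (MvPolynomial.C a) = 0

variable {θ : CoordRing n →+* E} {D : CoordRing n →+ E}

theorem IsDerivAlong.map_one (h : IsDerivAlong θ D) : D 1 = 0 := h.map_C 1

theorem IsDerivAlong.cmap_one (h : IsDerivAlong θ D) : cmap D 1 = 0 := by
  ext m
  rw [coeff_cmap, HahnSeries.coeff_one]
  split_ifs
  · exact h.map_one
  · exact map_zero D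

theorem IsDerivAlong.cmap_tPow (h : IsDerivAlong θ D) (m : ℤ) : cmap D (tPow _ m) = 0 := by
  ext k
  rw [coeff_cmap, tPow, HahnSeries.coeff_single]
  split_ifs
  · exact h.map_one
  · exact map_zero D

theorem cmap_principal (D : CoordRing n →+ E) (c : ℕ → CoordRing n) :
    cmap D (principal c) = principal (D ∘ c) := by
  ext m
  rw [coeff_cmap, coeff_principal, coeff_principal]
  split_ifs
  · rfl
  · exact map_zero D

variable (h : IsDerivAlong θ D)
include h

theorem IsDerivAlong.dmap_upMat_apply (i j) : dmap D (upMat (univ n)) i j =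
    if hij : i < j then principal fun r => D (MvPolynomial.X (.up i j hij r)) else 0 := by
  rw [dmap_apply, upMat]
  split_ifs
  · exact cmap_principal D _
  · exact h.cmap_one
  · exact map_zero _

theorem IsDerivAlong.dmap_lowMat_apply (i j) : dmap D (lowMat (univ n)) i j =
    if hij : j < i then principal fun r => D (MvPolynomial.X (.low i j hij r)) else 0 := by
  rw [dmap_apply, lowMat]
  split_ifs
  · exact cmap_principal D _
  · exact h.cmap_one
  · exact map_zero _

theorem IsDerivAlong.cmap_torEntry_zero : cmap D (torEntry (univ n) 0) = 0 := by
  rw [torEntry_zero, h.cmap_one]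

theorem IsDerivAlong.cmap_torEntry_succ (i : Fin n) : cmap D (torEntry (univ n) i.succ) =
    principal fun r => D (MvPolynomial.X (.tor i r)) := by
  rw [torEntry_succ, map_add, h.cmap_one, zero_add, cmap_principal]
  rfl

theorem IsDerivAlong.strictUpper_dmap_upMat : StrictUpper (dmap D (upMat (univ n))) :=
  fun i j hij => by rw [h.dmap_upMat_apply, dif_neg (not_lt.mpr hij)]

theorem IsDerivAlong.strictLower_dmap_lowMat : StrictLower (dmap D (lowMat (univ n))) :=
  fun i j hij => by rw [h.dmap_lowMat_apply, dif_neg (not_lt.mpr hij)]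

theorem IsDerivAlong.matGe_dmap_upMat : MatGe 1 (dmap D (upMat (univ n))) := fun i j => by
  rw [h.dmap_upMat_apply]
  split_ifs
  · exact ordGe_principal _
  · exact ordGe_zero 1

theorem IsDerivAlong.matGe_dmap_lowMat : MatGe 1 (dmap D (lowMat (univ n))) := fun i j => by
  rw [h.dmap_lowMat_apply]
  split_ifs
  · exact ordGe_principal _
  · exact ordGe_zero 1

theorem IsDerivAlong.dmap_torMat (μ : Fin (n + 1) → ℤ) : dmap D (torMat μ (univ n)) =
    Matrix.diagonal fun i => cmap D (torEntry (univ n) i) * tPow E (μ i) := by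
  ext1 i j
  rw [dmap_apply, torMat, Matrix.diagonal_apply, Matrix.diagonal_apply]
  split_ifs
  · rw [cmap_mul h.leibniz, h.cmap_tPow, mul_zero, zero_add, lmap_tPow]
  · exact map_zero _

theorem IsDerivAlong.dmap_sliceMat (μ : Fin (n + 1) → ℤ) : dmap D (sliceMat μ (univ n)) =
    smap θ (upMat (univ n)) * (smap θ (torMat μ (univ n)) * dmap D (lowMat (univ n)) +
      dmap D (torMat μ (univ n)) * smap θ (lowMat (univ n))) +
    dmap D (upMat (univ n)) * (smap θ (torMat μ (univ n)) * smap θ (lowMat (univ n))) := by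
  rw [sliceMat, mul_assoc, dmap_mul h.leibniz, dmap_mul h.leibniz, map_mul]

theorem IsDerivAlong.map_up (μ : Fin (n + 1) → ℤ) (i j : Fin (n + 1)) (hij : i < j) (r : ℕ) :
    D (MvPolynomial.X (.up i j hij r)) =
      res (dmap D (sliceMat μ (univ n)) * smap θ (gradCoord μ (.up i j hij r))) := by
  have hu : smap θ (upInv (univ n)) * smap θ (upMat (univ n)) = 1 := by
    rw [← map_mul, upInv_mul_upMat, _root_.map_one]
  have hu' : smap θ (upMat (univ n)) * smap θ (upInv (univ n)) = 1 := mul_eq_one_comm.mp hu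
  have hl : smap θ (lowMat (univ n)) * smap θ (lowInv (univ n)) = 1 := by
    rw [← map_mul, lowMat_mul_lowInv, _root_.map_one]
  have hd : smap θ (torMat μ (univ n)) * smap θ (torInv μ (univ n)) = 1 := by
    rw [← map_mul, torMat_mul_torInv, _root_.map_one]
  rw [gradCoord, smap_conj_borInv, h.dmap_sliceMat, res_variation hu hl hd]
  set L := lowerPart (upInv (univ n) *
      polyPart (upMat (univ n) * Matrix.single j i (tPow _ r)) * upMat (univ n)) with hL
  have hL' : StrictLower (smap θ L) := (strictLower_lowerPart _).smap θ
  have hU : StrictUpper (smap θ (upInv (univ n)) * dmap D (upMat (univ n))) :=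
    ((upperUni_upInv _).1.smap θ).mul_strict h.strictUpper_dmap_upMat
  have t1 : res (dmap D (torMat μ (univ n)) * smap θ (torInv μ (univ n)) * smap θ L) = 0 := by
    refine res_eq_zero_of_trace (LowerTri.mul_strict (LowerTri.mul ?_ ?_) hL').trace_eq_zero
    · rw [h.dmap_torMat]
      exact fun _ _ hij => Matrix.diagonal_apply_ne _ hij.ne
    · exact (lowerTri_torInv μ _).smap θ
  have t2 : res (smap θ (torMat μ (univ n)) * dmap D (lowMat (univ n)) *
      smap θ (lowInv (univ n)) * smap θ (torInv μ (univ n)) * smap θ L) = 0 := by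
    refine res_eq_zero_of_trace (LowerTri.mul_strict (LowerTri.mul (LowerTri.mul (LowerTri.mul
      ?_ ?_) ?_) ?_) hL').trace_eq_zero
    · exact (lowerTri_torMat μ _).smap θ
    · exact h.strictLower_dmap_lowMat.lowerTri
    · exact (lowerUni_lowInv _).1.smap θ
    · exact (lowerTri_torInv μ _).smap θ
  have hZ : UpperTri (smap θ (upInv (univ n)) *
      polyPart (smap θ (upMat (univ n)) * Matrix.single j i (tPow E r)) *
        smap θ (upMat (univ n)) - smap θ L) := by
    have := (upperTri_sub_lowerPart (upInv (univ n) *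
      polyPart (upMat (univ n) * Matrix.single j i (tPow _ r)) * upMat (univ n))).smap θ
    rwa [map_sub, map_mul, map_mul, smap_polyPart, map_mul, smap_single, lmap_tPow] at this
  have hm : MatGe 1 (dmap D (upMat (univ n)) * smap θ (upInv (univ n))) :=
    MatGe.mul (k := 1) (l := 0) h.matGe_dmap_upMat
      fun i j => ((closeToOne_upInv (univ n)).matGe i j).lmap θ
  rw [t1, t2, add_zero, add_zero, res_mul_strictLower hU hZ]
  rw [← mul_assoc (smap θ (upMat (univ n))), hu', one_mul, truncMat_eq_self hm, mul_assoc,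
    mul_assoc, ← mul_assoc (smap θ (upInv (univ n))), hu, one_mul, res_mul_single,
    coeff_mul_tPow_one, h.dmap_upMat_apply, dif_pos hij, coeff_principal_succ]

theorem IsDerivAlong.map_low (μ : Fin (n + 1) → ℤ) (i j : Fin (n + 1)) (hij : j < i) (r : ℕ) :
    D (MvPolynomial.X (.low i j hij r)) =
      res (dmap D (sliceMat μ (univ n)) * smap θ (gradCoord μ (.low i j hij r))) := by
  have hu : smap θ (upInv (univ n)) * smap θ (upMat (univ n)) = 1 := by
    rw [← map_mul, upInv_mul_upMat, _root_.map_one]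
  have hl : smap θ (lowMat (univ n)) * smap θ (lowInv (univ n)) = 1 := by
    rw [← map_mul, lowMat_mul_lowInv, _root_.map_one]
  have hl' : smap θ (lowInv (univ n)) * smap θ (lowMat (univ n)) = 1 := mul_eq_one_comm.mp hl
  have hd : smap θ (torMat μ (univ n)) * smap θ (torInv μ (univ n)) = 1 := by
    rw [← map_mul, torMat_mul_torInv, _root_.map_one]
  have hd' : smap θ (torInv μ (univ n)) * smap θ (torMat μ (univ n)) = 1 := mul_eq_one_comm.mp hd
  rw [gradCoord, smap_conj_borInv, h.dmap_sliceMat, res_variation hu hl hd]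
  set L := upperPart (borMat μ (univ n) *
      polyPart (Matrix.single j i (tPow _ r) * lowMat (univ n)) * borInv μ (univ n)) with hL
  have hL' : StrictUpper (smap θ L) := (strictUpper_upperPart _).smap θ
  have t1 : res (smap θ (upInv (univ n)) * dmap D (upMat (univ n)) * smap θ L) = 0 :=
    res_eq_zero_of_trace (UpperTri.mul_strict (((upperUni_upInv _).1.smap θ).mul
      h.strictUpper_dmap_upMat.upperTri) hL').trace_eq_zero
  have t2 : res (dmap D (torMat μ (univ n)) * smap θ (torInv μ (univ n)) * smap θ L) = 0 := by
    refine res_eq_zero_of_trace (UpperTri.mul_strict (UpperTri.mul ?_ ?_) hL').trace_eq_zero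
    · rw [h.dmap_torMat]
      exact fun _ _ hij => Matrix.diagonal_apply_ne _ hij.ne'
    · exact UpperTri.smap (fun _ _ hij => torInv_apply_ne μ _ hij.ne') θ
  have hU : StrictLower (smap θ (torMat μ (univ n)) * dmap D (lowMat (univ n)) *
      smap θ (lowInv (univ n)) * smap θ (torInv μ (univ n))) :=
    ((((lowerTri_torMat μ _).smap θ).mul_strict h.strictLower_dmap_lowMat).mul_lowerTri
      ((lowerUni_lowInv _).1.smap θ)).mul_lowerTri ((lowerTri_torInv μ _).smap θ)
  have hZ : LowerTri ((smap θ (torMat μ (univ n)) * smap θ (lowMat (univ n))) *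
      polyPart (Matrix.single j i (tPow E r) * smap θ (lowMat (univ n))) *
      (smap θ (lowInv (univ n)) * smap θ (torInv μ (univ n))) - smap θ L) := by
    have := (lowerTri_sub_upperPart (borMat μ (univ n) *
      polyPart (Matrix.single j i (tPow _ r) * lowMat (univ n)) * borInv μ (univ n))).smap θ
    rwa [map_sub, map_mul, map_mul, smap_polyPart, map_mul (smap θ) (Matrix.single j i _),
      smap_single, lmap_tPow, borMat, borInv, map_mul, map_mul (smap θ) (lowInv _)] at this
  have hm : MatGe 1 (smap θ (lowInv (univ n)) * dmap D (lowMat (univ n))) :=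
    MatGe.mul (k := 0) (l := 1)
      (fun i j => ((closeToOne_lowInv (univ n)).matGe i j).lmap θ) h.matGe_dmap_lowMat
  rw [t1, t2, zero_add, zero_add, res_mul_strictUpper hU hZ]
  generalize smap θ (torMat μ (univ n)) = d at *
  generalize smap θ (torInv μ (univ n)) = di at *
  have hl2 : smap θ (lowMat (univ n)) * (smap θ (lowInv (univ n)) * dmap D (lowMat (univ n))) =
      dmap D (lowMat (univ n)) := by rw [← mul_assoc, hl, one_mul]
  have hw : ∀ X : LMat n E,
      smap θ (lowInv (univ n)) * di * (d * X * smap θ (lowInv (univ n)) * di) *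
        (d * smap θ (lowMat (univ n))) = smap θ (lowInv (univ n)) * X := by
    intro X
    calc _ = smap θ (lowInv (univ n)) * (di * d) * X * (smap θ (lowInv (univ n)) * (di * d) *
          smap θ (lowMat (univ n))) := by noncomm_ring
      _ = _ := by rw [hd', mul_one, hl', mul_one]
  rw [hw, truncMat_eq_self hm, hl2, res_mul_single,
    coeff_mul_tPow_one, h.dmap_lowMat_apply, dif_pos hij, coeff_principal_succ]

end DerivationFormula
/-! ### The variation of the torus factor -/

section TorusVariation

variable {n : ℕ} {R E : Type*} [CommRing R] [CommRing E]

theorem torEntry_mul_torInv (μ : Fin (n + 1) → ℤ) (x : Coord n → R) (i) :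
    torEntry x i * tPow R (μ i) * torInv μ x i i = 1 := by
  have h := congrFun (congrFun (torMat_mul_torInv μ x) i) i
  rwa [torMat, Matrix.diagonal_mul, Matrix.one_apply_eq] at h

theorem ordGe_tPow_mul_torInv (μ : Fin (n + 1) → ℤ) (x : Coord n → R) (i) :
    OrdGe 0 (tPow R (μ i) * torInv μ x i i) := by
  obtain ⟨g, hg, hg'⟩ := exists_inv_of_ordGe_sub_one (ordGe_torEntry_sub_one x i)
  have h := torEntry_mul_torInv μ x i
  have : tPow R (μ i) * torInv μ x i i = g := by
    linear_combination g * h - (tPow R (μ i) * torInv μ x i i) * hg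
  rw [this]
  have := (hg'.mono (show (0 : ℤ) ≤ 1 by norm_num)).add ordGe_one
  rwa [sub_add_cancel] at this

variable {θ : CoordRing n →+* E} {D : CoordRing n →+ E} (h : IsDerivAlong θ D)
include h

theorem IsDerivAlong.ordGe_cmap_torEntry (i) : OrdGe 1 (cmap D (torEntry (univ n) i)) := by
  refine Fin.cases ?_ (fun i => ?_) i
  · rw [h.cmap_torEntry_zero]
    exact ordGe_zero 1
  · rw [h.cmap_torEntry_succ]
    exact ordGe_principal _

theorem IsDerivAlong.dmap_torMat_mul_torInv (μ : Fin (n + 1) → ℤ) (i j) :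
    (dmap D (torMat μ (univ n)) * smap θ (torInv μ (univ n))) i j = if i = j then
      cmap D (torEntry (univ n) i) * lmap θ (tPow _ (μ i) * torInv μ (univ n) i i) else 0 := by
  rw [h.dmap_torMat, Matrix.diagonal_mul, smap_apply]
  split_ifs with hij
  · subst hij
    rw [map_mul, lmap_tPow, mul_assoc]
  · rw [torInv_apply_ne μ _ hij, map_zero, mul_zero]

theorem IsDerivAlong.map_tor (μ : Fin (n + 1) → ℤ) (i : Fin n) (r : ℕ) :
    D (MvPolynomial.X (.tor i r)) =
      res (dmap D (sliceMat μ (univ n)) * smap θ (gradCoord μ (.tor i r))) := by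
  have hu : smap θ (upInv (univ n)) * smap θ (upMat (univ n)) = 1 := by
    rw [← map_mul, upInv_mul_upMat, _root_.map_one]
  have hl : smap θ (lowMat (univ n)) * smap θ (lowInv (univ n)) = 1 := by
    rw [← map_mul, lowMat_mul_lowInv, _root_.map_one]
  have hd : smap θ (torMat μ (univ n)) * smap θ (torInv μ (univ n)) = 1 := by
    rw [← map_mul, torMat_mul_torInv, _root_.map_one]
  rw [gradCoord, smap_conj_borInv, h.dmap_sliceMat, res_variation hu hl hd]
  set q := torEntry (univ n) i.succ * tPow (CoordRing n) r with hq
  set L : LoopMat n := Matrix.single i.succ i.succ q - Matrix.single 0 0 q with hL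
  have hLd : ∀ k l, k ≠ l → polyPart L k l = 0 := by
    intro k l hkl
    rw [polyPart, Matrix.sub_apply, truncMat_apply, hL, Matrix.sub_apply,
      Matrix.single_apply_of_ne, Matrix.single_apply_of_ne, sub_zero, trunc_zero, sub_zero]
    · rintro ⟨rfl, rfl⟩
      exact hkl rfl
    · rintro ⟨rfl, rfl⟩
      exact hkl rfl
  have hLu : UpperTri (smap θ (polyPart L)) := UpperTri.smap (fun k l hkl => hLd k l hkl.ne') θ
  have hLl : LowerTri (smap θ (polyPart L)) := LowerTri.smap (fun k l hkl => hLd k l hkl.ne) θ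
  have t1 : res (smap θ (upInv (univ n)) * dmap D (upMat (univ n)) *
      smap θ (polyPart L)) = 0 :=
    res_strictUpper_mul_upperTri
      (((upperUni_upInv _).1.smap θ).mul_strict h.strictUpper_dmap_upMat) hLu
  have t2 : res (smap θ (torMat μ (univ n)) * dmap D (lowMat (univ n)) *
      smap θ (lowInv (univ n)) * smap θ (torInv μ (univ n)) * smap θ (polyPart L)) = 0 :=
    res_strictLower_mul_lowerTri (((((lowerTri_torMat μ _).smap θ).mul_strict
      h.strictLower_dmap_lowMat).mul_lowerTri ((lowerUni_lowInv _).1.smap θ)).mul_lowerTri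
        ((lowerTri_torInv μ _).smap θ)) hLl
  have hm : MatGe 1 (dmap D (torMat μ (univ n)) * smap θ (torInv μ (univ n))) := by
    intro k l
    rw [h.dmap_torMat_mul_torInv]
    split_ifs
    · exact (h.ordGe_cmap_torEntry k).mul' ((ordGe_tPow_mul_torInv μ _ k).lmap θ) (by norm_num)
    · exact ordGe_zero 1
  rw [t1, t2, zero_add, add_zero, smap_polyPart, res_mul_polyPart_of_matGe hm, hL, map_sub,
    smap_single, smap_single, mul_sub, map_sub, res_mul_single, res_mul_single,
    h.dmap_torMat_mul_torInv, h.dmap_torMat_mul_torInv, if_pos rfl, if_pos rfl,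
    h.cmap_torEntry_zero, zero_mul, zero_mul, HahnSeries.coeff_zero, sub_zero, mul_assoc,
    ← map_mul, hq]
  have e : tPow _ (μ i.succ) * torInv μ (univ n) i.succ i.succ *
      (torEntry (univ n) i.succ * tPow _ r) = tPow _ r := by
    linear_combination tPow (CoordRing n) r * torEntry_mul_torInv μ (univ n) i.succ
  rw [e, lmap_tPow, coeff_mul_tPow_one, h.cmap_torEntry_succ, coeff_principal_succ]

/-- The defining property of the gradient: it computes the derivatives of functions from the
variation of the universal point, along every derivation. -/
theorem IsDerivAlong.map_eq_res (μ : Fin (n + 1) → ℤ) (f : CoordRing n) :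
    D f = res (dmap D (sliceMat μ (univ n)) * smap θ (grad μ f)) := by
  induction f using MvPolynomial.induction_on with
  | C a => rw [h.map_C, grad_C, map_zero, mul_zero, map_zero]
  | add f g hf hg => rw [map_add, hf, hg, map_add, map_add, mul_add, map_add]
  | mul_X f c hf =>
    have hX : D (MvPolynomial.X c) =
        res (dmap D (sliceMat μ (univ n)) * smap θ (gradCoord μ c)) := by
      cases c with
      | up i j hij r => exact h.map_up μ i j hij r
      | tor i r => exact h.map_tor μ i r
      | low i j hij r => exact h.map_low μ i j hij r
    rw [Derivation.leibniz, map_add, smap_smul, smap_smul, mul_add, mul_smul_mat, mul_smul_mat,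
      map_add, res_smul, res_smul, grad_X, ← hX, ← hf, h.leibniz, mul_comm (D f)]

end TorusVariation
/-! ### Vector fields, gradients and the bracket -/

theorem res_mul_conj_eq {n : ℕ} {R : Type*} [CommRing R] (Y L li di ui : LMat n R) :
    res (Y * (li * di * L * ui)) = res (ui * Y * li * di * L) := by
  calc _ = res (Y * (li * di) * L * ui) := by congr 1; noncomm_ring
    _ = res (ui * (Y * (li * di) * L)) := res_comm _ _
    _ = _ := by congr 1; noncomm_ring

section VectorField

variable {n : ℕ} (μ : Fin (n + 1) → ℤ)

theorem gaussPart_eq (Y : LoopMat n) :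
    gaussPart μ Y = upInv (univ n) * Y * lowInv (univ n) * torInv μ (univ n) := rfl

theorem varUp_eq (Y : LoopMat n) : varUp μ Y =
    truncMat (upMat (univ n) * upperPart (gaussPart μ Y) * upInv (univ n)) * upMat (univ n) := rfl

theorem varLow_eq (Y : LoopMat n) : varLow μ Y = lowMat (univ n) *
    truncMat (lowInv (univ n) * (torInv μ (univ n) * lowerPart (gaussPart μ Y) *
      torMat μ (univ n)) * lowMat (univ n)) := rfl

theorem res_mul_conj (Y L : LoopMat n) :
    res (Y * (borInv μ (univ n) * L * upInv (univ n))) = res (gaussPart μ Y * L) := by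
  rw [gaussPart_eq, borInv, res_mul_conj_eq]

theorem vectorField_up (Y : LoopMat n) (i j : Fin (n + 1)) (hij : i < j) (r : ℕ) :
    (varUp μ Y i j).coeff ((r : ℤ) + 1) = res (Y * gradCoord μ (.up i j hij r)) := by
  rw [gradCoord, res_mul_conj]
  set L := lowerPart (upInv (univ n) *
      polyPart (upMat (univ n) * Matrix.single j i (tPow _ r)) * upMat (univ n)) with hL
  have e := res_strictLower_mul_lowerTri (strictLower_lowerPart (upInv (univ n) *
      polyPart (upMat (univ n) * Matrix.single j i (tPow _ r)) * upMat (univ n)))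
      (lowerTri_sub_upperPart (gaussPart μ Y))
  rw [← hL, mul_sub, map_sub, sub_eq_zero] at e
  rw [res_comm, e, res_comm, res_mul_strictLower (strictUpper_upperPart _)
    (upperTri_sub_lowerPart _), res_mul_single, coeff_mul_tPow_one, varUp_eq]

theorem vectorField_low (Y : LoopMat n) (i j : Fin (n + 1)) (hij : j < i) (r : ℕ) :
    (varLow μ Y i j).coeff ((r : ℤ) + 1) = res (Y * gradCoord μ (.low i j hij r)) := by
  rw [gradCoord, res_mul_conj]
  set L := upperPart (borMat μ (univ n) *
      polyPart (Matrix.single j i (tPow _ r) * lowMat (univ n)) * borInv μ (univ n)) with hL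
  have e := res_strictUpper_mul_upperTri (strictUpper_upperPart (borMat μ (univ n) *
      polyPart (Matrix.single j i (tPow _ r) * lowMat (univ n)) * borInv μ (univ n)))
      (upperTri_sub_lowerPart (gaussPart μ Y))
  rw [← hL, mul_sub, map_sub, sub_eq_zero] at e
  rw [res_comm, e, res_comm, res_mul_strictUpper (strictLower_lowerPart _)
    (lowerTri_sub_upperPart _), res_mul_single, coeff_mul_tPow_one, varLow_eq, borInv, borMat]
  simp only [mul_assoc]

theorem vectorField_tor (Y : LoopMat n) (i : Fin n) (r : ℕ) :
    (varTor μ Y i.succ).coeff ((r : ℤ) + 1) = res (Y * gradCoord μ (.tor i r)) := by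
  rw [gradCoord, res_mul_conj, ← res_truncMat_mul, mul_sub, map_sub, res_mul_single,
    res_mul_single, ← HahnSeries.coeff_sub, ← sub_mul, varTor, ← coeff_mul_tPow_one]
  have e : trunc (gaussPart μ Y i.succ i.succ - gaussPart μ Y 0 0) =
      truncMat (gaussPart μ Y) i.succ i.succ - truncMat (gaussPart μ Y) 0 0 := by
    rw [eq_sub_iff_add_eq, truncMat_apply, truncMat_apply, ← trunc_add, sub_add_cancel]
  rw [e]
  congr 1
  ring

/-- The vector field of a field `Y` of tangent vectors differentiates a function by pairing `Y`
with its gradient. -/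
theorem vectorField_apply (Y : LoopMat n) (f : CoordRing n) :
    vectorField μ Y f = res (Y * grad μ f) := by
  induction f using MvPolynomial.induction_on with
  | C a =>
    rw [grad_C, mul_zero, map_zero]
    exact (vectorField μ Y).map_algebraMap a
  | add f g hf hg => rw [map_add, hf, hg, map_add, mul_add, map_add]
  | mul_X f c hf =>
    have hX : vectorField μ Y (MvPolynomial.X c) = res (Y * gradCoord μ c) := by
      rw [vectorField, MvPolynomial.mkDerivation_X]
      cases c with
      | up i j hij r => exact vectorField_up μ Y i j hij r
      | tor i r => exact vectorField_tor μ Y i r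
      | low i j hij r => exact vectorField_low μ Y i j hij r
    rw [Derivation.leibniz, Derivation.leibniz, mul_add, mul_smul_mat, mul_smul_mat,
      map_add, res_smul, res_smul, grad_X, ← hX, ← hf, smul_eq_mul, smul_eq_mul]

theorem gradLeft_eq (f : CoordRing n) :
    gradLeft μ f = truncMat (sliceMat μ (univ n) * grad μ f) := by
  ext1 i j
  rw [gradLeft, truncMat_apply, trunc]
  congr 1
  funext r
  rw [vectorField_apply, coe_sliceGL, mul_assoc, res_comm, loopE, res_mul_single,
    coeff_mul_tPow_one]

theorem gradRight_eq (f : CoordRing n) :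
    gradRight μ f = truncMat (grad μ f * sliceMat μ (univ n)) := by
  ext1 i j
  rw [gradRight, truncMat_apply, trunc]
  congr 1
  funext r
  rw [vectorField_apply, coe_sliceGL, res_comm, ← mul_assoc, loopE, res_mul_single,
    coeff_mul_tPow_one]

/-- The tangent vector field of the Hamiltonian `f`. -/
def hamField (f : CoordRing n) : LoopMat n :=
  (residue n (CoordRing n)).field (sliceMat μ (univ n)) (grad μ f)

theorem hamField_eq (f : CoordRing n) :
    hamField μ f = gradLeft μ f * sliceMat μ (univ n) - sliceMat μ (univ n) * gradRight μ f := by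
  rw [hamField, SplitTrace.field, residue_P, residue_P, gradLeft_eq, gradRight_eq]

theorem hamiltonianField_eq (f : CoordRing n) :
    hamiltonianField μ f = vectorField μ (hamField μ f) := by
  rw [hamiltonianField, hamField_eq, coe_sliceGL]

theorem bracket_eq_br (f g : CoordRing n) : bracket μ f g =
    (residue n (CoordRing n)).br (sliceMat μ (univ n)) (grad μ f) (grad μ g) := by
  rw [bracket, hamiltonianField_eq, vectorField_apply]
  rfl

theorem bracket_skew (f g : CoordRing n) : bracket μ f g = -bracket μ g f := by
  rw [bracket_eq_br, bracket_eq_br, SplitTrace.br_skew]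

theorem upperTri_gradLeft (f : CoordRing n) : UpperTri (gradLeft μ f) := fun i j hij => by
  rw [gradLeft_eq, truncMat_apply, trunc_eq_zero (lowerIsPoly_mul_grad μ f i j hij)]

theorem lowerTri_gradRight (f : CoordRing n) : LowerTri (gradRight μ f) := fun i j hij => by
  rw [gradRight_eq, truncMat_apply, trunc_eq_zero (upperIsPoly_grad_mul μ f i j hij)]

theorem matGe_gradLeft (f : CoordRing n) : MatGe 1 (gradLeft μ f) := by
  rw [gradLeft_eq]
  exact matGe_truncMat _

theorem matGe_gradRight (f : CoordRing n) : MatGe 1 (gradRight μ f) := by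
  rw [gradRight_eq]
  exact matGe_truncMat _

theorem isDerivAlong_derivation (D : Derivation ℂ (CoordRing n) (CoordRing n)) :
    IsDerivAlong (RingHom.id _) (D : CoordRing n →+ CoordRing n) where
  leibniz f g := by
    change D (f * g) = f * D g + D f * g
    rw [Derivation.leibniz, smul_eq_mul, smul_eq_mul, mul_comm g]
  map_C a := D.map_algebraMap a

end VectorField
/-! ### The Jacobi identity -/

section Jacobi

variable {n : ℕ} {R S : Type*} [CommRing R] [CommRing S]

theorem gauss_of_field {u ui m mi lam rho : LMat n R} (hu : ui * u = 1) (hm : m * mi = 1) :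
    ui * (lam * (u * m) - u * m * rho) * mi = ui * lam * u - m * rho * mi := by
  calc _ = ui * lam * u * (m * mi) - (ui * u) * m * rho * mi := by noncomm_ring
    _ = _ := by rw [hu, hm, mul_one, one_mul]

theorem strictUpper_variation {u lam : LMat n R} (hu : UpperUni u) (hl : UpperTri lam) :
    StrictUpper (lam * u - u * Matrix.diagonal fun i => lam i i) := by
  have hd : UpperTri (Matrix.diagonal fun i => lam i i) :=
    fun _ _ h => Matrix.diagonal_apply_ne _ h.ne'
  refine .of_upperTri (fun i j h => ?_) fun i => ?_
  · rw [Matrix.sub_apply, hl.mul hu.1 i j h, hu.1.mul hd i j h, sub_zero]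
  · rw [Matrix.sub_apply, hl.mul_diag hu.1, hu.1.mul_diag hd, hu.2, Matrix.diagonal_apply_eq]
    ring

theorem strictLower_variation {l rho : LMat n R} (hl : LowerUni l) (hr : LowerTri rho) :
    StrictLower ((Matrix.diagonal fun i => rho i i) * l - l * rho) := by
  have hd : LowerTri (Matrix.diagonal fun i => rho i i) :=
    fun _ _ h => Matrix.diagonal_apply_ne _ h.ne
  refine .of_lowerTri (fun i j h => ?_) fun i => ?_
  · rw [Matrix.sub_apply, hl.1.mul hr i j h, hd.mul hl.1 i j h, sub_zero]
  · rw [Matrix.sub_apply, hl.1.mul_diag hr, hd.mul_diag hl.1, hl.2, Matrix.diagonal_apply_eq]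
    ring

theorem MatGe.diag {X : LMat n R} {k : ℤ} (h : MatGe k X) :
    MatGe k (Matrix.diagonal fun i => X i i) := fun i j => by
  rw [Matrix.diagonal_apply]
  split_ifs
  · exact h i i
  · exact ordGe_zero k

theorem truncMat_variation_up {u ui lam : LMat n R} (hu : u * ui = 1) (hc : CloseToOne u)
    (hc' : CloseToOne ui) (hl : MatGe 1 lam) :
    truncMat (u * (ui * lam * u - Matrix.diagonal fun i => lam i i) * ui) * u =
      lam * u - u * Matrix.diagonal fun i => lam i i := by
  set δ : LMat n R := Matrix.diagonal fun i => lam i i with hδ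
  have e : u * (ui * lam * u - δ) * ui = lam - u * δ * ui := by
    calc _ = (u * ui) * lam * (u * ui) - u * δ * ui := by noncomm_ring
      _ = _ := by rw [hu, one_mul, mul_one]
  have h : MatGe 1 (lam - u * δ * ui) :=
    hl.sub (MatGe.mul (k := 1) (l := 0) (MatGe.mul (k := 0) (l := 1) hc.matGe hl.diag) hc'.matGe)
  rw [e, truncMat_eq_self h, sub_mul, mul_assoc (u * δ), mul_eq_one_comm.mp hu, mul_one]

theorem truncMat_variation_low {l li d di rho : LMat n R} (hl : l * li = 1) (hd : d * di = 1)
    (hc : CloseToOne l) (hc' : CloseToOne li) (hr : MatGe 1 rho)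
    (hδ : (Matrix.diagonal fun i => rho i i) * d = d * Matrix.diagonal fun i => rho i i) :
    l * truncMat (li * (di * ((Matrix.diagonal fun i => rho i i) -
      d * l * rho * (li * di)) * d) * l) = (Matrix.diagonal fun i => rho i i) * l - l * rho := by
  set δ : LMat n R := Matrix.diagonal fun i => rho i i
  have e : li * (di * (δ - d * l * rho * (li * di)) * d) * l = li * δ * l - rho := by
    calc _ = li * di * (δ * d) * l - li * (di * d) * l * rho * li * (di * d) * l := by
          noncomm_ring
      _ = li * (di * d) * δ * l - li * (di * d) * l * rho * li * (di * d) * l := by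
          rw [hδ]; noncomm_ring
      _ = li * δ * l - (li * l) * rho * (li * l) := by
          rw [mul_eq_one_comm.mp hd, mul_one, mul_one]; noncomm_ring
      _ = _ := by rw [mul_eq_one_comm.mp hl, one_mul, mul_one]
  have h : MatGe 1 (li * δ * l - rho) :=
    (MatGe.mul (k := 1) (l := 0) (MatGe.mul (k := 0) (l := 1) hc'.matGe hr.diag) hc.matGe).sub hr
  rw [e, truncMat_eq_self h, mul_sub, ← mul_assoc, ← mul_assoc, hl, one_mul]

theorem smap_id (X : LMat n R) : smap (RingHom.id R) X = X := rfl

variable (μ : Fin (n + 1) → ℤ)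

theorem gaussPart_hamField (f : CoordRing n) : gaussPart μ (hamField μ f) =
    upInv (univ n) * gradLeft μ f * upMat (univ n) -
      borMat μ (univ n) * gradRight μ f * borInv μ (univ n) := by
  rw [gaussPart_eq, mul_assoc, ← borInv, hamField_eq, sliceMat_eq]
  exact gauss_of_field (upInv_mul_upMat _) (borMat_mul_borInv μ _)

theorem gaussPart_hamField_diag (f : CoordRing n) (i) : gaussPart μ (hamField μ f) i i =
    gradLeft μ f i i - gradRight μ f i i := by
  have h1 := ((upperUni_upInv (univ n)).1.mul (upperTri_gradLeft μ f)).mul_diag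
    (upperUni_upMat (univ n)).1 i
  rw [(upperUni_upInv _).1.mul_diag (upperTri_gradLeft μ f), (upperUni_upInv _).2,
    (upperUni_upMat _).2, one_mul, mul_one] at h1
  have h2 := ((lowerTri_borMat μ (univ n)).mul (lowerTri_gradRight μ f)).mul_diag
    (lowerTri_borInv μ (univ n)) i
  have h3 := (lowerTri_borMat μ (univ n)).mul_diag (lowerTri_borInv μ (univ n)) i
  rw [borMat_mul_borInv, Matrix.one_apply_eq] at h3
  rw [(lowerTri_borMat μ _).mul_diag (lowerTri_gradRight μ f)] at h2
  rw [gaussPart_hamField, Matrix.sub_apply, h1, h2]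
  linear_combination gradRight μ f i i * h3

theorem upperPart_gaussPart_hamField (f : CoordRing n) : upperPart (gaussPart μ (hamField μ f)) =
    upInv (univ n) * gradLeft μ f * upMat (univ n) -
      Matrix.diagonal fun i => gradLeft μ f i i := by
  have hU := ((upperUni_upInv (univ n)).1.mul (upperTri_gradLeft μ f)).mul
    (upperUni_upMat (univ n)).1
  have hL := ((lowerTri_borMat μ (univ n)).mul (lowerTri_gradRight μ f)).mul
    (lowerTri_borInv μ (univ n))
  ext1 i j
  rw [upperPart, Matrix.sub_apply]
  rcases lt_trichotomy i j with h | rfl | h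
  · rw [if_pos h, gaussPart_hamField, Matrix.sub_apply, hL i j h,
      Matrix.diagonal_apply_ne _ h.ne]
  · rw [if_neg (lt_irrefl _), Matrix.diagonal_apply_eq,
      ((upperUni_upInv (univ n)).1.mul (upperTri_gradLeft μ f)).mul_diag
      (upperUni_upMat (univ n)).1, (upperUni_upInv _).1.mul_diag (upperTri_gradLeft μ f),
      (upperUni_upInv _).2, (upperUni_upMat _).2, one_mul, mul_one, sub_self]
  · rw [if_neg h.asymm, hU i j h, Matrix.diagonal_apply_ne _ h.ne', sub_zero]

theorem lowerPart_gaussPart_hamField (f : CoordRing n) : lowerPart (gaussPart μ (hamField μ f)) =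
    (Matrix.diagonal fun i => gradRight μ f i i) -
      borMat μ (univ n) * gradRight μ f * borInv μ (univ n) := by
  have hU := ((upperUni_upInv (univ n)).1.mul (upperTri_gradLeft μ f)).mul
    (upperUni_upMat (univ n)).1
  have hL := ((lowerTri_borMat μ (univ n)).mul (lowerTri_gradRight μ f)).mul
    (lowerTri_borInv μ (univ n))
  ext1 i j
  rw [lowerPart, Matrix.sub_apply]
  rcases lt_trichotomy i j with h | rfl | h
  · rw [if_neg h.asymm, hL i j h, Matrix.diagonal_apply_ne _ h.ne, sub_zero]
  · have h2 := gaussPart_hamField_diag μ f i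
    have h1 := congrFun (congrFun (upperPart_gaussPart_hamField μ f) i) i
    rw [upperPart, if_neg (lt_irrefl _), Matrix.sub_apply, Matrix.diagonal_apply_eq] at h1
    rw [gaussPart_hamField, Matrix.sub_apply] at h2
    rw [if_neg (lt_irrefl _), Matrix.diagonal_apply_eq]
    linear_combination -h1 - h2
  · rw [if_pos h, gaussPart_hamField, Matrix.sub_apply, hU i j h,
      Matrix.diagonal_apply_ne _ h.ne']

theorem varUp_hamField (f : CoordRing n) : varUp μ (hamField μ f) =
    gradLeft μ f * upMat (univ n) -
      upMat (univ n) * Matrix.diagonal fun i => gradLeft μ f i i := by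
  rw [varUp_eq, upperPart_gaussPart_hamField]
  exact truncMat_variation_up (upMat_mul_upInv _) (closeToOne_upMat _) (closeToOne_upInv _)
    (matGe_gradLeft μ f)

theorem varLow_hamField (f : CoordRing n) : varLow μ (hamField μ f) =
    (Matrix.diagonal fun i => gradRight μ f i i) * lowMat (univ n) -
      lowMat (univ n) * gradRight μ f := by
  rw [varLow_eq, lowerPart_gaussPart_hamField]
  refine truncMat_variation_low (lowMat_mul_lowInv _) (torMat_mul_torInv μ _)
    (closeToOne_lowMat _) (closeToOne_lowInv _) (matGe_gradRight μ f) ?_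
  rw [torMat, Matrix.diagonal_mul_diagonal, Matrix.diagonal_mul_diagonal]
  congr 1
  funext i
  exact mul_comm _ _

/-- The scalar by which the Hamiltonian vector field differs from the lift `hamField`, because of
the normalization of the torus factor. -/
def hamScalar (f : CoordRing n) : LaurentSeries (CoordRing n) :=
  gradLeft μ f 0 0 - gradRight μ f 0 0

theorem varTor_hamField (f : CoordRing n) (i) : varTor μ (hamField μ f) i =
    torEntry (univ n) i * (gradLeft μ f i i - gradRight μ f i i - hamScalar μ f) := by
  rw [varTor, gaussPart_hamField_diag, gaussPart_hamField_diag, trunc_eq_self]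
  · rfl
  · exact ((matGe_gradLeft μ f i i).sub (matGe_gradRight μ f i i)).sub
      ((matGe_gradLeft μ f 0 0).sub (matGe_gradRight μ f 0 0))

theorem isDerivAlong_hamiltonianField (f : CoordRing n) :
    IsDerivAlong (RingHom.id _) (hamiltonianField μ f : CoordRing n →+ CoordRing n) :=
  isDerivAlong_derivation _

theorem hamiltonianField_X (f : CoordRing n) (c : Coord n) :
    hamiltonianField μ f (MvPolynomial.X c) = match c with
    | .up i j _ r => (varUp μ (hamField μ f) i j).coeff ((r : ℤ) + 1)
    | .tor i r => (varTor μ (hamField μ f) i.succ).coeff ((r : ℤ) + 1)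
    | .low i j _ r => (varLow μ (hamField μ f) i j).coeff ((r : ℤ) + 1) := by
  rw [hamiltonianField_eq, vectorField]
  exact (MvPolynomial.mkDerivation_X _ _ _).trans (by cases c <;> rfl)

/-- Under a Hamiltonian flow the upper unitriangular factor moves along `λ u` up to the diagonal
part of `λ`. -/
theorem dmap_hamiltonianField_upMat (f : CoordRing n) :
    dmap (hamiltonianField μ f : CoordRing n →+ CoordRing n) (upMat (univ n)) =
      gradLeft μ f * upMat (univ n) -
        upMat (univ n) * Matrix.diagonal fun i => gradLeft μ f i i := by
  have hs := strictUpper_variation (upperUni_upMat (univ n)) (upperTri_gradLeft μ f)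
  have hm : MatGe 1 (gradLeft μ f * upMat (univ n) -
      upMat (univ n) * Matrix.diagonal fun i => gradLeft μ f i i) :=
    (MatGe.mul (k := 1) (l := 0) (matGe_gradLeft μ f) (closeToOne_upMat _).matGe).sub
      (MatGe.mul (k := 0) (l := 1) (closeToOne_upMat _).matGe (matGe_gradLeft μ f).diag)
  ext1 i j
  rw [(isDerivAlong_hamiltonianField μ f).dmap_upMat_apply]
  split_ifs with hij
  · rw [← principal_coeff_of_ordGe (hm i j)]
    congr 1
    funext r
    rw [← varUp_hamField]
    exact hamiltonianField_X μ f (.up i j hij r)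
  · rw [hs i j (not_lt.mp hij)]

theorem dmap_hamiltonianField_lowMat (f : CoordRing n) :
    dmap (hamiltonianField μ f : CoordRing n →+ CoordRing n) (lowMat (univ n)) =
      (Matrix.diagonal fun i => gradRight μ f i i) * lowMat (univ n) -
        lowMat (univ n) * gradRight μ f := by
  have hs := strictLower_variation (lowerUni_lowMat (univ n)) (lowerTri_gradRight μ f)
  have hm : MatGe 1 ((Matrix.diagonal fun i => gradRight μ f i i) * lowMat (univ n) -
        lowMat (univ n) * gradRight μ f) :=
    (MatGe.mul (k := 1) (l := 0) (matGe_gradRight μ f).diag (closeToOne_lowMat _).matGe).sub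
      (MatGe.mul (k := 0) (l := 1) (closeToOne_lowMat _).matGe (matGe_gradRight μ f))
  ext1 i j
  rw [(isDerivAlong_hamiltonianField μ f).dmap_lowMat_apply]
  split_ifs with hij
  · rw [← principal_coeff_of_ordGe (hm i j)]
    congr 1
    funext r
    rw [← varLow_hamField]
    exact hamiltonianField_X μ f (.low i j hij r)
  · rw [hs i j (not_lt.mp hij)]

theorem cmap_hamiltonianField_torEntry (f : CoordRing n) (i) :
    cmap (hamiltonianField μ f : CoordRing n →+ CoordRing n) (torEntry (univ n) i) =
      torEntry (univ n) i * (gradLeft μ f i i - gradRight μ f i i - hamScalar μ f) := by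
  refine Fin.cases ?_ (fun i => ?_) i
  · rw [(isDerivAlong_hamiltonianField μ f).cmap_torEntry_zero, hamScalar, sub_self, mul_zero]
  · rw [(isDerivAlong_hamiltonianField μ f).cmap_torEntry_succ]
    have hm : OrdGe 1 (torEntry (univ n) i.succ * (gradLeft μ f i.succ i.succ -
        gradRight μ f i.succ i.succ - hamScalar μ f)) :=
      (ordGe_torEntry (univ n) i.succ).mul' (((matGe_gradLeft μ f _ _).sub
        (matGe_gradRight μ f _ _)).sub ((matGe_gradLeft μ f 0 0).sub
          (matGe_gradRight μ f 0 0))) (by norm_num)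
    rw [← principal_coeff_of_ordGe hm]
    congr 1
    funext r
    rw [← varTor_hamField]
    exact hamiltonianField_X μ f (.tor i r)

theorem dmap_hamiltonianField_torMat (f : CoordRing n) :
    dmap (hamiltonianField μ f : CoordRing n →+ CoordRing n) (torMat μ (univ n)) =
      (Matrix.diagonal fun i => gradLeft μ f i i) * torMat μ (univ n) -
        torMat μ (univ n) * (Matrix.diagonal fun i => gradRight μ f i i) -
          scal (hamScalar μ f) * torMat μ (univ n) := by
  rw [(isDerivAlong_hamiltonianField μ f).dmap_torMat, torMat, Matrix.diagonal_mul_diagonal,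
    Matrix.diagonal_mul_diagonal, scal, Matrix.scalar_apply, Matrix.diagonal_mul_diagonal,
    Matrix.diagonal_sub, Matrix.diagonal_sub]
  congr 1
  funext i
  rw [cmap_hamiltonianField_torEntry]
  ring

theorem field_eq_of_variations {u d l lam rho dl dr : LMat n R} (c : LaurentSeries R) :
    u * (d * (dr * l - l * rho) + (dl * d - d * dr - scal c * d) * l) +
      (lam * u - u * dl) * (d * l) =
      lam * (u * d * l) - u * d * l * rho - scal c * (u * d * l) := by
  have h : (scal c : LMat n R) * (u * d * l) = u * (scal c * d) * l := by
    rw [mul_assoc u, ← mul_assoc, scal_mul_comm, mul_assoc u, mul_assoc u, ← mul_assoc _ d l]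
  rw [h]
  noncomm_ring

/-- The Hamiltonian vector field moves the universal point along `hamField`, up to a scalar. -/
theorem dmap_hamiltonianField_sliceMat (f : CoordRing n) :
    dmap (hamiltonianField μ f : CoordRing n →+ CoordRing n) (sliceMat μ (univ n)) =
      hamField μ f - scal (hamScalar μ f) * sliceMat μ (univ n) := by
  rw [(isDerivAlong_hamiltonianField μ f).dmap_sliceMat, smap_id, smap_id, smap_id,
    dmap_hamiltonianField_upMat, dmap_hamiltonianField_torMat, dmap_hamiltonianField_lowMat,
    hamField_eq, field_eq_of_variations, ← sliceMat]

theorem dmap_scal (D : R →+ S) (c : LaurentSeries R) :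
    dmap D (scal c : LMat n R) = scal (cmap D c) := by
  ext1 i j
  rw [dmap_apply, scal, scal, Matrix.scalar_apply, Matrix.scalar_apply, Matrix.diagonal_apply,
    Matrix.diagonal_apply]
  split_ifs
  · rfl
  · exact map_zero _

theorem dmap_commutator {A : Type*} [CommRing A] [Algebra ℂ A] (D D' : Derivation ℂ A A)
    (X : LMat n A) : dmap ((⁅D, D'⁆ : Derivation ℂ A A) : A →+ A) X =
      dmap (D : A →+ A) (dmap (D' : A →+ A) X) - dmap (D' : A →+ A) (dmap (D : A →+ A) X) := by
  ext1 i j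
  ext m
  exact Derivation.commutator_apply _

theorem commutator_eq_res (D D' : Derivation ℂ (CoordRing n) (CoordRing n)) (f : CoordRing n) :
    (D : CoordRing n →+ CoordRing n) ((D' : CoordRing n →+ CoordRing n) f) -
      (D' : CoordRing n →+ CoordRing n) ((D : CoordRing n →+ CoordRing n) f) =
    res ((dmap (D : CoordRing n →+ CoordRing n) (dmap (D' : CoordRing n →+ CoordRing n)
        (sliceMat μ (univ n))) -
      dmap (D' : CoordRing n →+ CoordRing n) (dmap (D : CoordRing n →+ CoordRing n)
        (sliceMat μ (univ n)))) * grad μ f) := by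
  have h := (isDerivAlong_derivation ⁅D, D'⁆).map_eq_res μ f
  rw [smap_id, dmap_commutator] at h
  rw [← h]
  exact (Derivation.commutator_apply f).symm

/-- All functions on the slice form a Hamiltonian family. The scalar by which the Hamiltonian field
differs from the field of the `r`-matrix comes from the normalization of the torus factor; the
gradients are orthogonal to this direction because functions on the slice ignore scalar factors. -/
theorem hamiltonianFamily : (residue n (CoordRing n)).HamiltonianFamily
    (Matrix.scalar (Fin (n + 1))).range (sliceMat μ (univ n)) (grad μ) (fun f => f)
    (fun f => (hamiltonianField μ f : CoordRing n →+ CoordRing n))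
    (fun f => dmap (hamiltonianField μ f : CoordRing n →+ CoordRing n))
    (fun f => scal (hamScalar μ f)) where
  central := by
    rintro _ ⟨c, rfl⟩ x
    exact scal_mul_comm c x
  mem f := ⟨_, rfl⟩
  map_mem f g := ⟨_, (dmap_scal _ _).symm⟩
  leibniz f x y := dmap_mul (isDerivAlong_hamiltonianField μ f).leibniz x y
  map_P f x := (truncMat_dmap _ x).symm
  map_τ f x := (res_dmap _ x).symm
  map_g f := dmap_hamiltonianField_sliceMat μ f
  trace_zero := by
    rintro _ ⟨c, rfl⟩ f
    exact res_scal_mul (trace_mul_grad μ f) c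
  map_f f g := (isDerivAlong_hamiltonianField μ f).map_eq_res μ g
  commutator f g h := by
    exact commutator_eq_res μ (hamiltonianField μ f) (hamiltonianField μ g) h

theorem isPoissonBracket_bracket : IsPoissonBracket (bracket μ) where
  add_left f g h := map_add (hamiltonianField μ h) f g
  smul_left c f g := (hamiltonianField μ g).map_smul c f
  leibniz f g h := by
    exact (hamiltonianField μ h).leibniz f g
  skew := bracket_skew μ
  jacobi f g h := by
    have := (hamiltonianFamily μ).jacobi f g h
    simp only [← bracket_eq_br] at this
    rw [bracket_skew μ f (bracket μ g h), bracket_skew μ g (bracket μ h f),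
      bracket_skew μ h (bracket μ f g)]
    change hamiltonianField μ f (bracket μ g h) + hamiltonianField μ g (bracket μ h f) +
      hamiltonianField μ h (bracket μ f g) = 0 at this
    change -hamiltonianField μ f (bracket μ g h) + -hamiltonianField μ g (bracket μ h f) +
      -hamiltonianField μ h (bracket μ f g) = 0
    linear_combination -this

end Jacobi
/-! ### Comparison of brackets along a change of representative -/

section Gauge

variable {n : ℕ} {E : Type*} [CommRing E]

theorem truncMat_sandwich {wi w : LMat n E} (hp : PolyMat w) (hp' : PolyMat wi) (hg : MatGe 0 w)
    (hg' : MatGe 0 wi) (Z : LMat n E) : truncMat (wi * Z * w) = wi * truncMat Z * w := by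
  have e : wi * Z * w = wi * truncMat Z * w + wi * polyPart Z * w := by
    rw [polyPart]; noncomm_ring
  rw [e, map_add, truncMat_eq_zero ((hp'.mul (polyMat_polyPart Z)).mul hp), add_zero]
  exact truncMat_eq_self (MatGe.mul (k := 1) (l := 0)
    (MatGe.mul (k := 0) (l := 1) hg' (matGe_truncMat Z)) hg)

theorem truncMat_conj_poly {Ni N : LMat n E} (hp : PolyMat N) (hp' : PolyMat Ni) (X : LMat n E) :
    truncMat (Ni * X * N) = Ni * truncMat X * N - polyPart (Ni * truncMat X * N) := by
  have e : Ni * X * N = Ni * truncMat X * N + Ni * polyPart X * N := by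
    rw [polyPart]; noncomm_ring
  rw [e, map_add, truncMat_eq_zero ((hp'.mul (polyMat_polyPart X)).mul hp), add_zero, polyPart]
  abel

theorem strictUpper_polyPart_conj {Ni N X : LMat n E} (hN : UpperUni N) (hNi : UpperUni Ni)
    (hX : UpperTri X) (hg : MatGe 1 X) : StrictUpper (polyPart (Ni * X * N)) := by
  have hU : UpperTri (Ni * X * N) := (hNi.1.mul hX).mul hN.1
  refine .of_upperTri (fun i j h => ?_) fun i => ?_
  · rw [polyPart, Matrix.sub_apply, truncMat_apply, hU i j h, trunc_zero, sub_zero]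
  · rw [polyPart, Matrix.sub_apply, truncMat_apply, (hNi.1.mul hX).mul_diag hN.1,
      hNi.1.mul_diag hX, hN.2, hNi.2, one_mul, mul_one, trunc_eq_self (hg i i), sub_self]

theorem strictLower_polyPart_conj {Ni N X : LMat n E} (hN : LowerUni N) (hNi : LowerUni Ni)
    (hX : LowerTri X) (hg : MatGe 1 X) : StrictLower (polyPart (Ni * X * N)) := by
  have hU : LowerTri (Ni * X * N) := (hNi.1.mul hX).mul hN.1
  refine .of_lowerTri (fun i j h => ?_) fun i => ?_
  · rw [polyPart, Matrix.sub_apply, truncMat_apply, hU i j h, trunc_zero, sub_zero]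
  · rw [polyPart, Matrix.sub_apply, truncMat_apply, (hNi.1.mul hX).mul_diag hN.1,
      hNi.1.mul_diag hX, hN.2, hNi.2, one_mul, mul_one, trunc_eq_self (hg i i), sub_self]

theorem strictUpper_dmap {S : Type*} [CommRing S] {D : E →+ S} (hD : D 1 = 0)
    {N : LMat n E} (hN : UpperUni N) :
    StrictUpper (dmap D N) := by
  refine .of_upperTri (fun i j h => ?_) fun i => ?_
  · rw [dmap_apply, hN.1 i j h, map_zero]
  · rw [dmap_apply, hN.2]
    ext m
    rw [coeff_cmap, HahnSeries.coeff_one]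
    split_ifs
    · exact hD
    · exact map_zero D

theorem strictLower_dmap {S : Type*} [CommRing S] {D : E →+ S} (hD : D 1 = 0)
    {N : LMat n E} (hN : LowerUni N) :
    StrictLower (dmap D N) := by
  refine .of_lowerTri (fun i j h => ?_) fun i => ?_
  · rw [dmap_apply, hN.1 i j h, map_zero]
  · rw [dmap_apply, hN.2]
    ext m
    rw [coeff_cmap, HahnSeries.coeff_one]
    split_ifs
    · exact hD
    · exact map_zero D

theorem PolyMat.dmap {S : Type*} [CommRing S] {X : LMat n E} (h : PolyMat X) (D : E →+ S) :
    PolyMat (dmap D X) :=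
  fun i j => (h i j).cmap D

theorem smap_field {S : Type*} [CommRing S] (θ : E →+* S) (g w : LMat n E) :
    smap θ ((residue n E).field g w) = (residue n S).field (smap θ g) (smap θ w) := by
  rw [SplitTrace.field, SplitTrace.field, map_sub, map_mul (smap θ), map_mul (smap θ), residue_P,
    residue_P, residue_P, residue_P, ← truncMat_smap, ← truncMat_smap,
    map_mul (smap θ), map_mul (smap θ)]

theorem smap_br {S : Type*} [CommRing S] (θ : E →+* S) (g v w : LMat n E) :
    θ ((residue n E).br g v w) = (residue n S).br (smap θ g) (smap θ v) (smap θ w) := by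
  rw [SplitTrace.br, SplitTrace.br, ← smap_field, ← map_mul, res_smap]

theorem res_cyc₄ (a b c d : LMat n E) : res (a * b * c * d) = res (d * a * b * c) := by
  rw [res_comm, mul_assoc d, mul_assoc d, mul_assoc]

theorem res_variation_conj {y yi Q Qi g' f' dy dg dQ : LMat n E} (hy : yi * y = 1)
    (hQ : Q * Qi = 1) :
    res ((y * g' * dQ + (y * dg + dy * g') * Q) * (Qi * f' * yi)) =
      res (dQ * Qi * (f' * g')) + res (dg * f') + res (yi * dy * (g' * f')) := by
  have e : (y * g' * dQ + (y * dg + dy * g') * Q) * (Qi * f' * yi) =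
      (y * (g' * dQ * Qi) + (y * dg + dy * g') * (Q * Qi)) * f' * yi := by noncomm_ring
  have e2 : yi * ((y * (g' * dQ * Qi) + (y * dg + dy * g') * 1) * f') =
      (yi * y) * (g' * dQ * Qi * f') + (yi * y) * dg * f' + yi * dy * (g' * f') := by
    noncomm_ring
  have e3 : res (g' * dQ * Qi * f') = res (dQ * Qi * (f' * g')) := by
    rw [mul_assoc g', mul_assoc g', res_comm, mul_assoc]
  rw [e, hQ, res_comm, e2, hy, one_mul, one_mul, map_add, map_add, e3]

theorem trace_smap {R S : Type*} [CommRing R] [CommRing S] (θ : R →+* S) (X : LMat n R) :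
    (smap θ X).trace = lmap θ X.trace := by
  rw [Matrix.trace, Matrix.trace, map_sum]
  rfl

variable [Algebra ℂ E]

/-- A matrix with entries in `ℂ`. -/
def ConstMat (X : LMat n E) : Prop := ∀ i j, ∃ z : ℂ, X i j = HahnSeries.C (algebraMap ℂ E z)

theorem ConstMat.polyMat {X : LMat n E} (h : ConstMat X) : PolyMat X := fun i j => by
  obtain ⟨z, hz⟩ := h i j
  rw [hz]
  exact isPoly_C _

theorem ConstMat.matGe {X : LMat n E} (h : ConstMat X) : MatGe 0 X := fun i j m hm => by
  obtain ⟨z, hz⟩ := h i j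
  rw [hz, HahnSeries.C_apply, HahnSeries.coeff_single, if_neg hm.ne]

theorem ConstMat.dmap_eq_zero {X : LMat n E} (h : ConstMat X) (D : Derivation ℂ E E) :
    dmap (D : E →+ E) X = 0 := by
  ext1 i j
  obtain ⟨z, hz⟩ := h i j
  rw [dmap_apply, hz]
  ext m
  rw [coeff_cmap, HahnSeries.C_apply, HahnSeries.coeff_single]
  split_ifs
  · exact D.map_algebraMap z
  · exact map_zero _

theorem constMat_one : ConstMat (1 : LMat n E) := fun i j => by
  rw [Matrix.one_apply]
  split_ifs
  · exact ⟨1, by rw [map_one, map_one]⟩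
  · exact ⟨0, by rw [map_zero, map_zero]⟩

theorem constMat_single_one (k l : Fin (n + 1)) : ConstMat (Matrix.single k l 1 : LMat n E) :=
  fun i j => by
    rw [Matrix.single_apply]
    split_ifs
    · exact ⟨1, by rw [map_one, map_one]⟩
    · exact ⟨0, by rw [map_zero, map_zero]⟩

theorem ConstMat.add {X Y : LMat n E} (hX : ConstMat X) (hY : ConstMat Y) : ConstMat (X + Y) :=
  fun i j => by
    obtain ⟨x, hx⟩ := hX i j
    obtain ⟨y, hy⟩ := hY i j
    exact ⟨x + y, by rw [Matrix.add_apply, hx, hy, map_add, map_add]⟩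

theorem ConstMat.sub {X Y : LMat n E} (hX : ConstMat X) (hY : ConstMat Y) : ConstMat (X - Y) :=
  fun i j => by
    obtain ⟨x, hx⟩ := hX i j
    obtain ⟨y, hy⟩ := hY i j
    exact ⟨x - y, by rw [Matrix.sub_apply, hx, hy, map_sub, map_sub]⟩

theorem derivation_leibniz (D : Derivation ℂ E E) (a b : E) :
    (D : E →+ E) (a * b) =
      (RingHom.id E) a * (D : E →+ E) b + (D : E →+ E) a * (RingHom.id E) b := by
  change D (a * b) = a * D b + D a * b
  rw [Derivation.leibniz, smul_eq_mul, smul_eq_mul, mul_comm b]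

theorem dmap_derivation_mul (D : Derivation ℂ E E) (X Y : LMat n E) :
    dmap (D : E →+ E) (X * Y) = X * dmap (D : E →+ E) Y + dmap (D : E →+ E) X * Y :=
  dmap_mul (derivation_leibniz D) X Y

theorem isDerivAlong_comp (D : Derivation ℂ E E) (θ : CoordRing n →ₐ[ℂ] E) :
    IsDerivAlong (θ : CoordRing n →+* E) ((D : E →+ E).comp (θ : CoordRing n →+ E)) where
  leibniz f g := by
    change D (θ (f * g)) = θ f * D (θ g) + D (θ f) * θ g
    rw [map_mul, Derivation.leibniz, smul_eq_mul, smul_eq_mul, mul_comm (θ g)]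
  map_C a := by
    change D (θ (algebraMap ℂ (CoordRing n) a)) = 0
    rw [θ.commutes, D.map_algebraMap]

theorem derivation_eq_res (D : Derivation ℂ E E) (θ : CoordRing n →ₐ[ℂ] E)
    (μ : Fin (n + 1) → ℤ) (f : CoordRing n) :
    D (θ f) = res (dmap (D : E →+ E) (smap (θ : CoordRing n →+* E) (sliceMat μ (univ n))) *
      smap (θ : CoordRing n →+* E) (grad μ f)) :=
  (isDerivAlong_comp D θ).map_eq_res μ f

/-- Two families of points `θ` of `Gr_μ` and `ι` of `Gr_μ'`, with the same base `Spec E`, whose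
universal matrices differ by a constant matrix `w` and elements `N` of `N[t]` and `q` of `N₋[t]`,
up to a scalar `c`. -/
structure GaugeRelated (μ μ' : Fin (n + 1) → ℤ) (θ ι : CoordRing n →ₐ[ℂ] E)
    (w wi N Ni q qi : LMat n E) (c ci : LaurentSeries E) : Prop where
  eq : smap (θ : CoordRing n →+* E) (sliceMat μ (univ n)) =
    (wi * Ni) * smap (ι : CoordRing n →+* E) (sliceMat μ' (univ n)) * (scal c * q)
  w_mul : w * wi = 1
  const_w : ConstMat w
  const_wi : ConstMat wi
  N_mul : N * Ni = 1
  upper : UpperUni N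
  poly_N : PolyMat N
  q_mul : q * qi = 1
  lower : LowerUni q
  poly_q : PolyMat q
  c_mul : c * ci = 1

namespace GaugeRelated

variable {μ μ' : Fin (n + 1) → ℤ} {θ ι : CoordRing n →ₐ[ℂ] E}
    {w wi N Ni q qi : LMat n E} {c ci : LaurentSeries E}

section

variable (h : GaugeRelated μ μ' θ ι w wi N Ni q qi c ci)
include h

theorem upper_Ni : UpperUni Ni := h.upper.of_mul_eq_one h.N_mul
theorem poly_Ni : PolyMat Ni := h.poly_N.of_mul_eq_one h.upper.det h.N_mul
theorem lower_qi : LowerUni qi := h.lower.of_mul_eq_one h.q_mul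
theorem poly_qi : PolyMat qi := h.poly_q.of_mul_eq_one h.lower.det h.q_mul

theorem y_mul : (N * w) * (wi * Ni) = 1 := by
  calc _ = N * (w * wi) * Ni := by noncomm_ring
    _ = 1 := by rw [h.w_mul, mul_one, h.N_mul]

theorem scal_mul_scal : (scal c : LMat n E) * scal ci = 1 := by
  rw [scal, scal, ← map_mul, h.c_mul, map_one]

theorem cq_mul : (scal c * q) * (qi * scal ci) = 1 := by
  calc _ = scal c * (q * qi) * scal ci := by noncomm_ring
    _ = 1 := by rw [h.q_mul, mul_one, h.scal_mul_scal]

end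

/-- The gradient transported from the second family to the first one. -/
def pullGrad (μ' : Fin (n + 1) → ℤ) (ι : CoordRing n →ₐ[ℂ] E) (w N qi : LMat n E)
    (ci : LaurentSeries E) (f : CoordRing n) : LMat n E :=
  (qi * scal ci) * smap (ι : CoordRing n →+* E) (grad μ' f) * (N * w)

/-- The pullback of the universal point. -/
abbrev point (μ : Fin (n + 1) → ℤ) (θ : CoordRing n →ₐ[ℂ] E) : LMat n E :=
  smap (θ : CoordRing n →+* E) (sliceMat μ (univ n))

/-- The pullback of the gradient of a function. -/
abbrev gradAt (μ : Fin (n + 1) → ℤ) (θ : CoordRing n →ₐ[ℂ] E) (f : CoordRing n) : LMat n E :=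
  smap (θ : CoordRing n →+* E) (grad μ f)

theorem lowerIsPoly_point_mul (μ : Fin (n + 1) → ℤ) (θ : CoordRing n →ₐ[ℂ] E) (f : CoordRing n) :
    LowerIsPoly (point μ θ * gradAt μ θ f) := fun i j hij => by
  rw [point, gradAt, ← map_mul]
  exact (lowerIsPoly_mul_grad μ f i j hij).lmap _

theorem upperIsPoly_mul_point (μ : Fin (n + 1) → ℤ) (θ : CoordRing n →ₐ[ℂ] E) (f : CoordRing n) :
    UpperIsPoly (gradAt μ θ f * point μ θ) := fun i j hij => by
  rw [point, gradAt, ← map_mul]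
  exact (upperIsPoly_grad_mul μ f i j hij).lmap _

theorem trace_point_mul (μ : Fin (n + 1) → ℤ) (θ : CoordRing n →ₐ[ℂ] E) (f : CoordRing n) :
    (point μ θ * gradAt μ θ f).trace = 0 := by
  rw [point, gradAt, ← map_mul, trace_smap, trace_mul_grad, map_zero]

theorem truncMat_point_mul (μ : Fin (n + 1) → ℤ) (θ : CoordRing n →ₐ[ℂ] E) (f : CoordRing n) :
    truncMat (point μ θ * gradAt μ θ f) = smap (θ : CoordRing n →+* E) (gradLeft μ f) := by
  rw [point, gradAt, ← map_mul, truncMat_smap, gradLeft_eq]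

theorem truncMat_mul_point (μ : Fin (n + 1) → ℤ) (θ : CoordRing n →ₐ[ℂ] E) (f : CoordRing n) :
    truncMat (gradAt μ θ f * point μ θ) = smap (θ : CoordRing n →+* E) (gradRight μ f) := by
  rw [point, gradAt, ← map_mul, truncMat_smap, gradRight_eq]

section

variable (h : GaugeRelated μ μ' θ ι w wi N Ni q qi c ci)
include h

theorem mul_pullGrad (f : CoordRing n) : point μ θ * pullGrad μ' ι w N qi ci f =
    (wi * Ni) * (point μ' ι * gradAt μ' ι f) * (N * w) := by
  rw [point, h.eq, pullGrad]
  calc _ = (wi * Ni) * point μ' ι * ((scal c * q) * (qi * scal ci)) * gradAt μ' ι f * (N * w) := by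
        noncomm_ring
    _ = _ := by rw [h.cq_mul, mul_one]; noncomm_ring

theorem pullGrad_mul (f : CoordRing n) : pullGrad μ' ι w N qi ci f * point μ θ =
    qi * (gradAt μ' ι f * point μ' ι) * q := by
  rw [point, h.eq, pullGrad]
  calc _ = (qi * scal ci) * gradAt μ' ι f * ((N * w) * (wi * Ni)) * point μ' ι *
        (scal c * q) := by noncomm_ring
    _ = qi * (scal ci * (gradAt μ' ι f * point μ' ι)) * scal c * q := by
        rw [h.y_mul, mul_one]; noncomm_ring
    _ = qi * (gradAt μ' ι f * point μ' ι) * (scal ci * scal c) * q := by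
        rw [scal_mul_comm]; noncomm_ring
    _ = _ := by rw [mul_eq_one_comm.mp h.scal_mul_scal, mul_one]

theorem trace_mul_pullGrad (f : CoordRing n) :
    (point μ θ * pullGrad μ' ι w N qi ci f).trace = 0 := by
  rw [h.mul_pullGrad, Matrix.trace_mul_comm, ← mul_assoc, h.y_mul, one_mul, trace_point_mul]

/-- The transported gradients are orthogonal to the directions `w⁻¹ 𝔫[t] w g`. -/
theorem res_upper_mul_pullGrad {Z : LMat n E} (hZ : StrictUpper Z) (hp : PolyMat Z)
    (f : CoordRing n) : res (wi * Z * w * (point μ θ * pullGrad μ' ι w N qi ci f)) = 0 := by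
  rw [h.mul_pullGrad]
  have e : wi * Z * w * (wi * Ni * (point μ' ι * gradAt μ' ι f) * (N * w)) =
      wi * (Z * Ni) * (point μ' ι * gradAt μ' ι f) * (N * w) := by
    calc _ = wi * Z * (w * wi) * Ni * (point μ' ι * gradAt μ' ι f) * (N * w) := by noncomm_ring
      _ = _ := by rw [h.w_mul]; noncomm_ring
  have e2 : N * w * wi * (Z * Ni) * (point μ' ι * gradAt μ' ι f) =
      N * (w * wi) * Z * Ni * (point μ' ι * gradAt μ' ι f) := by noncomm_ring
  rw [e, res_cyc₄, e2, h.w_mul, mul_one]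
  exact res_strictUpper_mul ((h.upper.1.mul_strict hZ).mul_upperTri h.upper_Ni.1)
    ((h.poly_N.mul hp).mul h.poly_Ni) (lowerIsPoly_point_mul μ' ι f)

/-- The transported gradients are orthogonal to the directions `g 𝔫₋[t]`. -/
theorem res_lower_mul_pullGrad {Z : LMat n E} (hZ : StrictLower Z) (hp : PolyMat Z)
    (f : CoordRing n) : res (Z * (pullGrad μ' ι w N qi ci f * point μ θ)) = 0 := by
  rw [h.pullGrad_mul]
  have e : Z * (qi * (gradAt μ' ι f * point μ' ι) * q) =
      Z * qi * (gradAt μ' ι f * point μ' ι) * q := by noncomm_ring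
  have e2 : q * Z * qi * (gradAt μ' ι f * point μ' ι) =
      (q * Z * qi) * (gradAt μ' ι f * point μ' ι) := by noncomm_ring
  rw [e, res_cyc₄, e2]
  exact res_strictLower_mul ((h.lower.1.mul_strict hZ).mul_lowerTri h.lower_qi.1)
    ((h.poly_q.mul hp).mul h.poly_qi) (upperIsPoly_mul_point μ' ι f)

theorem dmap_point (D : Derivation ℂ E E) : dmap (D : E →+ E) (point μ θ) =
    (wi * Ni) * point μ' ι * (scal c * dmap (D : E →+ E) q + scal (cmap (D : E →+ E) c) * q) +
      ((wi * Ni) * dmap (D : E →+ E) (point μ' ι) +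
        (wi * dmap (D : E →+ E) Ni) * point μ' ι) * (scal c * q) := by
  rw [point, h.eq, dmap_derivation_mul, dmap_derivation_mul D (scal c) q,
    dmap_derivation_mul D (wi * Ni), dmap_derivation_mul D wi, h.const_wi.dmap_eq_zero, zero_mul,
    add_zero, dmap_scal]

/-- The transported gradient of `f` computes the derivatives of `ι f` from the variation of the
first family. -/
theorem derivation_eq_res_pullGrad (D : Derivation ℂ E E) (f : CoordRing n) :
    D (ι f) = res (dmap (D : E →+ E) (point μ θ) * pullGrad μ' ι w N qi ci f) := by
  have hD : (D : E →+ E) 1 = 0 := D.map_one_eq_zero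
  rw [h.dmap_point, pullGrad, res_variation_conj h.y_mul h.cq_mul, derivation_eq_res D ι μ' f]
  have e1 : (scal c * dmap (D : E →+ E) q + scal (cmap (D : E →+ E) c) * q) * (qi * scal ci) =
      dmap (D : E →+ E) q * qi + scal (cmap (D : E →+ E) c * ci) := by
    calc _ = scal c * (dmap (D : E →+ E) q * qi * scal ci) +
          scal (cmap (D : E →+ E) c) * (q * qi) * scal ci := by noncomm_ring
      _ = scal c * scal ci * (dmap (D : E →+ E) q * qi) +
          scal (cmap (D : E →+ E) c) * scal ci := by
          rw [h.q_mul, mul_one, ← scal_mul_comm, mul_assoc (scal c)]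
      _ = _ := by rw [h.scal_mul_scal, one_mul, scal, scal, scal, map_mul]
  have z1 : res (dmap (D : E →+ E) q * qi * (gradAt μ' ι f * point μ' ι)) = 0 :=
    res_strictLower_mul ((strictLower_dmap hD h.lower).mul_lowerTri h.lower_qi.1)
      ((h.poly_q.dmap _).mul h.poly_qi) (upperIsPoly_mul_point μ' ι f)
  have z2 : res (scal (cmap (D : E →+ E) c * ci) * (gradAt μ' ι f * point μ' ι)) = 0 :=
    res_scal_mul (by rw [Matrix.trace_mul_comm, trace_point_mul]) _
  have e3 : N * w * (wi * dmap (D : E →+ E) Ni) = N * dmap (D : E →+ E) Ni := by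
    calc _ = N * (w * wi) * dmap (D : E →+ E) Ni := by noncomm_ring
      _ = _ := by rw [h.w_mul, mul_one]
  have z3 : res (N * dmap (D : E →+ E) Ni * (point μ' ι * gradAt μ' ι f)) = 0 :=
    res_strictUpper_mul (h.upper.1.mul_strict (strictUpper_dmap hD h.upper_Ni))
      (h.poly_N.mul (h.poly_Ni.dmap _)) (lowerIsPoly_point_mul μ' ι f)
  rw [e1, e3, z3, add_mul, map_add, z1, z2, add_zero, add_zero, zero_add]

theorem cq_conj (X : LMat n E) : (qi * scal ci) * X * (scal c * q) = qi * X * q := by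
  calc _ = qi * (scal ci * X) * scal c * q := by noncomm_ring
    _ = qi * X * (scal ci * scal c) * q := by rw [scal_mul_comm]; noncomm_ring
    _ = _ := by rw [mul_eq_one_comm.mp h.scal_mul_scal, mul_one]

theorem truncMat_conj_y (X : LMat n E) : truncMat ((wi * Ni) * X * (N * w)) =
    (wi * Ni) * truncMat X * (N * w) - wi * polyPart (Ni * truncMat X * N) * w := by
  have e : ∀ X, (wi * Ni) * X * (N * w) = wi * (Ni * X * N) * w := fun X => by noncomm_ring
  rw [e, e, truncMat_sandwich h.const_w.polyMat h.const_wi.polyMat h.const_w.matGe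
    h.const_wi.matGe, truncMat_conj_poly h.poly_N h.poly_Ni]
  noncomm_ring

theorem truncMat_conj_cq (X : LMat n E) : truncMat ((qi * scal ci) * X * (scal c * q)) =
    (qi * scal ci) * truncMat X * (scal c * q) - polyPart (qi * truncMat X * q) := by
  rw [h.cq_conj, h.cq_conj, truncMat_conj_poly h.poly_q h.poly_qi]

theorem strictUpper_polyPart (f : CoordRing n) :
    StrictUpper (polyPart (Ni * truncMat (point μ' ι * gradAt μ' ι f) * N)) :=
  strictUpper_polyPart_conj h.upper h.upper_Ni
    (by rw [truncMat_point_mul]; exact (upperTri_gradLeft μ' f).smap _) (matGe_truncMat _)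

theorem strictLower_polyPart (f : CoordRing n) :
    StrictLower (polyPart (qi * truncMat (gradAt μ' ι f * point μ' ι) * q)) :=
  strictLower_polyPart_conj h.lower h.lower_qi
    (by rw [truncMat_mul_point]; exact (lowerTri_gradRight μ' f).smap _) (matGe_truncMat _)

theorem br_pullGrad (f₁ f₂ : CoordRing n) : (residue n E).br (point μ θ)
    (pullGrad μ' ι w N qi ci f₁) (pullGrad μ' ι w N qi ci f₂) = ι (bracket μ' f₁ f₂) := by
  have e : ι (bracket μ' f₁ f₂) =
      (residue n E).br (point μ' ι) (gradAt μ' ι f₁) (gradAt μ' ι f₂) := by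
    rw [bracket_eq_br]
    exact smap_br (ι : CoordRing n →+* E) _ _ _
  rw [e]
  refine SplitTrace.br_conj h.eq h.y_mul h.cq_mul (h.truncMat_conj_y _) (h.truncMat_conj_cq _) ?_ ?_
  · rw [← h.mul_pullGrad]
    exact h.res_upper_mul_pullGrad (h.strictUpper_polyPart f₂) (polyMat_polyPart _) f₁
  · rw [h.cq_conj, ← h.pullGrad_mul]
    exact h.res_lower_mul_pullGrad (h.strictLower_polyPart f₂) (polyMat_polyPart _) f₁

end

theorem dmap_point_of_hamiltonian {D : Derivation ℂ E E} {F : CoordRing n}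
    (hD : ∀ x, D (θ x) = θ (hamiltonianField μ F x)) : dmap (D : E →+ E) (point μ θ) =
      (residue n E).field (point μ θ) (gradAt μ θ F) -
        scal (lmap (θ : CoordRing n →+* E) (hamScalar μ F)) * point μ θ := by
  have e : dmap (D : E →+ E) (point μ θ) = smap (θ : CoordRing n →+* E)
      (dmap (hamiltonianField μ F : CoordRing n →+ CoordRing n) (sliceMat μ (univ n))) := by
    ext1 i j
    ext m
    exact hD _
  have e2 : ∀ c : LaurentSeries (CoordRing n), smap (θ : CoordRing n →+* E) (scal c : LoopMat n) =
      scal (lmap (θ : CoordRing n →+* E) c) := by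
    intro c
    ext1 i j
    rw [smap_apply, scal, scal, Matrix.scalar_apply, Matrix.scalar_apply, Matrix.diagonal_apply,
      Matrix.diagonal_apply]
    split_ifs
    · rfl
    · exact map_zero _
  rw [e, dmap_hamiltonianField_sliceMat, map_sub, map_mul, e2, hamField, smap_field]

/-- Functions which agree along the two families have the same brackets, provided that the
Hamiltonian fields of one function on either side lift to derivations of `E`, and that the
gradient of the first of these functions is orthogonal to the direction in `w⁻¹ 𝔫[t] w g` in which
transport along `N` and its variation displace the Hamiltonian field of the second one. -/
theorem bracket_eq (h : GaugeRelated μ μ' θ ι w wi N Ni q qi c ci) {F₁ F₂ f₁ f₂ : CoordRing n}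
    (h₁ : θ F₁ = ι f₁) (h₂ : θ F₂ = ι f₂) {D₁ D₂ : Derivation ℂ E E}
    (hD₁ : ∀ x, D₁ (θ x) = θ (hamiltonianField μ F₂ x))
    (hD₂ : ∀ x, D₂ (ι x) = ι (hamiltonianField μ' f₁ x))
    (h₃ : res (wi * (polyPart (Ni * truncMat (point μ' ι * gradAt μ' ι f₁) * N) +
      dmap (D₂ : E →+ E) Ni * N) * w * (point μ θ * gradAt μ θ F₂)) = 0) :
    θ (bracket μ F₁ F₂) = ι (bracket μ' f₁ f₂) := by
  have e : θ (bracket μ F₁ F₂) =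
      (residue n E).br (point μ θ) (gradAt μ θ F₁) (gradAt μ θ F₂) := by
    rw [bracket_eq_br]
    exact smap_br (θ : CoordRing n →+* E) _ _ _
  -- the difference of the two gradients kills all variations of the point
  have orth : ∀ (D : Derivation ℂ E E) {F f : CoordRing n}, θ F = ι f →
      res (dmap (D : E →+ E) (point μ θ) *
        (gradAt μ θ F - pullGrad μ' ι w N qi ci f)) = 0 := by
    intro D F f hF
    rw [mul_sub, map_sub, ← h.derivation_eq_res_pullGrad, ← hF, derivation_eq_res D θ μ F, sub_self]
  have orth_scal : ∀ (z : LaurentSeries E) (F f : CoordRing n),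
      res (scal z * point μ θ * (gradAt μ θ F - pullGrad μ' ι w N qi ci f)) = 0 := by
    intro z F f
    rw [mul_assoc]
    refine res_scal_mul ?_ z
    rw [mul_sub, Matrix.trace_sub, trace_point_mul, h.trace_mul_pullGrad, sub_zero]
  rw [e, ← h.br_pullGrad]
  refine SplitTrace.br_eq_of_orthogonal ?_ ?_
  · rw [← sub_add_cancel ((residue n E).field (point μ θ) (gradAt μ θ F₂))
      (scal (lmap (θ : CoordRing n →+* E) (hamScalar μ F₂)) * point μ θ),
      ← dmap_point_of_hamiltonian hD₁, add_mul, map_add, orth D₁ h₁, orth_scal, add_zero]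
  · have hD : (D₂ : E →+ E) 1 = 0 := D₂.map_one_eq_zero
    set P := polyPart (Ni * truncMat (point μ' ι * gradAt μ' ι f₁) * N) with hP
    set b := polyPart (qi * truncMat (gradAt μ' ι f₁ * point μ' ι) * q) with hb
    have hf : (residue n E).field (point μ θ) (pullGrad μ' ι w N qi ci f₁) =
        (wi * Ni) * (residue n E).field (point μ' ι) (gradAt μ' ι f₁) * (scal c * q) -
          wi * P * w * point μ θ + point μ θ * b :=
      SplitTrace.field_conj h.eq h.y_mul h.cq_mul (h.truncMat_conj_y _) (h.truncMat_conj_cq _)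
    -- the field of the second family, as a variation of the first one
    have hv : (wi * Ni) * (residue n E).field (point μ' ι) (gradAt μ' ι f₁) * (scal c * q) =
        dmap (D₂ : E →+ E) (point μ θ) +
        scal (lmap (ι : CoordRing n →+* E) (hamScalar μ' f₁) - cmap (D₂ : E →+ E) c * ci) *
          point μ θ - wi * (dmap (D₂ : E →+ E) Ni * N) * w * point μ θ -
          point μ θ * (qi * dmap (D₂ : E →+ E) q) := by
      rw [h.dmap_point, dmap_point_of_hamiltonian hD₂]
      set z := lmap (ι : CoordRing n →+* E) (hamScalar μ' f₁)
      set c' := cmap (D₂ : E →+ E) c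
      set dq := dmap (D₂ : E →+ E) q
      set dN := dmap (D₂ : E →+ E) Ni
      have hs : (scal (z - c' * ci) : LMat n E) = scal z - scal c' * scal ci := by
        rw [scal, scal, scal, scal, map_sub, map_mul]
      have e1 : wi * (dN * N) * w * point μ θ = wi * dN * point μ' ι * (scal c * q) := by
        rw [point, h.eq]
        calc _ = wi * dN * ((N * w) * (wi * Ni)) * point μ' ι * (scal c * q) := by noncomm_ring
          _ = _ := by rw [h.y_mul, mul_one]
      have e2 : point μ θ * (qi * dq) = wi * Ni * point μ' ι * (scal c * dq) := by
        rw [point, h.eq]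
        calc _ = wi * Ni * point μ' ι * (scal c * (q * qi) * dq) := by noncomm_ring
          _ = _ := by rw [h.q_mul, mul_one]
      have e3 : scal c' * scal ci * point μ θ = wi * Ni * point μ' ι * (scal c' * q) := by
        rw [point, h.eq]
        calc _ = scal c' * (scal ci * (wi * Ni * point μ' ι)) * scal c * q := by noncomm_ring
          _ = scal c' * (wi * Ni * point μ' ι) * (scal ci * scal c) * q := by
              rw [scal_mul_comm ci]; noncomm_ring
          _ = _ := by
              rw [mul_eq_one_comm.mp h.scal_mul_scal, mul_one, scal_mul_comm]; noncomm_ring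
      have e4 : scal z * point μ θ = wi * Ni * (scal z * point μ' ι) * (scal c * q) := by
        rw [point, h.eq]
        calc _ = scal z * (wi * Ni) * point μ' ι * (scal c * q) := by noncomm_ring
          _ = _ := by rw [scal_mul_comm]; noncomm_ring
      rw [hs, sub_mul, e1, e2, e3, e4]
      noncomm_ring
    have low : ∀ Z : LMat n E, StrictLower Z → PolyMat Z →
        res (point μ θ * Z * (gradAt μ θ F₂ - pullGrad μ' ι w N qi ci f₂)) = 0 := by
      intro Z hZ hp
      have e : ∀ X, res (point μ θ * Z * X) = res (Z * (X * point μ θ)) := by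
        intro X
        rw [mul_assoc, res_comm, mul_assoc]
      rw [mul_sub, map_sub, e, e, h.res_lower_mul_pullGrad hZ hp, sub_zero]
      exact res_strictLower_mul hZ hp (upperIsPoly_mul_point μ θ F₂)
    have up : res (wi * (P + dmap (D₂ : E →+ E) Ni * N) * w * point μ θ *
        (gradAt μ θ F₂ - pullGrad μ' ι w N qi ci f₂)) = 0 := by
      have hPs : StrictUpper P := h.strictUpper_polyPart f₁
      have hs : StrictUpper (P + dmap (D₂ : E →+ E) Ni * N) := fun i j hij => by
        rw [Matrix.add_apply, hPs i j hij,
          (strictUpper_dmap hD h.upper_Ni).mul_upperTri h.upper.1 i j hij, add_zero]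
      have hp : PolyMat (P + dmap (D₂ : E →+ E) Ni * N) :=
        (polyMat_polyPart _).add ((h.poly_Ni.dmap _).mul h.poly_N)
      rw [mul_assoc _ (point μ θ), mul_sub, mul_sub, map_sub, h₃, h.res_upper_mul_pullGrad hs hp,
        sub_zero]
    have lowb := low b (h.strictLower_polyPart f₁) (polyMat_polyPart _)
    have lowq := low (qi * dmap (D₂ : E →+ E) q)
      (h.lower_qi.1.mul_strict (strictLower_dmap hD h.lower)) (h.poly_qi.mul (h.poly_q.dmap _))
    have e : ∀ a b c d e f x : LMat n E,
        res ((a + b - d - e - c + f) * x) =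
          res (a * x) + res (b * x) - res (d * x + c * x) + res (f * x) - res (e * x) := by
      intro a b c d e f x
      simp only [add_mul, sub_mul, map_add, map_sub]
      ring
    rw [hf, hv, e, orth D₂ h₂, orth_scal, lowb, lowq, ← add_mul]
    have e5 : wi * (dmap (D₂ : E →+ E) Ni * N) * w * point μ θ + wi * P * w * point μ θ =
        wi * (P + dmap (D₂ : E →+ E) Ni * N) * w * point μ θ := by noncomm_ring
    rw [e5, up]
    ring

end GaugeRelated

end Gauge
/-! ### Gauss decompositions -/

section Gauss

variable {n : ℕ} {R : Type*} [CommRing R]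

theorem CloseToOne.ordGe_diag {X : LMat n R} (h : CloseToOne X) (i) : OrdGe 1 (X i i - 1) := by
  have := h i i
  rwa [Matrix.sub_apply, Matrix.one_apply_eq] at this

theorem closeToOne_one : CloseToOne (1 : LMat n R) := by
  intro i j
  rw [sub_self]
  exact ordGe_zero 1

theorem upperUni_one : UpperUni (1 : LMat n R) :=
  ⟨fun _ _ h => Matrix.one_apply_ne h.ne', fun i => Matrix.one_apply_eq i⟩

theorem lowerUni_one : LowerUni (1 : LMat n R) :=
  ⟨fun _ _ h => Matrix.one_apply_ne h.ne, fun i => Matrix.one_apply_eq i⟩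

/-- Elimination of the entries above the diagonal, from the last column to the first. -/
theorem exists_upperUni_mul_lowerTri {X : LMat n R} (hX : CloseToOne X) (k : ℕ) :
    ∃ U : LMat n R, UpperUni U ∧ CloseToOne U ∧
      ∀ i j : Fin (n + 1), i < j → n + 1 ≤ (j : ℕ) + k → (U * X) i j = 0 := by
  induction k with
  | zero =>
    exact ⟨1, upperUni_one, closeToOne_one, fun i j _ h => absurd j.2 (by omega)⟩
  | succ k ih =>
    obtain ⟨U, hU, hU', h0⟩ := ih
    by_cases hk : n < k
    · exact ⟨U, hU, hU', fun i j hij _ => h0 i j hij (by omega)⟩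
    · set p : Fin (n + 1) := ⟨n - k, by omega⟩ with hp
      set Y := U * X with hY
      have hYc : CloseToOne Y := hU'.mul hX
      obtain ⟨g, hg, hg'⟩ := exists_inv_of_ordGe_sub_one (hYc.ordGe_diag p)
      have hg0 : OrdGe 0 g := by
        have := (hg'.mono (show (0 : ℤ) ≤ 1 by norm_num)).add ordGe_one
        rwa [sub_add_cancel] at this
      set a : Fin (n + 1) → LaurentSeries R := fun i => if i < p then Y i p * g else 0 with ha
      set V : LMat n R := Matrix.of fun i j => if j = p then a i else 0 with hV
      have hVY : ∀ i j, (V * Y) i j = a i * Y p j := by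
        intro i j
        rw [Matrix.mul_apply, Finset.sum_eq_single p]
        · rw [hV, Matrix.of_apply, if_pos rfl]
        · intro m _ hm
          rw [hV, Matrix.of_apply, if_neg hm, zero_mul]
        · intro hm
          exact absurd (Finset.mem_univ p) hm
      have hVs : StrictUpper V := by
        intro i j hij
        rw [hV, Matrix.of_apply]
        split_ifs with h1
        · rw [ha]
          exact if_neg (not_lt.mpr (h1 ▸ hij))
        · rfl
      have hVg : MatGe 1 V := by
        intro i j
        rw [hV, Matrix.of_apply]
        split_ifs with h1
        · simp only [ha]
          split_ifs with h2
          · have := hYc i p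
            rw [Matrix.sub_apply, Matrix.one_apply_ne h2.ne, sub_zero] at this
            exact this.mul' hg0 (by norm_num)
          · exact ordGe_zero 1
        · exact ordGe_zero 1
      have hu : UpperUni (1 - V) :=
        ⟨fun i j hij => by
          rw [Matrix.sub_apply, Matrix.one_apply_ne hij.ne', hVs i j hij.le, sub_zero],
          fun i => by rw [Matrix.sub_apply, Matrix.one_apply_eq, hVs i i le_rfl, sub_zero]⟩
      have hc : CloseToOne (1 - V) := by
        have e : (1 - V : LMat n R) - 1 = -V := by abel
        rw [CloseToOne, e]
        exact hVg.neg
      refine ⟨(1 - V) * U, hu.mul hU, hc.mul hU', fun i j hij hj => ?_⟩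
      rw [mul_assoc, ← hY, sub_mul, one_mul, Matrix.sub_apply, hVY]
      by_cases hjp : j = p
      · subst hjp
        rw [ha]
        simp only [if_pos hij]
        linear_combination (-Y i p) * hg
      · have hj' : n + 1 ≤ (j : ℕ) + k := by
          have : (j : ℕ) ≠ n - k := fun h => hjp (Fin.ext h)
          omega
        have hpj : p < j := by
          rw [Fin.lt_def]
          change n - k < (j : ℕ)
          omega
        rw [h0 i j hij hj', h0 p j hpj hj', mul_zero, sub_zero]

/-- Every matrix congruent to `1` modulo `t⁻¹` has a Gauss decomposition; the pivots are units
because they are congruent to `1`. -/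
theorem exists_gauss {X : LMat n R} (hX : CloseToOne X) : ∃ U B : LMat n R, UpperUni U ∧
    CloseToOne U ∧ LowerTri B ∧ (∀ i, OrdGe 1 (B i i - 1)) ∧ X = U * B := by
  obtain ⟨U, hU, hU', h0⟩ := exists_upperUni_mul_lowerTri hX (n + 1)
  have hA : U * U⁻¹ = 1 := Matrix.mul_nonsing_inv U (by rw [hU.det]; exact isUnit_one)
  refine ⟨U⁻¹, U * X, hU.of_mul_eq_one hA, hU'.of_mul_eq_one hU.det hA, fun i j hij =>
    h0 i j hij (by omega), (hU'.mul hX).ordGe_diag, ?_⟩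
  rw [← mul_assoc, mul_eq_one_comm.mp hA, one_mul]

/-- Every lower unitriangular matrix is the product of one which is congruent to `1` modulo `t⁻¹`
and a polynomial one; the polynomial parts are removed row by row. -/
theorem exists_closeToOne_mul_poly {X : LMat n R} (hX : LowerUni X) (k : ℕ) :
    ∃ Q : LMat n R, LowerUni Q ∧ PolyMat Q ∧
      ∀ i j : Fin (n + 1), j < i → (i : ℕ) < k → OrdGe 1 ((X * Q) i j) := by
  induction k with
  | zero => exact ⟨1, lowerUni_one, polyMat_one, fun i j _ h => absurd h (by omega)⟩
  | succ k ih =>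
    obtain ⟨Q, hQ, hQ', h0⟩ := ih
    by_cases hk : n < k
    · exact ⟨Q, hQ, hQ', fun i j hij _ => h0 i j hij (by omega)⟩
    · set p : Fin (n + 1) := ⟨k, by omega⟩ with hp
      set Y := X * Q with hY
      have hYu : LowerUni Y := hX.mul hQ
      set a : Fin (n + 1) → LaurentSeries R :=
        fun j => if j < p then Y p j - trunc (Y p j) else 0 with ha
      set V : LMat n R := Matrix.of fun i j => if i = p then a j else 0 with hV
      have hYV : ∀ i j, (Y * V) i j = Y i p * a j := by
        intro i j
        rw [Matrix.mul_apply, Finset.sum_eq_single p]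
        · rw [hV, Matrix.of_apply, if_pos rfl]
        · intro m _ hm
          rw [hV, Matrix.of_apply, if_neg hm, mul_zero]
        · intro hm
          exact absurd (Finset.mem_univ p) hm
      have hVs : StrictLower V := by
        intro i j hij
        rw [hV, Matrix.of_apply]
        split_ifs with h1
        · rw [ha]
          exact if_neg (not_lt.mpr (h1 ▸ hij))
        · rfl
      have hVg : PolyMat V := by
        intro i j
        rw [hV, Matrix.of_apply]
        split_ifs with h1
        · simp only [ha]
          split_ifs with h2
          · exact isPoly_sub_trunc _
          · exact isPoly_zero
        · exact isPoly_zero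
      have hu : LowerUni (1 - V) :=
        ⟨fun i j hij => by
          rw [Matrix.sub_apply, Matrix.one_apply_ne hij.ne, hVs i j hij.le, sub_zero],
          fun i => by rw [Matrix.sub_apply, Matrix.one_apply_eq, hVs i i le_rfl, sub_zero]⟩
      refine ⟨Q * (1 - V), hQ.mul hu, hQ'.mul (polyMat_one.sub hVg), fun i j hij hi => ?_⟩
      rw [← mul_assoc, ← hY, mul_sub, mul_one, Matrix.sub_apply, hYV]
      by_cases hip : i = p
      · subst hip
        rw [ha]
        simp only [if_pos hij]
        rw [hYu.2, one_mul, sub_sub_cancel]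
        exact ordGe_trunc _
      · have hi' : (i : ℕ) < k := by
          have : (i : ℕ) ≠ k := fun h => hip (Fin.ext h)
          omega
        rw [hYu.1 i p hi', zero_mul, sub_zero]
        exact h0 i j hij hi'

/-- The factorization of `N₋((t⁻¹))` into `N₋,₁[[t⁻¹]]` and `N₋[t]`. -/
theorem exists_lower_factor {X : LMat n R} (hX : LowerUni X) : ∃ l q : LMat n R, LowerUni l ∧
    CloseToOne l ∧ LowerUni q ∧ PolyMat q ∧ X = l * q := by
  obtain ⟨Q, hQ, hQ', h0⟩ := exists_closeToOne_mul_poly hX (n + 1)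
  have hA : Q * Q⁻¹ = 1 := Matrix.mul_nonsing_inv Q (by rw [hQ.det]; exact isUnit_one)
  have hl := hX.mul hQ
  refine ⟨X * Q, Q⁻¹, hl, fun i j => ?_, hQ.of_mul_eq_one hA,
    hQ'.of_mul_eq_one hQ.det hA, by rw [mul_assoc, hA, mul_one]⟩
  rcases lt_trichotomy i j with h | rfl | h
  · rw [Matrix.sub_apply, hl.1 i j h, Matrix.one_apply_ne h.ne, sub_zero]
    exact ordGe_zero 1
  · rw [Matrix.sub_apply, hl.2, Matrix.one_apply_eq, sub_self]
    exact ordGe_zero 1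
  · rw [Matrix.sub_apply, Matrix.one_apply_ne h.ne', sub_zero]
    exact h0 i j h i.2

end Gauss

/-! ### Points of the slices -/

section SlicePoints

variable {n : ℕ} {R S : Type*} [CommRing R] [CommRing S]

/-- The point with given factors. -/
def ofFactors (U : LMat n R) (d : Fin (n + 1) → LaurentSeries R) (l : LMat n R) : Coord n → R
  | .up i j _ r => (U i j).coeff ((r : ℤ) + 1)
  | .tor i r => (d i.succ).coeff ((r : ℤ) + 1)
  | .low i j _ r => (l i j).coeff ((r : ℤ) + 1)

theorem upMat_ofFactors {U : LMat n R} (hU : UpperUni U) (hc : CloseToOne U)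
    (d : Fin (n + 1) → LaurentSeries R) (l : LMat n R) : upMat (ofFactors U d l) = U := by
  ext1 i j
  rcases lt_trichotomy i j with h | rfl | h
  · have := hc i j
    rw [Matrix.sub_apply, Matrix.one_apply_ne h.ne, sub_zero] at this
    rw [upMat_apply_of_lt _ h]
    exact principal_coeff_of_ordGe this
  · rw [(upperUni_upMat _).2, hU.2]
  · rw [(upperUni_upMat _).1 i j h, hU.1 i j h]

theorem lowMat_ofFactors {l : LMat n R} (hl : LowerUni l) (hc : CloseToOne l)
    (U : LMat n R) (d : Fin (n + 1) → LaurentSeries R) : lowMat (ofFactors U d l) = l := by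
  ext1 i j
  rcases lt_trichotomy i j with h | rfl | h
  · rw [(lowerUni_lowMat _).1 i j h, hl.1 i j h]
  · rw [(lowerUni_lowMat _).2, hl.2]
  · have := hc i j
    rw [Matrix.sub_apply, Matrix.one_apply_ne h.ne', sub_zero] at this
    rw [lowMat_apply_of_lt _ h]
    exact principal_coeff_of_ordGe this

theorem torEntry_ofFactors {d : Fin (n + 1) → LaurentSeries R} (h0 : d 0 = 1)
    (hd : ∀ i, OrdGe 1 (d i - 1)) (U l : LMat n R) (i) : torEntry (ofFactors U d l) i = d i := by
  refine Fin.cases ?_ (fun i => ?_) i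
  · rw [torEntry_zero, h0]
  · rw [torEntry_succ]
    have e := principal_coeff_of_ordGe (hd i.succ)
    have e' : (principal fun r => ofFactors U d l (.tor i r)) = d i.succ - 1 := by
      rw [← e]
      congr 1
      funext r
      rw [HahnSeries.coeff_sub, HahnSeries.coeff_one, if_neg (by omega), sub_zero]
      rfl
    rw [e', add_sub_cancel]

theorem eq_of_factors_eq {x y : Coord n → R} (hu : upMat x = upMat y)
    (hd : ∀ i, torEntry x i = torEntry y i) (hl : lowMat x = lowMat y) : x = y := by
  funext c
  cases c with
  | up i j h r =>
    have := congrArg (fun M : LMat n R => (M i j).coeff ((r : ℤ) + 1)) hu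
    simpa only [upMat_apply_of_lt _ h, coeff_principal_succ] using this
  | tor i r =>
    have := congrArg (fun f => f.coeff ((r : ℤ) + 1)) (hd i.succ)
    simpa only [torEntry_succ, HahnSeries.coeff_add, add_right_inj, coeff_principal_succ] using this
  | low i j h r =>
    have := congrArg (fun M : LMat n R => (M i j).coeff ((r : ℤ) + 1)) hl
    simpa only [lowMat_apply_of_lt _ h, coeff_principal_succ] using this

end SlicePoints
/-! ### Points related by elements of `N[t]` and `N₋[t]` -/

section Related

variable {n : ℕ} {R S : Type*} [CommRing R] [CommRing S]

/-- The points `x` of `Gr_μ` and `y` of `Gr_μ'` satisfy `S(y) = A S(x) q`, up to a scalar, with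
`q ∈ N₋[t]`. -/
def Related (μ μ' : Fin (n + 1) → ℤ) (A : LMat n R) (x y : Coord n → R) : Prop :=
  ∃ (c ci : LaurentSeries R) (q : LMat n R), c * ci = 1 ∧ LowerUni q ∧ PolyMat q ∧
    sliceMat μ' y = A * sliceMat μ x * (scal c * q)

theorem scal_mul_scal (c d : LaurentSeries R) : (scal c : LMat n R) * scal d = scal (c * d) := by
  rw [scal, scal, scal, map_mul]

theorem scal_one : (scal 1 : LMat n R) = 1 := by rw [scal, map_one]

theorem smap_scal (θ : R →+* S) (c : LaurentSeries R) :
    smap θ (scal c : LMat n R) = scal (lmap θ c) := by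
  ext1 i j
  rw [smap_apply, scal, scal, Matrix.scalar_apply, Matrix.scalar_apply, Matrix.diagonal_apply,
    Matrix.diagonal_apply]
  split_ifs
  · rfl
  · exact map_zero _

theorem LowerUni.mul_inv {q : LMat n R} (hq : LowerUni q) : q * q⁻¹ = 1 :=
  Matrix.mul_nonsing_inv q (by rw [hq.det]; exact isUnit_one)

theorem UpperUni.mul_inv {q : LMat n R} (hq : UpperUni q) : q * q⁻¹ = 1 :=
  Matrix.mul_nonsing_inv q (by rw [hq.det]; exact isUnit_one)

theorem LowerUni.smap {X : LMat n R} (h : LowerUni X) (θ : R →+* S) : LowerUni (smap θ X) :=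
  ⟨h.1.smap θ, fun i => by rw [smap_apply, h.2, map_one]⟩

theorem PolyMat.smap {X : LMat n R} (h : PolyMat X) (θ : R →+* S) : PolyMat (smap θ X) :=
  fun i j => (h i j).lmap θ

/-- The inverse of `sliceMat`. -/
def sliceInv (μ : Fin (n + 1) → ℤ) (x : Coord n → R) : LMat n R := borInv μ x * upInv x

theorem sliceMat_mul_sliceInv (μ : Fin (n + 1) → ℤ) (x : Coord n → R) :
    sliceMat μ x * sliceInv μ x = 1 := by
  rw [sliceMat_eq, sliceInv]
  calc _ = upMat x * (borMat μ x * borInv μ x) * upInv x := by noncomm_ring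
    _ = 1 := by rw [borMat_mul_borInv, mul_one, upMat_mul_upInv]

namespace Related

variable {μ μ' μ'' : Fin (n + 1) → ℤ} {A B : LMat n R} {x y z : Coord n → R}

theorem trans (h : Related μ μ' A x y) (h' : Related μ' μ'' B y z) :
    Related μ μ'' (B * A) x z := by
  obtain ⟨c, ci, q, hc, hq, hq', e⟩ := h
  obtain ⟨d, di, r, hd, hr, hr', e'⟩ := h'
  refine ⟨c * d, ci * di, q * r, by linear_combination hc * d * di + hd, hq.mul hr, hq'.mul hr', ?_⟩
  rw [e', e, ← scal_mul_scal]
  calc _ = B * A * sliceMat μ x * scal c * (q * scal d) * r := by noncomm_ring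
    _ = _ := by rw [← scal_mul_comm d q]; noncomm_ring

theorem symm (h : Related μ μ' A x y) (hB : B * A = 1) : Related μ' μ B y x := by
  obtain ⟨c, ci, q, hc, hq, hq', e⟩ := h
  have hqi := hq.mul_inv
  refine ⟨ci, c, q⁻¹, by rw [mul_comm, hc], hq.of_mul_eq_one hqi,
    hq'.of_mul_eq_one hq.det hqi, ?_⟩
  rw [e]
  calc sliceMat μ x = 1 * sliceMat μ x * 1 := by rw [one_mul, mul_one]
    _ = (B * A) * sliceMat μ x * (scal c * (q * q⁻¹) * scal ci) := by
        rw [hB, hqi, mul_one, mul_one, scal_mul_scal, hc, scal_one, mul_one]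
    _ = B * A * sliceMat μ x * scal c * q * (q⁻¹ * scal ci) := by noncomm_ring
    _ = _ := by rw [← scal_mul_comm ci]; noncomm_ring

theorem map (h : Related μ μ' A x y) (θ : R →+* S) :
    Related μ μ' (smap θ A) (θ ∘ x) (θ ∘ y) := by
  obtain ⟨c, ci, q, hc, hq, hq', e⟩ := h
  refine ⟨lmap θ c, lmap θ ci, smap θ q, by rw [← map_mul, hc, map_one], hq.smap θ,
    hq'.smap θ, ?_⟩
  rw [← smap_sliceMat, ← smap_sliceMat, e, map_mul, map_mul, map_mul, smap_scal]

/-- Points of the same slice which differ by elements of `N[t]` and `N₋[t]` are equal. -/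
theorem eq_of_upper {P : LMat n R} (h : Related μ μ P x y) (hP : UpperUni P) (hP' : PolyMat P) :
    x = y ∧ P = 1 := by
  obtain ⟨c, ci, q, hc, hq, hq', e⟩ := h
  rw [sliceMat_eq, sliceMat_eq] at e
  have hPi := hP.mul_inv
  -- the upper triangular side of the equation and its lower triangular side are both `1`
  have e1 : upInv x * P⁻¹ * upMat y = borMat μ x * (scal c * q) * borInv μ y := by
    calc _ = upInv x * P⁻¹ * (upMat y * borMat μ y) * borInv μ y := by
          rw [mul_assoc _ (_ * _), mul_assoc (upMat y), borMat_mul_borInv, mul_one]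
      _ = upInv x * (P⁻¹ * P) * upMat x * borMat μ x * (scal c * q) * borInv μ y := by
          rw [e]; noncomm_ring
      _ = _ := by rw [mul_eq_one_comm.mp hPi, mul_one, upInv_mul_upMat, one_mul]
  have hU : UpperUni (upInv x * P⁻¹ * upMat y) :=
    ((upperUni_upInv x).mul (hP.of_mul_eq_one hPi)).mul (upperUni_upMat y)
  have hL : LowerTri (borMat μ x * (scal c * q) * borInv μ y) := by
    refine ((lowerTri_borMat μ x).mul (fun i j hij => ?_)).mul (lowerTri_borInv μ y)
    rw [scal_mul_apply, hq.1 i j hij, mul_zero]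
  have h1 : upInv x * P⁻¹ * upMat y = 1 := by
    ext1 i j
    rcases lt_trichotomy i j with h | rfl | h
    · rw [e1, hL i j h, Matrix.one_apply_ne h.ne]
    · rw [hU.2, Matrix.one_apply_eq]
    · rw [hU.1 i j h, Matrix.one_apply_ne h.ne']
  have h2 : P⁻¹ = upMat x * upInv y := by
    calc P⁻¹ = (upMat x * upInv x) * P⁻¹ * (upMat y * upInv y) := by
          rw [upMat_mul_upInv, upMat_mul_upInv, one_mul, mul_one]
      _ = upMat x * (upInv x * P⁻¹ * upMat y) * upInv y := by noncomm_ring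
      _ = _ := by rw [h1, mul_one]
  have h3 : P⁻¹ = 1 := eq_one_of_polyMat_of_closeToOne (hP'.of_mul_eq_one hP.det hPi)
    (by rw [h2]; exact (closeToOne_upMat x).mul (closeToOne_upInv y))
  have hP1 : P = 1 := by rw [← mul_one P, ← h3, hPi, h3]
  have hup : upMat x = upMat y := by
    rw [h3, mul_one] at h1
    rw [← mul_one (upMat x), ← h1, ← mul_assoc, upMat_mul_upInv, one_mul]
  have hb : borMat μ y = borMat μ x * (scal c * q) := by
    rw [e1] at h1
    rw [← one_mul (borMat μ y), ← h1, mul_assoc _ _ (borMat μ y), borInv_mul_borMat, mul_one]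
  have hbd : ∀ i, torEntry y i = torEntry x i * c := by
    intro i
    have hd := congrFun (congrFun hb i) i
    rw [borMat, borMat, (lowerTri_torMat μ y).mul_diag (lowerUni_lowMat y).1, (lowerUni_lowMat y).2,
      ((lowerTri_torMat μ x).mul (lowerUni_lowMat x).1).mul_diag
        (fun i j hij => by rw [scal_mul_apply, hq.1 i j hij, mul_zero]),
      (lowerTri_torMat μ x).mul_diag (lowerUni_lowMat x).1, (lowerUni_lowMat x).2, scal_mul_apply,
      hq.2, torMat, torMat, Matrix.diagonal_apply_eq, Matrix.diagonal_apply_eq] at hd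
    have hu := isUnit_tPow (R := R) (μ i)
    refine hu.mul_right_cancel ?_
    linear_combination hd
  have hc1 : c = 1 := by
    have := hbd 0
    rw [torEntry_zero, torEntry_zero, one_mul] at this
    exact this.symm
  have htor : ∀ i, torEntry x i = torEntry y i := fun i => by rw [hbd, hc1, mul_one]
  have htm : torMat μ x = torMat μ y := by
    rw [torMat, torMat]
    congr 1
    funext i
    rw [htor]
  have hl : lowMat y = lowMat x * q := by
    rw [hc1, scal_one, one_mul, borMat, borMat, htm] at hb
    calc lowMat y = torInv μ y * (torMat μ y * lowMat y) := by
          rw [← mul_assoc, torInv_mul_torMat, one_mul]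
      _ = torInv μ y * torMat μ y * (lowMat x * q) := by rw [hb]; noncomm_ring
      _ = _ := by rw [torInv_mul_torMat, one_mul]
  have hq1 : q = 1 := by
    refine eq_one_of_polyMat_of_closeToOne hq' ?_
    have : q = lowInv x * lowMat y := by
      rw [hl, ← mul_assoc, lowInv_mul_lowMat, one_mul]
    rw [this]
    exact (closeToOne_lowInv x).mul (closeToOne_lowMat y)
  exact ⟨eq_of_factors_eq hup htor (by rw [hl, hq1, mul_one]), hP1⟩

end Related

/-- Every product of an upper unitriangular matrix congruent to `1` modulo `t⁻¹` and a lower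
triangular matrix with diagonal `t^μ`, up to factors congruent to `1`, lies in the slice after
multiplication by a scalar and an element of `N₋[t]`. -/
theorem exists_sliceMat_mul (μ : Fin (n + 1) → ℤ) {U B : LMat n R} (hU : UpperUni U)
    (hc : CloseToOne U) (hB : LowerTri B) {d : Fin (n + 1) → LaurentSeries R}
    (hd : ∀ i, OrdGe 1 (d i - 1)) (hBd : ∀ i, B i i = d i * tPow R (μ i)) :
    ∃ (x : Coord n → R) (c ci : LaurentSeries R) (q : LMat n R), upMat x = U ∧ c * ci = 1 ∧
      LowerUni q ∧ PolyMat q ∧ sliceMat μ x = U * B * (scal c * q) := by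
  choose di hdi hdi' using fun i => exists_inv_of_ordGe_sub_one (hd i)
  set T : LMat n R := Matrix.diagonal fun i => d i * tPow R (μ i) with hT
  set Ti : LMat n R := Matrix.diagonal fun i => di i * tPow R (-μ i) with hTi
  have hTT : T * Ti = 1 := by
    rw [hT, hTi, Matrix.diagonal_mul_diagonal, ← Matrix.diagonal_one]
    congr 1
    funext i
    have := tPow_mul_tPow (R := R) (μ i) (-μ i)
    rw [add_neg_cancel, tPow_zero] at this
    linear_combination hdi i * tPow R (μ i) * tPow R (-μ i) + this
  have hTiB : LowerUni (Ti * B) := by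
    refine ⟨LowerTri.mul (fun i j h => Matrix.diagonal_apply_ne _ h.ne) hB, fun i => ?_⟩
    rw [hTi, Matrix.diagonal_mul, hBd]
    have := tPow_mul_tPow (R := R) (μ i) (-μ i)
    rw [add_neg_cancel, tPow_zero] at this
    linear_combination hdi i * tPow R (μ i) * tPow R (-μ i) + this
  obtain ⟨l, q, hl, hlc, hq, hqp, e⟩ := exists_lower_factor hTiB
  have hqi := hq.mul_inv
  set x := ofFactors U (fun i => d i * di 0) l with hx
  have hxd : ∀ i, torEntry x i = d i * di 0 := fun i => by
    refine torEntry_ofFactors (hdi 0) (fun i => ?_) U l i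
    have e : d i * di 0 - 1 = (d i - 1) * (di 0 - 1) + (d i - 1) + (di 0 - 1) := by ring
    rw [e]
    exact (((hd i).mul' (hdi' 0) (by norm_num)).add (hd i)).add (hdi' 0)
  refine ⟨x, di 0, d 0, q⁻¹, upMat_ofFactors hU hc _ _, by rw [mul_comm]; exact hdi 0,
    hq.of_mul_eq_one hqi, hqp.of_mul_eq_one hq.det hqi, ?_⟩
  have ht : torMat μ x = scal (di 0) * T := by
    rw [torMat, hT, scal, Matrix.scalar_apply, Matrix.diagonal_mul_diagonal]
    congr 1
    funext i
    rw [hxd]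
    ring
  have hBT : B = T * (l * q) := by rw [← e, ← mul_assoc, hTT, one_mul]
  rw [sliceMat, upMat_ofFactors hU hc, lowMat_ofFactors hl hlc, ht, hBT]
  calc _ = U * (scal (di 0) * (T * l)) := by noncomm_ring
    _ = U * T * l * 1 * scal (di 0) := by rw [scal_mul_comm]; noncomm_ring
    _ = U * T * (l * q) * (q⁻¹ * scal (di 0)) := by rw [← hqi]; noncomm_ring
    _ = _ := by rw [← scal_mul_comm]; noncomm_ring

end Related
/-! ### The action of the root group -/

section Translation

variable {n : ℕ} {a b : Fin (n + 1)} {R S : Type*} [CommRing R] [CommRing S]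

/-- The tangent vector `∑_j v_j E_bj`. -/
def rootMat (v : Root a b → R) : LMat n R :=
  ∑ j : Root a b, Matrix.single b j.1 (HahnSeries.C (v j))

theorem transMat_eq (v : Root a b → R) : transMat v = 1 + rootMat v := rfl

theorem rootMat_apply (v : Root a b → R) (i k : Fin (n + 1)) : rootMat v i k =
    if h : i = b ∧ a ≤ k ∧ k < b then HahnSeries.C (v ⟨k, h.2⟩) else 0 := by
  rw [rootMat, Matrix.sum_apply]
  split_ifs with h
  · rw [Finset.sum_eq_single ⟨k, h.2⟩]
    · rw [Matrix.single_apply, if_pos ⟨h.1.symm, rfl⟩]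
    · rintro j - hj
      rw [Matrix.single_apply, if_neg]
      rintro ⟨-, rfl⟩
      exact hj rfl
    · exact fun h => absurd (Finset.mem_univ _) h
  · refine Finset.sum_eq_zero fun j _ => ?_
    rw [Matrix.single_apply, if_neg]
    rintro ⟨rfl, rfl⟩
    exact h ⟨rfl, j.2⟩

theorem rootMat_add (v w : Root a b → R) : rootMat (v + w) = rootMat v + rootMat w := by
  ext1 i k
  rw [Matrix.add_apply, rootMat_apply, rootMat_apply, rootMat_apply]
  split_ifs
  · exact map_add _ _ _
  · rw [add_zero]

theorem rootMat_zero : rootMat (0 : Root a b → R) = 0 := by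
  ext1 i k
  rw [rootMat_apply]
  split_ifs
  · exact map_zero _
  · rfl

theorem rootMat_mul_apply_of_ne (v : Root a b → R) (X : LMat n R) {i : Fin (n + 1)} (h : i ≠ b)
    (k) : (rootMat v * X) i k = 0 := by
  rw [Matrix.mul_apply]
  exact Finset.sum_eq_zero fun j _ => by rw [rootMat_apply, dif_neg (fun h' => h h'.1), zero_mul]

theorem mul_rootMat_apply_last (v : Root a b → R) (X : LMat n R) (i) :
    (X * rootMat v) i b = 0 := by
  rw [Matrix.mul_apply]
  exact Finset.sum_eq_zero fun j _ => by
    rw [rootMat_apply, dif_neg (fun h' => lt_irrefl _ h'.2.2), mul_zero]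

theorem rootMat_mul_rootMat (v w : Root a b → R) : rootMat v * rootMat w = 0 := by
  ext1 i k
  rw [Matrix.mul_apply]
  refine Finset.sum_eq_zero fun j _ => ?_
  by_cases h : j = b
  · rw [rootMat_apply v, dif_neg (fun h' => h'.2.2.ne h), zero_mul]
  · rw [rootMat_apply w, dif_neg (fun h' => h h'.1), mul_zero]

theorem transMat_mul_transMat (v w : Root a b → R) :
    transMat v * transMat w = transMat (v + w) := by
  rw [transMat_eq, transMat_eq, transMat_eq, rootMat_add, add_mul, mul_add, mul_add,
    rootMat_mul_rootMat]
  noncomm_ring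

theorem transMat_zero : transMat (0 : Root a b → R) = 1 := by
  rw [transMat_eq, rootMat_zero, add_zero]

theorem transMat_mul_neg (v : Root a b → R) : transMat v * transMat (-v) = 1 := by
  rw [transMat_mul_transMat, add_neg_cancel, transMat_zero]

theorem transMat_neg_mul (v : Root a b → R) : transMat (-v) * transMat v = 1 := by
  rw [transMat_mul_transMat, neg_add_cancel, transMat_zero]

theorem smap_transMat (θ : R →+* S) (v : Root a b → R) :
    smap θ (transMat v) = transMat (θ ∘ v) := by
  rw [transMat_eq, transMat_eq, map_add, map_one]
  congr 1
  ext1 i k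
  rw [smap_apply, rootMat_apply, rootMat_apply]
  split_ifs
  · exact lmap_C θ _
  · exact map_zero _

theorem strictLower_rootMat (v : Root a b → R) : StrictLower (rootMat v) := by
  intro i k hik
  rw [rootMat_apply, dif_neg]
  rintro ⟨rfl, -, h⟩
  exact absurd h (not_lt.mpr hik)

theorem lowerUni_transMat (v : Root a b → R) : LowerUni (transMat v) := by
  refine ⟨fun i k h => ?_, fun i => ?_⟩
  · rw [transMat_eq, Matrix.add_apply, Matrix.one_apply_ne h.ne, strictLower_rootMat v i k h.le,
      add_zero]
  · rw [transMat_eq, Matrix.add_apply, Matrix.one_apply_eq, strictLower_rootMat v i i le_rfl,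
      add_zero]

theorem matGe_transMat (v : Root a b → R) : MatGe 0 (transMat v) := by
  rw [transMat_eq]
  refine matGe_one.add fun i k m hm => ?_
  rw [rootMat_apply]
  split_ifs
  · rw [HahnSeries.C_apply, HahnSeries.coeff_single, if_neg hm.ne]
  · rfl

theorem closeToOne_conj {A B X : LMat n R} (hA : MatGe 0 A) (hB : MatGe 0 B) (hAB : A * B = 1)
    (hX : CloseToOne X) : CloseToOne (A * X * B) := by
  have e : A * X * B - 1 = A * (X - 1) * B := by
    rw [mul_sub, sub_mul, mul_one, hAB]
  rw [CloseToOne, e]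
  exact MatGe.mul (k := 1) (l := 0) (MatGe.mul (k := 0) (l := 1) hA hX) hB

/-- The projection of `x_{-α}(v) g` to the slice exists; the left factor in `N[t]` is not needed. -/
theorem exists_related_transMat (μ : Fin (n + 1) → ℤ) (v : Root a b → R) (x : Coord n → R) :
    ∃ y, Related μ μ (transMat v) x y := by
  obtain ⟨U, B, hU, hU', hB, hB', e⟩ := exists_gauss
    (closeToOne_conj (matGe_transMat v) (matGe_transMat (-v)) (transMat_mul_neg v)
      (closeToOne_upMat x))
  have hL := lowerUni_transMat v
  have hT := lowerTri_borMat μ x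
  have hd : ∀ i, OrdGe 1 (B i i * torEntry x i - 1) := fun i => by
    have e : B i i * torEntry x i - 1 = (B i i - 1) * torEntry x i + (torEntry x i - 1) := by ring
    rw [e]
    exact ((hB' i).mul' (ordGe_torEntry x i) (by norm_num)).add (ordGe_torEntry_sub_one x i)
  obtain ⟨y, c, ci, q, -, hc, hq, hq', e'⟩ := exists_sliceMat_mul μ hU hU'
    (hB.mul (hL.1.mul hT)) hd fun i => by
      rw [hB.mul_diag (hL.1.mul hT), hL.1.mul_diag hT, hL.2, borMat,
        (lowerTri_torMat μ x).mul_diag (lowerUni_lowMat x).1, (lowerUni_lowMat x).2, torMat,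
        Matrix.diagonal_apply_eq]
      ring
  have key : U * (B * (transMat v * borMat μ x)) = transMat v * sliceMat μ x := by
    rw [← mul_assoc, ← e, sliceMat_eq, mul_assoc _ (transMat (-v)), ← mul_assoc (transMat (-v)),
      transMat_neg_mul, one_mul, mul_assoc]
  exact ⟨y, c, ci, q, hc, hq, hq', by rw [e', key]⟩

theorem coeff_one_mul {X Y : LMat n R} (hX : CloseToOne X) (hY : CloseToOne Y)
    {i j : Fin (n + 1)} (h : i ≠ j) :
    ((X * Y) i j).coeff 1 = (X i j).coeff 1 + (Y i j).coeff 1 := by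
  have e : X * Y = (X - 1) * (Y - 1) + X + Y - 1 := by noncomm_ring
  have h0 : (((X - 1) * (Y - 1)) i j).coeff 1 = 0 :=
    MatGe.mul (k := 1) (l := 1) hX hY i j 1 (by norm_num)
  rw [e, Matrix.sub_apply, Matrix.one_apply_ne h, sub_zero, Matrix.add_apply, Matrix.add_apply,
    HahnSeries.coeff_add, HahnSeries.coeff_add, h0, zero_add]

/-- The moment map is invariant, as one sees on the coefficient of `t⁻¹`. -/
theorem Related.momentCoord_eq {μ : Fin (n + 1) → ℤ} {v : Root a b → R} {x y : Coord n → R}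
    (h : Related μ μ (transMat v) x y) (j : Root a b) :
    y (momentCoord j) = x (momentCoord j) := by
  obtain ⟨c, ci, q, hc, hq, hq', e⟩ := h
  have hqi := hq.mul_inv
  have hjb : j.1 ≠ b := j.2.2.ne
  set M := borMat μ y * (q⁻¹ * scal ci) * borInv μ x * transMat (-v) with hM
  have hML : LowerTri M := by
    refine ((((lowerTri_borMat μ y).mul ?_).mul (lowerTri_borInv μ x))).mul
      (lowerUni_transMat (-v)).1
    intro i k hik
    rw [← scal_mul_comm, scal_mul_apply, (hq.of_mul_eq_one hqi).1 i k hik, mul_zero]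
  have e1 : upMat y * M = transMat v * upMat x * transMat (-v) := by
    rw [hM]
    calc _ = (upMat y * borMat μ y) * (q⁻¹ * scal ci) * borInv μ x * transMat (-v) := by
          noncomm_ring
      _ = transMat v * upMat x * borMat μ x * (scal c * (q * q⁻¹) * scal ci) * borInv μ x *
          transMat (-v) := by
          rw [← sliceMat_eq, e, sliceMat_eq]; noncomm_ring
      _ = transMat v * upMat x * (borMat μ x * borInv μ x) * transMat (-v) := by
          rw [hqi, mul_one, scal_mul_scal, hc, scal_one]; noncomm_ring
      _ = _ := by rw [borMat_mul_borInv, mul_one]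
  have hMc : CloseToOne M := by
    have : M = upInv y * (transMat v * upMat x * transMat (-v)) := by
      rw [← e1, ← mul_assoc, upInv_mul_upMat, one_mul]
    rw [this]
    exact (closeToOne_upInv y).mul (closeToOne_conj (matGe_transMat v) (matGe_transMat (-v))
      (transMat_mul_neg v) (closeToOne_upMat x))
  have e2 := congrArg (fun X : LMat n R => (X j.1 b).coeff 1) e1
  have e3 : (transMat v * upMat x * transMat (-v)) j.1 b = upMat x j.1 b := by
    rw [transMat_eq (-v), mul_add, mul_one, Matrix.add_apply, mul_rootMat_apply_last, add_zero,
      transMat_eq, add_mul, one_mul, Matrix.add_apply, rootMat_mul_apply_of_ne _ _ hjb, add_zero]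
  simp only [coeff_one_mul (closeToOne_upMat y) hMc hjb, hML j.1 b j.2.2, e3,
    HahnSeries.coeff_zero, add_zero, upMat_apply_of_lt _ j.2.2] at e2
  have h0 := fun x : Coord n → R => coeff_principal_succ (fun r => x (.up j.1 b j.2.2 r)) 0
  norm_num at h0
  rwa [h0, h0] at e2

/-- The projection in terms of matrices: the class modulo scalars is expressed by the scalar factor
in `Related`. -/
theorem isProjection_iff {μ : Fin (n + 1) → ℤ} {v : Root a b → R} {x y : Coord n → R} :
    IsProjection μ (translation v * slicePoint μ x) y ↔
      ∃ P : LMat n R, UpperUni P ∧ PolyMat P ∧ Related μ μ (P * transMat v) x y := by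
  constructor
  · rintro ⟨p, q, hp, hq, h⟩
    rw [translation, slicePoint, slicePoint, ← map_mul, ← map_mul, ← map_mul, eq_comm,
      Matrix.ProjGenLinGroup.mk_eq_mk_iff] at h
    obtain ⟨r, hr⟩ := h
    rw [isUpperPoly_iff] at hp
    rw [isLowerPoly_iff] at hq
    refine ⟨p.1, hp.1, hp.2, r.1, r⁻¹.1, q.1, r.mul_inv, hq.1, hq.2, ?_⟩
    have := congrArg Units.val hr
    rw [← coe_sliceGL, ← this]
    have hs : (Matrix.GeneralLinearGroup.scalar (Fin (n + 1)) r).1 = (scal r.1 : LMat n R) := rfl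
    rw [Units.val_mul, Units.val_mul, Units.val_mul, Units.val_mul, hs, scal_mul_comm, coe_sliceGL]
    change p.1 * (transMat v * sliceMat μ x) * q.1 * scal r.1 = _
    noncomm_ring
  · rintro ⟨P, hP, hP', c, ci, q, hc, hq, hq', e⟩
    refine ⟨Matrix.GeneralLinearGroup.mk'' P (by rw [hP.det]; exact isUnit_one),
      Matrix.GeneralLinearGroup.mk'' q (by rw [hq.det]; exact isUnit_one),
      isUpperPoly_iff.mpr ⟨hP, hP'⟩, isLowerPoly_iff.mpr ⟨hq, hq'⟩, ?_⟩
    rw [translation, slicePoint, slicePoint, ← map_mul, ← map_mul, ← map_mul, eq_comm,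
      Matrix.ProjGenLinGroup.mk_eq_mk_iff]
    refine ⟨⟨c, ci, hc, by rw [mul_comm, hc]⟩, Units.ext ?_⟩
    rw [coe_sliceGL, e]
    change P * (transMat v * sliceMat μ x) * q * scal c = _
    rw [scal_mul_comm]
    noncomm_ring

end Translation

section ActionMap

variable {n : ℕ} (μ : Fin (n + 1) → ℤ) (a b : Fin (n + 1))

theorem exists_translationMap : ∃ ρ : ActionMap n a b,
    Related μ μ (transMat (fun j => MvPolynomial.X (Sum.inl j)))
      (fun c => MvPolynomial.X (Sum.inr c)) ρ :=
  exists_related_transMat μ _ _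

/-- The action of `G_α` on `Gr_μ`, obtained from the projection of the universal translate. -/
def translationMap : ActionMap n a b := (exists_translationMap μ a b).choose

variable {a b}

theorem related_act {R : Type*} [CommRing R] [Algebra ℂ R] (v : Root a b → R) (x : Coord n → R) :
    Related μ μ (transMat v) x ((translationMap μ a b).act v x) := by
  have h := (exists_translationMap μ a b).choose_spec.map
    (MvPolynomial.aeval (Sum.elim v x) : MvPolynomial (Root a b ⊕ Coord n) ℂ →ₐ[ℂ] R).toRingHom
  rw [smap_transMat] at h
  have hv : ((MvPolynomial.aeval (Sum.elim v x) : MvPolynomial (Root a b ⊕ Coord n) ℂ →ₐ[ℂ]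
      R).toRingHom ∘ fun j => MvPolynomial.X (Sum.inl j)) = v := by
    funext j
    exact MvPolynomial.aeval_X _ _
  have hx : ((MvPolynomial.aeval (Sum.elim v x) : MvPolynomial (Root a b ⊕ Coord n) ℂ →ₐ[ℂ]
      R).toRingHom ∘ fun c => MvPolynomial.X (Sum.inr c)) = x := by
    funext j
    exact MvPolynomial.aeval_X _ _
  rwa [hv, hx] at h

theorem eq_act_of_related {R : Type*} [CommRing R] [Algebra ℂ R] {v : Root a b → R}
    {x y : Coord n → R} {P : LMat n R} (hP : UpperUni P) (hP' : PolyMat P)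
    (h : Related μ μ (P * transMat v) x y) : y = (translationMap μ a b).act v x := by
  have h1 := ((related_act μ v x).symm (transMat_neg_mul v)).trans h
  rw [mul_assoc, transMat_mul_neg, mul_one] at h1
  exact (h1.eq_of_upper hP hP').1.symm

theorem zero_act {R : Type*} [CommRing R] [Algebra ℂ R] (x : Coord n → R) :
    (translationMap μ a b).act (0 : Root a b → R) x = x := by
  have h := related_act μ (0 : Root a b → R) x
  rw [transMat_zero] at h
  exact (h.eq_of_upper upperUni_one polyMat_one).1.symm

theorem add_act {R : Type*} [CommRing R] [Algebra ℂ R] (v w : Root a b → R) (x : Coord n → R) :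
    (translationMap μ a b).act (v + w) x =
      (translationMap μ a b).act v ((translationMap μ a b).act w x) := by
  refine (eq_act_of_related μ upperUni_one polyMat_one ?_).symm
  rw [one_mul, ← transMat_mul_transMat]
  exact (related_act μ w x).trans (related_act μ v _)

theorem isTranslationAction : IsTranslationAction μ (translationMap μ a b) where
  isProjection R _ _ v x := isProjection_iff.mpr
    ⟨1, upperUni_one, polyMat_one, by rw [one_mul]; exact related_act μ v x⟩
  unique R _ _ v x y h := by
    obtain ⟨P, hP, hP', h⟩ := isProjection_iff.mp h
    exact eq_act_of_related μ hP hP' h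
  zero_act R _ _ x := zero_act μ x
  add_act R _ _ v w x := add_act μ v w x

end ActionMap
/-! ### The action is Hamiltonian -/

section Hamiltonian

variable {n : ℕ} (μ : Fin (n + 1) → ℤ) {a b : Fin (n + 1)}

theorem act_map (ρ : ActionMap n a b) {R S : Type*} [CommRing R] [Algebra ℂ R] [CommRing S]
    [Algebra ℂ S] (φ : R →ₐ[ℂ] S) (v : Root a b → R) (x : Coord n → R) :
    φ ∘ ρ.act v x = ρ.act (φ ∘ v) (φ ∘ x) := by
  funext c
  change φ (MvPolynomial.aeval (Sum.elim v x) (ρ c)) =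
    MvPolynomial.aeval (Sum.elim (φ ∘ v) (φ ∘ x)) (ρ c)
  rw [← AlgHom.comp_apply, MvPolynomial.comp_aeval]
  congr 2
  funext s
  cases s <;> rfl

/-- The Hamiltonian field of `Φ_α,j` pairs the gradient of a function with the tangent vector
`E_bj g`. -/
theorem bracket_momentCoord (j : Root a b) (f : CoordRing n) :
    bracket μ (MvPolynomial.X (momentCoord j)) f =
      ((sliceMat μ (univ n) * grad μ f) j.1 b).coeff 1 := by
  have hjb : j.1 ≠ b := j.2.2.ne
  have h1 := hamiltonianField_X μ f (momentCoord j)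
  have h2 : (((gradLeft μ f) * (upMat (univ n) - 1)) j.1 b).coeff 1 = 0 :=
    MatGe.mul (k := 1) (l := 1) (matGe_gradLeft μ f) (closeToOne_upMat _) j.1 b 1 (by norm_num)
  have h3 : (((upMat (univ n) - 1) * Matrix.diagonal fun i => gradLeft μ f i i) j.1 b).coeff 1 =
      0 := MatGe.mul (k := 1) (l := 1) (closeToOne_upMat _) (matGe_gradLeft μ f).diag j.1 b 1
        (by norm_num)
  have e : gradLeft μ f * upMat (univ n) -
      upMat (univ n) * (Matrix.diagonal fun i => gradLeft μ f i i) =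
      gradLeft μ f * (upMat (univ n) - 1) -
        (upMat (univ n) - 1) * (Matrix.diagonal fun i => gradLeft μ f i i) +
        (gradLeft μ f - Matrix.diagonal fun i => gradLeft μ f i i) := by
    simp only [mul_sub, sub_mul, mul_one, one_mul]
    abel
  refine h1.trans ?_
  change (varUp μ (hamField μ f) j.1 b).coeff (((0 : ℕ) : ℤ) + 1) = _
  rw [Nat.cast_zero, zero_add, varUp_hamField, e, Matrix.add_apply, Matrix.sub_apply,
    Matrix.sub_apply, Matrix.diagonal_apply_ne _ hjb, sub_zero, HahnSeries.coeff_add,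
    HahnSeries.coeff_sub, h2, h3, sub_zero, zero_add, gradLeft_eq, truncMat_apply, coeff_trunc,
    if_pos (by norm_num)]

variable (ρ : ActionMap n a b)

/-- The coordinate ring of the product of the group and the slice. -/
abbrev ActionRing (n : ℕ) (a b : Fin (n + 1)) : Type := MvPolynomial (Root a b ⊕ Coord n) ℂ

/-- The restriction of functions to the unit of the group. -/
def evalAtZero (a b : Fin (n + 1)) : ActionRing n a b →ₐ[ℂ] CoordRing n :=
  MvPolynomial.aeval (Sum.elim 0 (univ n))

/-- The derivative of a function at the unit of the group. -/
def derivAtZero (a b : Fin (n + 1)) (j : Root a b) : ActionRing n a b →+ CoordRing n :=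
  (evalAtZero a b : ActionRing n a b →+ CoordRing n).comp
    ((MvPolynomial.pderiv (Sum.inl j) : Derivation ℂ (ActionRing n a b) (ActionRing n a b)) :
      ActionRing n a b →+ ActionRing n a b)

theorem derivAtZero_apply (j : Root a b) (f : ActionRing n a b) :
    derivAtZero a b j f = evalAtZero a b (MvPolynomial.pderiv (Sum.inl j) f) := rfl

theorem derivAtZero_mul (j : Root a b) (f g : ActionRing n a b) :
    derivAtZero a b j (f * g) =
      evalAtZero a b f * derivAtZero a b j g + derivAtZero a b j f * evalAtZero a b g := by
  rw [derivAtZero_apply, MvPolynomial.pderiv_mul, map_add, map_mul, map_mul, add_comm]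
  rfl

theorem derivAtZero_C (j : Root a b) (z : ℂ) : derivAtZero a b j (MvPolynomial.C z) = 0 := by
  rw [derivAtZero_apply, MvPolynomial.pderiv_C, map_zero]

theorem derivAtZero_one (j : Root a b) :
    derivAtZero a b j (1 : ActionRing n a b) = 0 := derivAtZero_C j 1

theorem derivAtZero_rename (j : Root a b) (f : CoordRing n) :
    derivAtZero a b j (MvPolynomial.rename Sum.inr f) = 0 := by
  induction f using MvPolynomial.induction_on with
  | C z => rw [MvPolynomial.rename_C, derivAtZero_C]
  | add f g hf hg => rw [map_add, map_add, hf, hg, add_zero]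
  | mul_X f c hf =>
    have hX : derivAtZero a b j (MvPolynomial.X (Sum.inr c)) = 0 := by
      rw [derivAtZero_apply, MvPolynomial.pderiv_X_of_ne (by simp), map_zero]
    rw [map_mul, derivAtZero_mul, hf, MvPolynomial.rename_X, hX, mul_zero, zero_mul, add_zero]

theorem derivAtZero_X (j k : Root a b) :
    derivAtZero a b j (MvPolynomial.X (Sum.inl k) : ActionRing n a b) =
      if k = j then 1 else 0 := by
  classical
  rw [derivAtZero_apply, MvPolynomial.pderiv_X, Pi.single_apply]
  by_cases h : k = j
  · rw [if_pos h, if_pos (by rw [h]), map_one]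
  · rw [if_neg h, if_neg (by simpa using h), map_zero]

theorem dmap_derivAtZero_transMat (j : Root a b) :
    dmap (derivAtZero a b j) (transMat (fun k => MvPolynomial.X (Sum.inl k))) =
      (Matrix.single b j.1 1 : LoopMat n) := by
  have h1 : dmap (derivAtZero a b j)
      (1 : LMat n (ActionRing n a b)) = 0 := by
    ext1 i k
    rw [dmap_apply, Matrix.one_apply]
    split_ifs
    · refine HahnSeries.ext (funext fun m => ?_)
      rw [coeff_cmap, HahnSeries.coeff_one]
      split_ifs
      · exact derivAtZero_one j
      · exact map_zero _
    · exact map_zero _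
  rw [transMat_eq, map_add, h1, zero_add]
  ext1 i k
  rw [dmap_apply, rootMat_apply, Matrix.single_apply]
  by_cases h : i = b ∧ a ≤ k ∧ k < b
  · rw [dif_pos h]
    refine HahnSeries.ext (funext fun m => ?_)
    rw [coeff_cmap, HahnSeries.C_apply, HahnSeries.coeff_single]
    by_cases hm : m = 0
    · rw [if_pos hm, derivAtZero_X]
      by_cases hk : j.1 = k
      · rw [if_pos (Subtype.ext hk.symm), if_pos ⟨h.1.symm, hk⟩, HahnSeries.coeff_one, if_pos hm]
      · rw [if_neg (fun h' => hk (congrArg Subtype.val h').symm), if_neg (fun h' => hk h'.2)]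
        rfl
    · rw [if_neg hm, map_zero]
      split_ifs
      · rw [HahnSeries.coeff_one, if_neg hm]
      · rfl
  · rw [dif_neg h, map_zero, if_neg]
    rintro ⟨rfl, rfl⟩
    exact h ⟨rfl, j.2⟩

theorem evalAtZero_comp_translationMap :
    evalAtZero a b ∘ translationMap μ a b = univ n := zero_act μ (univ n)

theorem aeval_translationMap_evalAtZero (f : CoordRing n) :
    evalAtZero a b (MvPolynomial.aeval (translationMap μ a b) f) = f := by
  have h : (evalAtZero a b).comp (MvPolynomial.aeval (translationMap μ a b)) = AlgHom.id ℂ _ := by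
    refine MvPolynomial.algHom_ext fun c => ?_
    rw [AlgHom.comp_apply, MvPolynomial.aeval_X]
    exact congrFun (evalAtZero_comp_translationMap μ) c
  exact DFunLike.congr_fun h f

/-- The infinitesimal action as an additive map. -/
def infinitesimalHom (j : Root a b) : CoordRing n →+ CoordRing n :=
  (derivAtZero a b j).comp
    ((MvPolynomial.aeval (translationMap μ a b) : CoordRing n →ₐ[ℂ] _) : CoordRing n →+ _)

theorem isDerivAlong_infinitesimalHom (j : Root a b) :
    IsDerivAlong (RingHom.id _) (infinitesimalHom μ j) where
  leibniz f g := by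
    change derivAtZero a b j (MvPolynomial.aeval (translationMap μ a b) (f * g)) = _
    rw [map_mul, derivAtZero_mul, aeval_translationMap_evalAtZero, aeval_translationMap_evalAtZero]
    rfl
  map_C z := by
    change derivAtZero a b j (MvPolynomial.aeval (translationMap μ a b) (MvPolynomial.C z)) = _
    rw [MvPolynomial.aeval_C]
    exact derivAtZero_C j z

theorem evalAtZero_comp_inr : evalAtZero a b ∘ (fun c => MvPolynomial.X (Sum.inr c)) = univ n := by
  funext c
  exact MvPolynomial.aeval_X _ _

theorem dmap_derivAtZero_sliceMat (j : Root a b) :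
    dmap (derivAtZero a b j) (sliceMat μ fun c => MvPolynomial.X (Sum.inr c)) = 0 := by
  have e : sliceMat μ (fun c => (MvPolynomial.X (Sum.inr c) : ActionRing n a b)) =
      smap ((MvPolynomial.rename Sum.inr : CoordRing n →ₐ[ℂ] ActionRing n a b) :
        CoordRing n →+* ActionRing n a b) (sliceMat μ (univ n)) := by
    rw [smap_sliceMat]
    congr 1
    funext c
    exact (MvPolynomial.rename_X _ _).symm
  rw [e]
  ext1 i k
  refine HahnSeries.ext (funext fun m => ?_)
  exact derivAtZero_rename j _

theorem eq_one_of_scal_mul_lowerUni {R : Type*} [CommRing R] {c : LaurentSeries R} {q : LMat n R}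
    (hq : LowerUni q) (h : scal c * q = 1) : c = 1 ∧ q = 1 := by
  have h0 := congrFun (congrFun h 0) 0
  rw [scal_mul_apply, hq.2, mul_one, Matrix.one_apply_eq] at h0
  rw [h0, scal_one, one_mul] at h
  exact ⟨h0, h⟩

/-- The derivative of a family `V = T X c q` at a point where `T = 1` and `V = X`. The factors `c`
and `q` are trivial there, so their derivatives are a scalar and an element of `𝔫₋[t]`. -/
theorem exists_dmap_eq {R S : Type*} [CommRing R] [CommRing S] {θ : R →+* S} {D : R →+ S}
    (hD : ∀ x y, D (x * y) = θ x * D y + D x * θ y) (hD1 : D 1 = 0) {V T X q : LMat n R}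
    {c : LaurentSeries R} (e : V = T * X * (scal c * q)) (hq : LowerUni q) (hq' : PolyMat q)
    (hT : smap θ T = 1) (hX : dmap D X = 0) (hV : smap θ V = smap θ X) {Y : LMat n S}
    (hY : smap θ X * Y = 1) :
    ∃ (z : LaurentSeries S) (Z : LMat n S), StrictLower Z ∧ PolyMat Z ∧
      dmap D V = smap θ X * (Z + scal z) + dmap D T * smap θ X := by
  have hG := mul_eq_one_comm.mp hY
  -- the correction factor is trivial after specialization
  have hQ : scal (lmap θ c) * smap θ q = 1 := by
    have h := congrArg (smap θ) e
    rw [map_mul, map_mul, map_mul, hT, one_mul, smap_scal, hV] at h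
    calc _ = (Y * smap θ X) * (scal (lmap θ c) * smap θ q) := by rw [hG, one_mul]
      _ = 1 := by rw [mul_assoc, ← h, hG]
  obtain ⟨hc1, hq1⟩ := eq_one_of_scal_mul_lowerUni (hq.smap θ) hQ
  refine ⟨cmap D c, dmap D q, strictLower_dmap hD1 hq, hq'.dmap _, ?_⟩
  rw [e, dmap_mul hD, dmap_mul hD T, dmap_mul hD (scal c), hX, dmap_scal, map_mul, map_mul,
    smap_scal, hT, hc1, hq1, scal_one]
  simp only [one_mul, mul_one, mul_zero, zero_add]

/-- The infinitesimal action in the direction `j` moves the universal point along `E_bj g`, up to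
`g 𝔫₋[t]` and scalars, to which the gradients are orthogonal. -/
theorem dmap_infinitesimalHom (j : Root a b) : ∃ (z : LaurentSeries (CoordRing n)) (Y : LoopMat n),
    StrictLower Y ∧ PolyMat Y ∧ dmap (infinitesimalHom μ j) (sliceMat μ (univ n)) =
      sliceMat μ (univ n) * (Y + scal z) + Matrix.single b j.1 1 * sliceMat μ (univ n) := by
  obtain ⟨c, ci, q, hc, hq, hq', e⟩ := (exists_translationMap μ a b).choose_spec
  have hθT : smap (evalAtZero a b : ActionRing n a b →+* CoordRing n)
      (transMat fun k => MvPolynomial.X (Sum.inl k)) = 1 := by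
    rw [smap_transMat, ← transMat_zero (a := a) (b := b)]
    congr 1
    funext k
    exact MvPolynomial.aeval_X _ _
  have hθS : smap (evalAtZero a b : ActionRing n a b →+* CoordRing n)
      (sliceMat μ fun c => MvPolynomial.X (Sum.inr c)) = sliceMat μ (univ n) := by
    rw [smap_sliceMat]
    congr 1
    exact evalAtZero_comp_inr
  have hθρ : smap (evalAtZero a b : ActionRing n a b →+* CoordRing n)
      (sliceMat μ (translationMap μ a b)) = sliceMat μ (univ n) := by
    rw [smap_sliceMat]
    congr 1
    exact evalAtZero_comp_translationMap μ
  have h := exists_dmap_eq (θ := (evalAtZero a b : ActionRing n a b →+* CoordRing n))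
    (derivAtZero_mul (a := a) (b := b) j) (derivAtZero_one j) e hq hq' hθT
    (dmap_derivAtZero_sliceMat μ j) (hθρ.trans hθS.symm)
    (by rw [hθS]; exact sliceMat_mul_sliceInv μ (univ n))
  rw [hθS, dmap_derivAtZero_transMat] at h
  have e1 : dmap (infinitesimalHom μ j) (sliceMat μ (univ n)) =
      dmap (derivAtZero a b j) (sliceMat μ (translationMap μ a b)) := by
    have h : sliceMat μ (translationMap μ a b) =
        smap ((MvPolynomial.aeval (translationMap μ a b) : CoordRing n →ₐ[ℂ] ActionRing n a b) :
          CoordRing n →+* ActionRing n a b) (sliceMat μ (univ n)) := by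
      rw [smap_sliceMat]
      congr 1
      funext c
      exact (MvPolynomial.aeval_X _ _).symm
    rw [h]
    rfl
  rw [e1]
  exact h

theorem infinitesimal_eq_bracket (j : Root a b) (f : CoordRing n) :
    (translationMap μ a b).infinitesimal j f = bracket μ (MvPolynomial.X (momentCoord j)) f := by
  obtain ⟨z, Y, hY, hY', e⟩ := dmap_infinitesimalHom μ j
  have h := (isDerivAlong_infinitesimalHom μ j).map_eq_res μ f
  rw [smap_id] at h
  refine h.trans ?_
  have z1 : res (sliceMat μ (univ n) * (Y + scal z) * grad μ f) = 0 := by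
    rw [mul_assoc, res_comm, mul_assoc, add_mul, map_add, res_scal_mul _ z, add_zero]
    · exact res_strictLower_mul hY hY' (upperIsPoly_grad_mul μ f)
    · rw [Matrix.trace_mul_comm, trace_mul_grad]
  rw [e, add_mul, map_add, z1, zero_add, mul_assoc, res_comm, res_mul_single, mul_one,
    bracket_momentCoord]

/-! ### The action is by Poisson automorphisms -/

theorem pullback_comp_pullback (v w : Root a b → ℂ) (f : CoordRing n) :
    (translationMap μ a b).pullback v ((translationMap μ a b).pullback w f) =
      (translationMap μ a b).pullback (w + v) f := by
  have h : ((translationMap μ a b).pullback v).comp ((translationMap μ a b).pullback w) =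
      (translationMap μ a b).pullback (w + v) := by
    refine MvPolynomial.algHom_ext fun c => ?_
    have e1 := congrFun (act_map (translationMap μ a b) ((translationMap μ a b).pullback v)
      (fun j => MvPolynomial.C (w j)) (univ n)) c
    have e2 : (translationMap μ a b).pullback v ∘ (fun j => MvPolynomial.C (w j)) =
        fun j => MvPolynomial.C (w j) := by
      funext j
      exact MvPolynomial.aeval_C _ _
    have e3 : (translationMap μ a b).pullback v ∘ univ n =
        (translationMap μ a b).act (fun j => MvPolynomial.C (v j)) (univ n) := by
      funext c
      exact MvPolynomial.aeval_X _ _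
    rw [e2, e3, ← add_act] at e1
    have e4 : ((fun j => MvPolynomial.C (w j)) + fun j => MvPolynomial.C (v j) :
        Root a b → CoordRing n) = fun j => MvPolynomial.C ((w + v) j) := by
      funext j
      exact (map_add _ _ _).symm
    rw [e4] at e1
    rw [AlgHom.comp_apply]
    refine Eq.trans ?_ (e1.trans (MvPolynomial.aeval_X _ c).symm)
    exact congrArg ((translationMap μ a b).pullback v) (MvPolynomial.aeval_X _ c)
  exact DFunLike.congr_fun h f

theorem pullback_zero (f : CoordRing n) : (translationMap μ a b).pullback 0 f = f := by
  have h : (translationMap μ a b).pullback 0 = AlgHom.id ℂ _ := by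
    refine MvPolynomial.algHom_ext fun c => ?_
    refine (MvPolynomial.aeval_X _ c).trans ?_
    have e : (fun j => MvPolynomial.C ((0 : Root a b → ℂ) j) : Root a b → CoordRing n) = 0 := by
      funext j
      exact map_zero _
    rw [e, zero_act]
    rfl
  exact DFunLike.congr_fun h f

/-- A derivation transported along an automorphism. -/
def conjDerivation {A : Type*} [CommRing A] [Algebra ℂ A] (D : Derivation ℂ A A)
    (σ σ' : A →ₐ[ℂ] A) (h : ∀ x, σ (σ' x) = x) : Derivation ℂ A A :=
  Derivation.mk' (σ.toLinearMap ∘ₗ D.toLinearMap ∘ₗ σ'.toLinearMap) fun x y => by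
    change σ (D (σ' (x * y))) = x • σ (D (σ' y)) + y • σ (D (σ' x))
    rw [map_mul, Derivation.leibniz, map_add, smul_eq_mul, smul_eq_mul, map_mul, map_mul, h, h]
    rfl

theorem constMat_transMat {E : Type*} [CommRing E] [Algebra ℂ E] (v : Root a b → ℂ) :
    ConstMat (transMat (fun j => algebraMap ℂ E (v j))) := by
  intro i k
  rw [transMat_eq, Matrix.add_apply, rootMat_apply, Matrix.one_apply]
  refine ⟨(if i = k then 1 else 0) + if h : i = b ∧ a ≤ k ∧ k < b then v ⟨k, h.2⟩ else 0, ?_⟩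
  rw [map_add, map_add]
  congr 1
  · split_ifs <;> simp
  · split_ifs <;> simp

theorem Related.exists_gaugeRelated {E : Type*} [CommRing E] [Algebra ℂ E]
    {μ μ' : Fin (n + 1) → ℤ} {θ ι : CoordRing n →ₐ[ℂ] E} {w wi N Ni : LMat n E}
    (h : Related μ' μ (wi * Ni) (ι ∘ univ n) (θ ∘ univ n)) (w_mul : w * wi = 1)
    (const_w : ConstMat w) (const_wi : ConstMat wi) (N_mul : N * Ni = 1) (upper : UpperUni N)
    (poly_N : PolyMat N) : ∃ (q qi : LMat n E) (c ci : LaurentSeries E),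
      GaugeRelated μ μ' θ ι w wi N Ni q qi c ci := by
  obtain ⟨c, ci, q, hc, hq, hq', e⟩ := h
  refine ⟨q, q⁻¹, c, ci, ?_, w_mul, const_w, const_wi, N_mul, upper, poly_N, hq.mul_inv, hq, hq',
    hc⟩
  rw [smap_sliceMat, smap_sliceMat]
  exact e

/-- The comparison of brackets for a family that is translated by a constant matrix. -/
theorem Related.bracket_eq {E : Type*} [CommRing E] [Algebra ℂ E]
    {μ μ' : Fin (n + 1) → ℤ} {θ ι : CoordRing n →ₐ[ℂ] E} {w wi : LMat n E}
    (h : Related μ' μ wi (ι ∘ univ n) (θ ∘ univ n)) (w_mul : w * wi = 1)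
    (const_w : ConstMat w) (const_wi : ConstMat wi) {F₁ F₂ f₁ f₂ : CoordRing n}
    (h₁ : θ F₁ = ι f₁) (h₂ : θ F₂ = ι f₂) {D₁ D₂ : Derivation ℂ E E}
    (hD₁ : ∀ x, D₁ (θ x) = θ (hamiltonianField μ F₂ x))
    (hD₂ : ∀ x, D₂ (ι x) = ι (hamiltonianField μ' f₁ x)) :
    θ (bracket μ F₁ F₂) = ι (bracket μ' f₁ f₂) := by
  rw [← mul_one wi] at h
  obtain ⟨q, qi, c, ci, G⟩ := h.exists_gaugeRelated w_mul const_w const_wi (mul_one 1)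
    upperUni_one polyMat_one
  refine G.bracket_eq h₁ h₂ hD₁ hD₂ ?_
  have e1 : ∀ X : LMat n E, polyPart (1 * truncMat X * 1) = 0 := fun X => by
    rw [one_mul, mul_one, polyPart, truncMat_eq_self (matGe_truncMat X), sub_self]
  rw [e1, constMat_one.dmap_eq_zero, zero_mul, add_zero, mul_zero, zero_mul, zero_mul, map_zero]

/-- Left translation by a constant matrix commutes with the projection to principal parts, and so
preserves the `r`-matrix bracket; correction by `N₋[t]` does not change it on invariant
functions. -/
theorem pullback_bracket (v : Root a b → ℂ) (f g : CoordRing n) :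
    (translationMap μ a b).pullback v (bracket μ f g) =
      bracket μ ((translationMap μ a b).pullback v f) ((translationMap μ a b).pullback v g) := by
  have h1 : ∀ x, (translationMap μ a b).pullback v ((translationMap μ a b).pullback (-v) x) = x :=
    fun x => by rw [pullback_comp_pullback, neg_add_cancel, pullback_zero]
  have h2 : ∀ x, (translationMap μ a b).pullback (-v) ((translationMap μ a b).pullback v x) = x :=
    fun x => by rw [pullback_comp_pullback, add_neg_cancel, pullback_zero]
  have e := (related_act μ (fun j => MvPolynomial.C (v j) : Root a b → CoordRing n)
    (univ n)).symm (transMat_neg_mul _)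
  have hneg : -(fun j => MvPolynomial.C (v j) : Root a b → CoordRing n) =
      fun j => algebraMap ℂ (CoordRing n) ((-v) j) := by
    funext j
    exact (map_neg (MvPolynomial.C) (v j)).symm
  have hσ : (translationMap μ a b).pullback v ∘ univ n =
      (translationMap μ a b).act (fun j => MvPolynomial.C (v j)) (univ n) := by
    funext x
    exact MvPolynomial.aeval_X _ x
  rw [← hσ] at e
  have hw := transMat_mul_neg (fun j => MvPolynomial.C (v j) : Root a b → CoordRing n)
  rw [hneg] at e hw
  refine (Related.bracket_eq (θ := AlgHom.id ℂ (CoordRing n)) e hw (constMat_transMat v)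
    (constMat_transMat (-v)) (F₁ := (translationMap μ a b).pullback v f)
    (F₂ := (translationMap μ a b).pullback v g) rfl rfl
    (D₁ := hamiltonianField μ ((translationMap μ a b).pullback v g))
    (D₂ := conjDerivation (hamiltonianField μ f) _ _ h1) (fun x => rfl) (fun x => ?_)).symm
  change (translationMap μ a b).pullback v (hamiltonianField μ f
    ((translationMap μ a b).pullback (-v) ((translationMap μ a b).pullback v x))) = _
  rw [h2]

theorem isHamiltonian : IsHamiltonian μ (translationMap μ a b) where
  pullback_bracket := pullback_bracket μ
  equivariant _ _ _ v x j := (related_act μ v x).momentCoord_eq j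
  infinitesimal_eq := infinitesimal_eq_bracket μ

end Hamiltonian
/-! ### The matrices of the reduction -/

section ReductionMatrices

variable {n : ℕ} {R S : Type*} [CommRing R] [CommRing S]

theorem single_mul_apply' (i j : Fin (n + 1)) (c : LaurentSeries R) (X : LMat n R) (k l) :
    (Matrix.single i j c * X) k l = if k = i then c * X j l else 0 := by
  split_ifs with h
  · rw [h, Matrix.single_mul_apply_same]
  · exact Matrix.single_mul_apply_of_ne _ _ _ _ _ h X

theorem mul_single_apply' (i j : Fin (n + 1)) (c : LaurentSeries R) (X : LMat n R) (k l) :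
    (X * Matrix.single i j c) k l = if l = j then X k i * c else 0 := by
  split_ifs with h
  · rw [h, Matrix.mul_single_apply_same]
  · exact Matrix.mul_single_apply_of_ne _ _ _ _ _ h X

variable (a b : Fin (n + 1))

variable (R) in
/-- A representative of the reflection in the root of `α`. -/
def weylMat : LMat n R :=
  1 - Matrix.single a a 1 - Matrix.single b b 1 + Matrix.single b a 1 - Matrix.single a b 1

variable (R) in
/-- The inverse of `weylMat`. -/
def weylInv : LMat n R :=
  1 - Matrix.single a a 1 - Matrix.single b b 1 + Matrix.single a b 1 - Matrix.single b a 1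

variable (R) in
/-- The matrix `(1 + t E_ab) w`. -/
def leftMat : LMat n R := weylMat R a b + Matrix.single a a (tPow R 1)

variable (R) in
/-- The matrix `w⁻¹ (1 - t E_ab)`. -/
def leftInv : LMat n R := weylInv R a b + Matrix.single b b (tPow R 1)

variable (R) in
/-- The matrix `(1 - t E_ba) t^(-α)`. -/
def rightMat : LMat n R := 1 - Matrix.single a a 1 - Matrix.single b b 1 +
  Matrix.single a a (tPow R (-1)) + Matrix.single b b (tPow R 1) - Matrix.single b a 1

variable (R) in
/-- The matrix `t^α (1 + t E_ba)`. -/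
def rightInv : LMat n R := 1 - Matrix.single a a 1 - Matrix.single b b 1 +
  Matrix.single a a (tPow R 1) + Matrix.single b b (tPow R (-1)) + Matrix.single b a 1

variable (R) in
/-- The matrix `1 + t⁻¹ E_ab`, the common first order part of the upper unitriangular factors on
the level set. -/
def levelMat : LMat n R := 1 + Matrix.single a b (tPow R (-1))

theorem tPow_one_mul_neg : tPow R 1 * tPow R (-1) = 1 := by
  rw [tPow_mul_tPow, add_neg_cancel, tPow_zero]

variable {a b} (hab : a ≠ b)
include hab

theorem leftMat_mul_apply (X : LMat n R) (i j) : (leftMat R a b * X) i j =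
    if i = a then tPow R 1 * X a j - X b j else if i = b then X a j else X i j := by
  simp only [leftMat, weylMat, add_mul, sub_mul, one_mul, Matrix.add_apply, Matrix.sub_apply,
    single_mul_apply']
  split_ifs with h1 h2 h2
  · exact absurd (h1.symm.trans h2) hab
  · subst h1; ring
  · subst h2; ring
  · ring

theorem leftInv_mul_apply (X : LMat n R) (i j) : (leftInv R a b * X) i j =
    if i = a then X b j else if i = b then tPow R 1 * X b j - X a j else X i j := by
  simp only [leftInv, weylInv, add_mul, sub_mul, one_mul, Matrix.add_apply, Matrix.sub_apply,
    single_mul_apply']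
  split_ifs with h1 h2 h2
  · exact absurd (h1.symm.trans h2) hab
  · subst h1; ring
  · subst h2; ring
  · ring

theorem weylMat_mul_apply (X : LMat n R) (i j) : (weylMat R a b * X) i j =
    if i = a then -X b j else if i = b then X a j else X i j := by
  simp only [weylMat, add_mul, sub_mul, one_mul, Matrix.add_apply, Matrix.sub_apply,
    single_mul_apply']
  split_ifs with h1 h2 h2
  · exact absurd (h1.symm.trans h2) hab
  · subst h1; ring
  · subst h2; ring
  · ring

theorem weylInv_mul_apply (X : LMat n R) (i j) : (weylInv R a b * X) i j =
    if i = a then X b j else if i = b then -X a j else X i j := by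
  simp only [weylInv, add_mul, sub_mul, one_mul, Matrix.add_apply, Matrix.sub_apply,
    single_mul_apply']
  split_ifs with h1 h2 h2
  · exact absurd (h1.symm.trans h2) hab
  · subst h1; ring
  · subst h2; ring
  · ring

theorem mul_weylMat_apply (X : LMat n R) (i j) : (X * weylMat R a b) i j =
    if j = a then X i b else if j = b then -X i a else X i j := by
  simp only [weylMat, mul_add, mul_sub, mul_one, Matrix.add_apply, Matrix.sub_apply,
    mul_single_apply']
  split_ifs with h1 h2 h2
  · exact absurd (h1.symm.trans h2) hab
  · subst h1; ring
  · subst h2; ring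
  · ring

theorem rightMat_mul_apply (X : LMat n R) (i j) : (rightMat R a b * X) i j =
    if i = a then tPow R (-1) * X a j else if i = b then tPow R 1 * X b j - X a j else X i j := by
  simp only [rightMat, add_mul, sub_mul, one_mul, Matrix.add_apply, Matrix.sub_apply,
    single_mul_apply']
  split_ifs with h1 h2 h2
  · exact absurd (h1.symm.trans h2) hab
  · subst h1; ring
  · subst h2; ring
  · ring

theorem mul_rightMat_apply (X : LMat n R) (i j) : (X * rightMat R a b) i j =
    if j = a then tPow R (-1) * X i a - X i b else if j = b then tPow R 1 * X i b else X i j := by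
  simp only [rightMat, mul_add, mul_sub, mul_one, Matrix.add_apply, Matrix.sub_apply,
    mul_single_apply']
  split_ifs with h1 h2 h2
  · exact absurd (h1.symm.trans h2) hab
  · subst h1; ring
  · subst h2; ring
  · ring

theorem mul_rightInv_apply (X : LMat n R) (i j) : (X * rightInv R a b) i j =
    if j = a then tPow R 1 * X i a + X i b else if j = b then tPow R (-1) * X i b else X i j := by
  simp only [rightInv, mul_add, mul_sub, mul_one, Matrix.add_apply, Matrix.sub_apply,
    mul_single_apply']
  split_ifs with h1 h2 h2
  · exact absurd (h1.symm.trans h2) hab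
  · subst h1; ring
  · subst h2; ring
  · ring

theorem weylMat_mul_weylInv : weylMat R a b * weylInv R a b = 1 := by
  ext1 i j
  have e : ∀ k l, weylInv R a b k l = (weylInv R a b * 1) k l := fun k l => by rw [mul_one]
  rw [weylMat_mul_apply hab]
  simp only [e, weylInv_mul_apply hab, if_neg hab.symm, if_true]
  split_ifs with h1 h2
  · subst h1; ring
  · subst h2; rfl
  · rfl

theorem leftMat_mul_leftInv : leftMat R a b * leftInv R a b = 1 := by
  ext1 i j
  have e : ∀ k l, leftInv R a b k l = (leftInv R a b * 1) k l := fun k l => by rw [mul_one]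
  rw [leftMat_mul_apply hab]
  simp only [e, leftInv_mul_apply hab, if_neg hab.symm, if_true]
  split_ifs with h1 h2
  · subst h1; ring
  · subst h2; rfl
  · rfl

theorem rightMat_mul_rightInv : rightMat R a b * rightInv R a b = 1 := by
  ext1 i j
  have e : ∀ k l, rightMat R a b k l = (1 * rightMat R a b) k l := fun k l => by rw [one_mul]
  rw [mul_rightInv_apply hab]
  simp only [e, mul_rightMat_apply hab, if_neg hab.symm, if_true]
  split_ifs with h1 h2
  · subst h1; linear_combination (1 : LMat n R) i j * tPow_one_mul_neg (R := R)
  · subst h2; linear_combination (1 : LMat n R) i j * tPow_one_mul_neg (R := R)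
  · rfl

/-- The Gauss decomposition in the `SL₂` of the root `α`, by which `t^μ` turns into `t^(μ+α)`:
`1 + t⁻¹ E_ab = w⁻¹ (1 - t E_ab) t^α (1 + t E_ba)`. -/
theorem leftInv_mul_rightInv : leftInv R a b * rightInv R a b = levelMat R a b := by
  ext1 i j
  have e : ∀ k l, rightInv R a b k l = (1 * rightInv R a b) k l := fun k l => by rw [one_mul]
  have h := tPow_one_mul_neg (R := R)
  rw [leftInv_mul_apply hab]
  simp only [e, mul_rightInv_apply hab, levelMat, Matrix.add_apply, Matrix.single_apply,
    Matrix.one_apply]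
  rcases eq_or_ne i a with rfl | hia
  · rcases eq_or_ne j i with rfl | hja
    · simp [hab.symm]
    · rcases eq_or_ne j b with rfl | hjb
      · simp [hab, hab.symm]
      · simp [hja, hjb, hja.symm, hjb.symm]
  · rcases eq_or_ne i b with rfl | hib
    · rcases eq_or_ne j a with rfl | hja
      · simp [hab, hab.symm]
      · rcases eq_or_ne j i with rfl | hjb
        · simp [hab, hab.symm, h]
        · simp [hab, hab.symm, hja, hjb, hja.symm, hjb.symm]
    · rcases eq_or_ne j a with rfl | hja
      · simp [hab.symm, hia, hib]
      · rcases eq_or_ne j b with rfl | hjb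
        · simp [hia, hib, hia.symm]
        · simp [hia, hib, hja, hjb, hia.symm]

theorem leftInv_eq : leftInv R a b = weylInv R a b * (1 - Matrix.single a b (tPow R 1)) := by
  ext1 i j
  rw [mul_sub, mul_one, Matrix.sub_apply, mul_single_apply', leftInv, Matrix.add_apply,
    Matrix.single_apply]
  have e : weylInv R a b i a = if i = b then -1 else 0 := by
    have e : weylInv R a b i a = (weylInv R a b * 1) i a := by rw [mul_one]
    rw [e, weylInv_mul_apply hab]
    split_ifs with h1 h2 h2
    · exact absurd (h1.symm.trans h2) hab
    · exact Matrix.one_apply_ne hab.symm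
    · rw [Matrix.one_apply_eq]
    · exact Matrix.one_apply_ne h1
  rw [e]
  by_cases h1 : i = b <;> by_cases h2 : j = b
  · simp [h1, h2]
  · simp [h1, h2, Ne.symm h2]
  · simp [h1, h2, Ne.symm h1]
  · simp [h2, Ne.symm h2]

end ReductionMatrices
/-! ### Constant corrections -/

section Corrections

variable {n : ℕ} {R S : Type*} [CommRing R] [CommRing S] (a b : Fin (n + 1))

/-- The constant matrix with entries `p j` at the places `(a, j)`, `a < j`, and `q i` at the
places `(i, b)`, `i < a`. -/
def corrMat (p q : Fin (n + 1) → R) : LMat n R := fun i j =>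
  if i = a ∧ a < j then HahnSeries.C (p j) else if i < a ∧ j = b then HahnSeries.C (q i) else 0

/-- The matrix `1 - t E_ab + k` of `N[t]`, with `k` a constant correction. -/
def gaugeMat (p q : Fin (n + 1) → R) : LMat n R :=
  1 - Matrix.single a b (tPow R 1) + corrMat a b p q

theorem corrMat_apply (p q : Fin (n + 1) → R) (i j) : corrMat a b p q i j =
    if i = a ∧ a < j then HahnSeries.C (p j) else if i < a ∧ j = b then HahnSeries.C (q i) else 0 :=
  rfl

variable {a b}

theorem corrMat_apply_of_not {p q : Fin (n + 1) → R} {i j : Fin (n + 1)}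
    (h : ¬ (i = a ∧ a < j ∨ i < a ∧ j = b)) : corrMat a b p q i j = 0 := by
  rw [corrMat, if_neg fun h' => h (Or.inl h'), if_neg fun h' => h (Or.inr h')]

theorem corrMat_zero : corrMat a b (0 : Fin (n + 1) → R) 0 = 0 := by
  ext1 i j
  rw [corrMat_apply]
  split_ifs
  · exact map_zero _
  · exact map_zero _
  · rfl

theorem corrMat_add (p q p' q' : Fin (n + 1) → R) :
    corrMat a b p q + corrMat a b p' q' = corrMat a b (p + p') (q + q') := by
  ext1 i j
  rw [Matrix.add_apply, corrMat_apply, corrMat_apply, corrMat_apply]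
  split_ifs
  · exact (map_add _ _ _).symm
  · exact (map_add _ _ _).symm
  · rw [add_zero]

theorem corrMat_neg (p q : Fin (n + 1) → R) :
    -corrMat a b p q = corrMat a b (-p) (-q) := by
  rw [neg_eq_iff_add_eq_zero, corrMat_add, add_neg_cancel, add_neg_cancel, corrMat_zero]

theorem matGe_corrMat (p q : Fin (n + 1) → R) : MatGe 0 (corrMat a b p q) := by
  intro i j m hm
  rw [corrMat_apply]
  split_ifs
  · rw [HahnSeries.C_apply, HahnSeries.coeff_single, if_neg hm.ne]
  · rw [HahnSeries.C_apply, HahnSeries.coeff_single, if_neg hm.ne]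
  · rfl

theorem polyMat_corrMat (p q : Fin (n + 1) → R) : PolyMat (corrMat a b p q) := by
  intro i j
  rw [corrMat_apply]
  split_ifs
  · exact isPoly_C _
  · exact isPoly_C _
  · exact isPoly_zero

theorem smap_corrMat (θ : R →+* S) (p q : Fin (n + 1) → R) :
    smap θ (corrMat a b p q) = corrMat a b (θ ∘ p) (θ ∘ q) := by
  ext1 i j
  rw [smap_apply, corrMat_apply, corrMat_apply]
  split_ifs
  · exact lmap_C θ _
  · exact lmap_C θ _
  · exact map_zero _

section

variable (hab : a < b)
include hab

theorem strictUpper_corrMat (p q : Fin (n + 1) → R) : StrictUpper (corrMat a b p q) := by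
  intro i j hij
  refine corrMat_apply_of_not ?_
  rintro (⟨rfl, h⟩ | ⟨h, rfl⟩)
  · exact absurd h (not_lt.mpr hij)
  · exact absurd (h.trans hab) (not_lt.mpr hij)

theorem corrMat_apply_last (p q : Fin (n + 1) → R) (j) : corrMat a b p q b j = 0 :=
  corrMat_apply_of_not (by rintro (⟨h, -⟩ | ⟨h, -⟩) <;> order)

theorem corrMat_apply_first (p q : Fin (n + 1) → R) (i) : corrMat a b p q i a = 0 :=
  corrMat_apply_of_not (by rintro (⟨-, h⟩ | ⟨-, h⟩) <;> order)

/-- The rows of a correction have index at most `a`, its columns have index larger than `a`. -/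
theorem corrMat_mul_mul_corrMat {X : LMat n R} (hX : UpperTri X) (p q p' q' : Fin (n + 1) → R) :
    corrMat a b p q * X * corrMat a b p' q' = 0 := by
  ext1 i j
  rw [Matrix.mul_apply]
  refine Finset.sum_eq_zero fun l _ => ?_
  by_cases hl : a < l
  · rw [corrMat_apply_of_not (i := l) (by rintro (⟨h, -⟩ | ⟨h, -⟩) <;> order), mul_zero]
  · rw [Matrix.mul_apply, Finset.sum_eq_zero fun m _ => ?_, zero_mul]
    by_cases hm : a < m
    · rw [hX m l (by order), mul_zero]
    · rw [corrMat_apply_of_not (by rintro (⟨-, h⟩ | ⟨-, h⟩) <;> order), zero_mul]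

theorem corrMat_mul_corrMat (p q p' q' : Fin (n + 1) → R) :
    corrMat a b p q * corrMat a b p' q' = 0 := by
  have := corrMat_mul_mul_corrMat hab upperUni_one.1 p q p' q'
  rwa [mul_one] at this

theorem single_mul_corrMat (c : LaurentSeries R) (p q : Fin (n + 1) → R) :
    Matrix.single a b c * corrMat a b p q = 0 := by
  ext1 i j
  rw [single_mul_apply', corrMat_apply_last hab, mul_zero, ite_self]
  rfl

theorem corrMat_mul_single (c : LaurentSeries R) (p q : Fin (n + 1) → R) :
    corrMat a b p q * Matrix.single a b c = 0 := by
  ext1 i j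
  rw [mul_single_apply', corrMat_apply_first hab, zero_mul, ite_self]
  rfl

theorem single_mul_single_self (c d : LaurentSeries R) :
    (Matrix.single a b c * Matrix.single a b d : LMat n R) = 0 :=
  Matrix.single_mul_single_of_ne _ _ _ _ hab.ne' _

theorem upperUni_gaugeMat (p q : Fin (n + 1) → R) : UpperUni (gaugeMat a b p q) := by
  have h : ∀ i j, j ≤ i → gaugeMat a b p q i j = (1 : LMat n R) i j := fun i j hij => by
    rw [gaugeMat, Matrix.add_apply, strictUpper_corrMat hab p q i j hij, Matrix.sub_apply,
      Matrix.single_apply, if_neg (by rintro ⟨rfl, rfl⟩; order), sub_zero, add_zero]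
  exact ⟨fun i j hij => by rw [h i j hij.le, Matrix.one_apply_ne hij.ne'],
    fun i => by rw [h i i le_rfl, Matrix.one_apply_eq]⟩

omit hab in
theorem polyMat_gaugeMat (p q : Fin (n + 1) → R) : PolyMat (gaugeMat a b p q) := by
  refine (polyMat_one.sub fun i j => ?_).add (polyMat_corrMat p q)
  rw [Matrix.single_apply]
  split_ifs
  · exact isPoly_tPow (by norm_num)
  · exact isPoly_zero

theorem one_add_corrMat_mul (p q p' q' : Fin (n + 1) → R) :
    (1 + corrMat a b p q) * (1 + corrMat a b p' q') = 1 + corrMat a b (p + p') (q + q') := by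
  rw [← corrMat_add]
  have h := corrMat_mul_corrMat hab p q p' q'
  simp only [add_mul, mul_add, one_mul, mul_one, h]
  abel

theorem one_add_corrMat_mul_gaugeMat (p q p' q' : Fin (n + 1) → R) :
    (1 + corrMat a b p q) * gaugeMat a b p' q' = gaugeMat a b (p + p') (q + q') := by
  rw [gaugeMat, gaugeMat, ← corrMat_add]
  have h1 := corrMat_mul_corrMat hab p q p' q'
  have h2 := corrMat_mul_single hab (tPow R 1) p q
  simp only [add_mul, mul_add, mul_sub, one_mul, mul_one, h1, h2]
  abel

theorem leftInv_mul_one_add_corrMat (p q : Fin (n + 1) → R) :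
    leftInv R a b * (1 + corrMat a b p q) = weylInv R a b * gaugeMat a b p q := by
  rw [leftInv_eq hab.ne, mul_assoc, gaugeMat]
  have h2 := single_mul_corrMat hab (tPow R 1) p q
  congr 1
  simp only [mul_add, sub_mul, one_mul, mul_one, h2]
  abel

theorem exists_gaugeMat_right_inv (p q : Fin (n + 1) → R) : ∃ Y : LMat n R,
    gaugeMat a b p q * Y = 1 ∧ UpperUni Y ∧ PolyMat Y :=
  have h := upperUni_gaugeMat hab p q
  ⟨_, h.mul_inv, h.of_mul_eq_one h.mul_inv,
    (polyMat_gaugeMat p q).of_mul_eq_one h.det h.mul_inv⟩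

end

/-- The part of `w⁻¹ k w` which lies in `𝔫`, for a constant correction `k`. -/
def upperCorr (a b : Fin (n + 1)) (p q : Fin (n + 1) → R) : LMat n R := fun i j =>
  if i = b ∧ b < j then -HahnSeries.C (p j) else if i < a ∧ j = a then HahnSeries.C (q i) else 0

/-- The part of `w⁻¹ k w` which lies in the Lie algebra of the root group. -/
def rootCorr (a b : Fin (n + 1)) (p : Fin (n + 1) → R) : Root a b → R := fun j =>
  if j.1 = a then -p b else -p j.1

theorem upperCorr_apply (p q : Fin (n + 1) → R) (i j) : upperCorr a b p q i j =
    if i = b ∧ b < j then -HahnSeries.C (p j) else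
      if i < a ∧ j = a then HahnSeries.C (q i) else 0 :=
  rfl

theorem strictUpper_upperCorr (p q : Fin (n + 1) → R) : StrictUpper (upperCorr a b p q) := by
  intro i j hij
  rw [upperCorr_apply, if_neg (by rintro ⟨rfl, h⟩; order), if_neg (by rintro ⟨h, rfl⟩; order)]

theorem polyMat_upperCorr (p q : Fin (n + 1) → R) : PolyMat (upperCorr a b p q) := by
  intro i j
  rw [upperCorr_apply]
  split_ifs
  · exact (isPoly_C _).neg
  · exact isPoly_C _
  · exact isPoly_zero

section

variable (hab : a < b)
include hab

/-- Conjugation by `w` takes a constant correction to the sum of an element of `𝔫` and an element of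
the Lie algebra of the root group. -/
theorem weylInv_mul_corrMat_mul (p q : Fin (n + 1) → R) :
    weylInv R a b * corrMat a b p q * weylMat R a b =
      upperCorr a b p q + rootMat (rootCorr a b p) := by
  ext1 i j
  rw [mul_weylMat_apply hab.ne, weylInv_mul_apply hab.ne, weylInv_mul_apply hab.ne,
    weylInv_mul_apply hab.ne, Matrix.add_apply, upperCorr_apply, rootMat_apply,
    corrMat_apply_last hab, corrMat_apply_last hab, corrMat_apply_last hab]
  rcases eq_or_ne i b with rfl | hib
  · rw [if_neg hab.ne', if_pos rfl, if_neg hab.ne', if_pos rfl, if_neg hab.ne', if_pos rfl]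
    rcases eq_or_ne j a with rfl | hja
    · simp [corrMat_apply, hab, not_lt.mpr hab.le, rootCorr]
    · rcases eq_or_ne j i with rfl | hji
      · simp [corrMat_apply, hab.ne']
      · rcases lt_trichotomy j i with h | h | h
        · by_cases ha : a < j
          · simp [corrMat_apply, hja, hji, ha, not_lt.mpr h.le, rootCorr, h, ha.le]
          · simp [corrMat_apply, hja, hji, ha, not_lt.mpr h.le,
              show ¬ a ≤ j from fun h' => hja (le_antisymm (not_lt.mp ha) h')]
        · exact absurd h hji
        · simp [corrMat_apply, hja, hji, h, hab.trans h, not_lt.mpr h.le]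
  · rcases eq_or_ne i a with rfl | hia
    · simp [hib]
    · rcases eq_or_ne j a with rfl | hja
      · simp [corrMat_apply, hib, hia]
      · simp only [corrMat_apply_first hab, neg_zero,
          hib, hia, hja, false_and, and_false, if_false, dite_false, add_zero]
        split_ifs with h
        · rfl
        · exact corrMat_apply_of_not (by rintro (⟨h', -⟩ | ⟨-, h'⟩) <;> contradiction)

theorem upperCorr_mul_rootMat (p q : Fin (n + 1) → R) (v : Root a b → R) :
    upperCorr a b p q * rootMat v = 0 := by
  ext1 i j
  rw [Matrix.mul_apply]
  refine Finset.sum_eq_zero fun l _ => ?_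
  by_cases h : l = b
  · rw [upperCorr_apply, if_neg (by rintro ⟨-, h'⟩; order), if_neg (by rintro ⟨-, h'⟩; order),
      zero_mul]
  · rw [rootMat_apply, dif_neg (fun h' => h h'.1), mul_zero]

/-- Conjugation by `w` turns `1 + k` into the product of an element of `N` and an element of the
root group. -/
theorem weylInv_mul_one_add_corrMat_mul (p q : Fin (n + 1) → R) :
    weylInv R a b * (1 + corrMat a b p q) * weylMat R a b =
      (1 + upperCorr a b p q) * transMat (rootCorr a b p) := by
  rw [mul_add, mul_one, add_mul, mul_eq_one_comm.mp (weylMat_mul_weylInv hab.ne),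
    weylInv_mul_corrMat_mul hab, transMat_eq]
  have h := upperCorr_mul_rootMat hab p q (rootCorr a b p)
  simp only [add_mul, mul_add, one_mul, mul_one, h]
  abel

end

/-- The correction which corresponds to an element of the root group. -/
def corrOfRoot (v : Root a b → R) : Fin (n + 1) → R := fun j =>
  if h : a < j ∧ j < b then -v ⟨j, h.1.le, h.2⟩ else
    if h : a < b ∧ j = b then -v ⟨a, le_rfl, h.1⟩ else 0

theorem rootCorr_corrOfRoot (v : Root a b → R) : rootCorr a b (corrOfRoot v) = v := by
  funext j
  have hab : a < b := j.2.1.trans_lt j.2.2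
  rw [rootCorr]
  split_ifs with h
  · rw [corrOfRoot, dif_neg (fun h => lt_irrefl _ h.2), dif_pos ⟨hab, rfl⟩, neg_neg]
    congr 1
    exact Subtype.ext h.symm
  · rw [corrOfRoot, dif_pos ⟨lt_of_le_of_ne j.2.1 (Ne.symm h), j.2.2⟩, neg_neg]

theorem upperCorr_corrOfRoot (v : Root a b → R) :
    upperCorr a b (corrOfRoot v) (0 : Fin (n + 1) → R) = 0 := by
  ext1 i j
  rw [upperCorr_apply]
  split_ifs with h
  · rw [corrOfRoot, dif_neg (fun h' => by order), dif_neg (fun h' => by order), map_zero, neg_zero]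
    rfl
  · exact map_zero _
  · rfl

theorem transMat_mul_weylInv (hab : a < b) (v : Root a b → R) : transMat v * weylInv R a b =
    weylInv R a b * (1 + corrMat a b (corrOfRoot v) 0) := by
  have h := weylInv_mul_one_add_corrMat_mul hab (corrOfRoot v) 0
  rw [rootCorr_corrOfRoot, upperCorr_corrOfRoot, add_zero, one_mul] at h
  rw [← h, mul_assoc, weylMat_mul_weylInv hab.ne, mul_one]

end Corrections
/-! ### The correspondence between the level set and the slice of `μ + α` -/

section Correspondence

variable {n : ℕ} {R S : Type*} [CommRing R] [CommRing S] {a b : Fin (n + 1)}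

/-- The points `x` of `Gr_μ` and `z` of `Gr_{μ+α}` satisfy `S(x) = w⁻¹ (1 - t E_ab + k) S(z) q`,
up to a scalar, with a constant correction `k` and `q ∈ N₋[t]`. On the level set this is the
graph of the quotient map. -/
def Corresponds (μ : Fin (n + 1) → ℤ) (a b : Fin (n + 1)) (x z : Coord n → R) : Prop :=
  ∃ p q : Fin (n + 1) → R, Related (μ + coroot a b) μ (weylInv R a b * gaugeMat a b p q) z x

theorem smap_one_single (θ : R →+* S) (i j : Fin (n + 1)) :
    smap θ (Matrix.single i j 1 : LMat n R) = Matrix.single i j 1 := by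
  rw [smap_single, map_one]

theorem smap_weylInv (θ : R →+* S) : smap θ (weylInv R a b) = weylInv S a b := by
  simp only [weylInv, map_sub, map_add, map_one, smap_one_single]

theorem smap_gaugeMat (θ : R →+* S) (p q : Fin (n + 1) → R) :
    smap θ (gaugeMat a b p q) = gaugeMat a b (θ ∘ p) (θ ∘ q) := by
  rw [gaugeMat, gaugeMat, map_add, map_sub, map_one, smap_single, lmap_tPow, smap_corrMat]

theorem Corresponds.map {μ : Fin (n + 1) → ℤ} {x z : Coord n → R} (h : Corresponds μ a b x z)
    (θ : R →+* S) : Corresponds μ a b (θ ∘ x) (θ ∘ z) := by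
  obtain ⟨p, q, h⟩ := h
  refine ⟨θ ∘ p, θ ∘ q, ?_⟩
  have := h.map θ
  rwa [map_mul, smap_weylInv, smap_gaugeMat] at this

variable (hab : a < b)
include hab

omit hab in
theorem exists_matGe_sub_corrMat {M : LMat n R} (h0 : MatGe 0 M)
    (h1 : ∀ i j, ¬ (i = a ∧ a < j ∨ i < a ∧ j = b) → OrdGe 1 (M i j)) :
    ∃ p q, MatGe 1 (M - corrMat a b p q) := by
  refine ⟨fun j => (M a j).coeff 0, fun i => (M i b).coeff 0, fun i j => ?_⟩
  by_cases h : i = a ∧ a < j ∨ i < a ∧ j = b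
  · intro m hm
    rw [Matrix.sub_apply, HahnSeries.coeff_sub]
    rcases (show m ≤ 0 by omega).lt_or_eq with hm | rfl
    · rw [h0 i j m hm, matGe_corrMat _ _ i j m hm, sub_zero]
    · rw [corrMat_apply]
      rcases h with h | h
      · rw [if_pos h, h.1, HahnSeries.C_apply, HahnSeries.coeff_single, if_pos rfl, sub_self]
      · rw [if_neg (fun h' => h.1.ne h'.1), if_pos h, h.2, HahnSeries.C_apply,
          HahnSeries.coeff_single, if_pos rfl, sub_self]
  · rw [Matrix.sub_apply, corrMat_apply_of_not h, sub_zero]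
    exact h1 i j h

/-- A matrix which is integral, with its terms of order zero at the places of a correction,
becomes close to `1` after a correction. -/
theorem exists_closeToOne_corrMat {M : LMat n R} (h0 : MatGe 0 M)
    (h1 : ∀ i j, ¬ (i = a ∧ a < j ∨ i < a ∧ j = b) → OrdGe 1 (M i j)) :
    ∃ p q, CloseToOne ((1 - corrMat a b p q) * (1 + M)) := by
  obtain ⟨p, q, hs⟩ := exists_matGe_sub_corrMat h0 h1
  refine ⟨p, q, ?_⟩
  have hk : MatGe 1 (corrMat a b p q * M) := by
    intro i j
    rw [Matrix.mul_apply]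
    refine OrdGe.sum fun l _ => ?_
    by_cases hl : a < l
    · exact (matGe_corrMat p q i l).mul' (h1 l j (by rintro (⟨h, -⟩ | ⟨h, -⟩) <;> order))
        (by norm_num)
    · rw [corrMat_apply_of_not (by rintro (⟨-, h⟩ | ⟨-, h⟩) <;> order), zero_mul]
      exact ordGe_zero 1
  have e : (1 - corrMat a b p q) * (1 + M) - 1 = (M - corrMat a b p q) - corrMat a b p q * M := by
    simp only [sub_mul, mul_add, one_mul, mul_one]
    abel
  rw [CloseToOne, e]
  exact hs.sub hk

omit hab in
theorem ordGe_tPow_one_mul_sub {f : LaurentSeries R} (hf : OrdGe 1 f) :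
    OrdGe 1 (tPow R 1 * f - HahnSeries.C (f.coeff 1)) := by
  intro m hm
  rw [HahnSeries.coeff_sub, coeff_tPow_mul, HahnSeries.C_apply, HahnSeries.coeff_single]
  split_ifs with h
  · rw [h, zero_add, sub_self]
  · rw [hf (m + 1) (by omega), sub_zero]

/-- For the deviation `V` of the upper factor of a point of the level set from `1 + t⁻¹ E_ab`, the
matrix `(1 + t E_ab) w V (1 - t E_ba) t^(-α)` has no pole at `t = ∞`, and it vanishes there except
at the places of a correction. -/
theorem ordGe_leftMat_mul_rightMat {V : LMat n R} (hV : StrictUpper V) (hV1 : MatGe 1 V)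
    (hVb : ∀ j, a ≤ j → OrdGe 2 (V j b)) (i j : Fin (n + 1)) :
    OrdGe 0 ((leftMat R a b * V * rightMat R a b) i j) ∧
    (¬ (i = a ∧ a < j ∨ i < a ∧ j = b) →
      OrdGe 1 ((leftMat R a b * V * rightMat R a b) i j)) := by
  have key : ∀ f : LaurentSeries R, OrdGe 1 f → OrdGe 0 f ∧
      (¬ (i = a ∧ a < j ∨ i < a ∧ j = b) → OrdGe 1 f) :=
    fun f hf => ⟨hf.mono (by norm_num), fun _ => hf⟩
  have z : ∀ i j, j ≤ i → V i j = 0 := hV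
  rw [mul_rightMat_apply hab.ne, leftMat_mul_apply hab.ne, leftMat_mul_apply hab.ne,
    leftMat_mul_apply hab.ne]
  rcases eq_or_ne i a with rfl | hia
  · rw [if_pos rfl, if_pos rfl, if_pos rfl]
    rcases eq_or_ne j i with rfl | hja
    · rw [if_pos rfl, z j j le_rfl, z b j hab.le, z b b le_rfl]
      refine key _ ?_
      have : OrdGe 1 (tPow R 1 * V j b) := ordGe_tPow_mul 1 (hVb j le_rfl)
      simpa using this.neg
    · rw [if_neg hja]
      rcases eq_or_ne j b with rfl | hjb
      · rw [if_pos rfl, z j j le_rfl, sub_zero]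
        refine ⟨ordGe_tPow_mul 1 (ordGe_tPow_mul 1 (hVb i le_rfl)), fun h => absurd ?_ h⟩
        exact Or.inl ⟨rfl, hab⟩
      · rw [if_neg hjb]
        rcases lt_or_gt_of_ne hja with h | h
        · rw [z i j h.le, z b j (h.trans hab).le, mul_zero, sub_zero]
          exact ⟨ordGe_zero 0, fun _ => ordGe_zero 1⟩
        · exact ⟨(ordGe_tPow_mul 1 (hV1 i j)).sub ((hV1 b j).mono (by norm_num)),
            fun h' => absurd (Or.inl ⟨rfl, h⟩) h'⟩
  · rw [if_neg hia, if_neg hia, if_neg hia]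
    rcases eq_or_ne i b with rfl | hib
    · rw [if_pos rfl, if_pos rfl, if_pos rfl]
      refine key _ ?_
      split_ifs with h1 h2
      · exact (ordGe_tPow_mul _ ((hV1 a a).mono (by norm_num))).sub (hV1 a i)
      · exact ordGe_tPow_mul 1 (hVb a le_rfl)
      · exact hV1 a j
    · rw [if_neg hib, if_neg hib, if_neg hib]
      rcases eq_or_ne j a with rfl | hja
      · rw [if_pos rfl]
        exact key _ ((ordGe_tPow_mul _ ((hV1 i j).mono (by norm_num))).sub (hV1 i b))
      · rw [if_neg hja]
        rcases eq_or_ne j b with rfl | hjb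
        · rw [if_pos rfl]
          rcases lt_or_gt_of_ne hia with h | h
          · exact ⟨ordGe_tPow_mul 1 (hV1 i j), fun h' => absurd (Or.inr ⟨h, rfl⟩) h'⟩
          · exact key _ (ordGe_tPow_mul 1 (hVb i h.le))
        · rw [if_neg hjb]
          exact key _ (hV1 i j)

/-- If `1 + X` is the corrected upper factor of a point of `Gr_{μ+α}`, conjugation by
`(1 - t E_ba) t^(-α)` brings it into the first congruence subgroup, without terms of order `t⁻¹`
that would change the moment map. The values of `p` and `q` are the ones which achieve this. -/
theorem matGe_rightMat_mul_rightInv {X V k : LMat n R} {p q : Fin (n + 1) → R}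
    (hX : StrictUpper X) (hk : k = corrMat a b p q) (hXk : MatGe 1 (X - k))
    (hrow : ∀ j, X b j = V b j) (hcol : ∀ i, X i a = V i a) (hV : MatGe 1 V)
    (hp : ∀ j, p j = (V b j).coeff 1) (hq : ∀ i, q i = -(V i a).coeff 1) :
    MatGe 1 (rightMat R a b * X * rightInv R a b) ∧
      ∀ j, a ≤ j → j < b → OrdGe 2 ((rightMat R a b * X * rightInv R a b) j b) := by
  have z : ∀ i j, j ≤ i → X i j = 0 := hX
  have hka : ∀ j, a < j → k a j = HahnSeries.C ((V b j).coeff 1) := fun j h => by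
    rw [hk, corrMat_apply, if_pos ⟨rfl, h⟩, hp]
  have hkb : ∀ i, i < a → k i b = -HahnSeries.C ((V i a).coeff 1) := fun i h => by
    rw [hk, corrMat_apply, if_neg (fun h' => h.ne h'.1), if_pos ⟨h, rfl⟩, hq, map_neg]
  have h0 : ∀ i j, OrdGe 0 (X i j) := fun i j => by
    have := (MatGe.mono hXk (show (0 : ℤ) ≤ 1 by norm_num)).add
      (hk ▸ matGe_corrMat (a := a) (b := b) p q)
    rw [sub_add_cancel] at this
    exact this i j
  have h1 : ∀ i j, ¬ (i = a ∧ a < j ∨ i < a ∧ j = b) → OrdGe 1 (X i j) := fun i j h => by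
    have := hXk i j
    rwa [Matrix.sub_apply, hk, corrMat_apply_of_not h, sub_zero] at this
  have hXab : OrdGe 1 (X a b) := by
    have := hXk a b
    rwa [Matrix.sub_apply, hka b hab, ← hrow, z b b le_rfl, HahnSeries.coeff_zero, map_zero,
      sub_zero] at this
  have hinv : ∀ (k : ℤ) {f : LaurentSeries R}, OrdGe (k - 1) f → OrdGe k (tPow R (-1) * f) :=
    fun k f hf => ordGe_tPow_mul (-1) hf
  constructor
  · intro i j
    rw [mul_rightInv_apply hab.ne, rightMat_mul_apply hab.ne, rightMat_mul_apply hab.ne,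
      rightMat_mul_apply hab.ne]
    rcases eq_or_ne i a with rfl | hia
    · rw [if_pos rfl, if_pos rfl, if_pos rfl]
      split_ifs with h2 h3
      · rw [z i i le_rfl, mul_zero, mul_zero, zero_add]
        exact hinv _ (h0 i b)
      · exact hinv _ ((hinv 1 (h0 i b)).mono (by norm_num))
      · exact hinv _ (h0 i j)
    · rw [if_neg hia, if_neg hia, if_neg hia]
      rcases eq_or_ne i b with rfl | hib
      · rw [if_pos rfl, if_pos rfl, if_pos rfl]
        split_ifs with h2 h3
        · rw [z i a hab.le, z a a le_rfl, z i i le_rfl]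
          simpa using hXab.neg
        · rw [z i i le_rfl, mul_zero, zero_sub]
          exact hinv _ (h0 a i).neg
        · rcases lt_or_gt_of_ne h2 with h | h
          · rw [z i j (h.trans hab).le, z a j h.le, mul_zero, sub_zero]
            exact ordGe_zero 1
          · have e := (ordGe_tPow_one_mul_sub (hV i j)).sub (hXk a j)
            rw [Matrix.sub_apply, hka j h, sub_sub_sub_cancel_right] at e
            rwa [hrow]
      · rw [if_neg hib, if_neg hib, if_neg hib]
        split_ifs with h2 h3
        · rcases lt_or_gt_of_ne hia with h | h
          · have e := (ordGe_tPow_one_mul_sub (hV i a)).add (hXk i b)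
            rw [Matrix.sub_apply, hkb i h, sub_neg_eq_add, sub_add_add_cancel] at e
            rwa [hcol]
          · rw [z i a h.le, mul_zero, zero_add]
            exact h1 i b (by rintro (⟨h', -⟩ | ⟨h', -⟩) <;> order)
        · exact hinv _ (h0 i b)
        · exact h1 i j (by rintro (⟨h', -⟩ | ⟨-, h'⟩) <;> contradiction)
  · intro j hj hjb
    rw [mul_rightInv_apply hab.ne, if_neg hab.ne', if_pos rfl, rightMat_mul_apply hab.ne]
    rcases hj.eq_or_lt with rfl | hj
    · rw [if_pos rfl]
      exact hinv _ (hinv _ (h0 a b))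
    · rw [if_neg hj.ne', if_neg hjb.ne]
      exact hinv _ (h1 j b (by rintro (⟨h', -⟩ | ⟨h', -⟩) <;> order))

omit hab in
theorem upMat_momentCoord (x : Coord n → R) (j : Root a b) :
    (upMat x j.1 b).coeff 1 = x (momentCoord j) := by
  rw [upMat_apply_of_lt _ j.2.2]
  have h0 := coeff_principal_succ (fun r => x (.up j.1 b j.2.2 r)) 0
  norm_num at h0
  exact h0

theorem lowerTri_rightInv : LowerTri (rightInv R a b) := by
  intro i j hij
  have e : rightInv R a b i j = (1 * rightInv R a b) i j := by rw [one_mul]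
  rw [e, mul_rightInv_apply hab.ne]
  split_ifs with h1 h2
  · rw [Matrix.one_apply_ne (by order), Matrix.one_apply_ne (by order), mul_zero, add_zero]
  · rw [Matrix.one_apply_ne (by order), mul_zero]
  · exact Matrix.one_apply_ne hij.ne

theorem rightInv_apply_self (i : Fin (n + 1)) : rightInv R a b i i = tPow R (coroot a b i) := by
  have e : rightInv R a b i i = (1 * rightInv R a b) i i := by rw [one_mul]
  rw [e, mul_rightInv_apply hab.ne, coroot, Pi.sub_apply]
  split_ifs with h1 h2
  · subst h1
    rw [Matrix.one_apply_eq, Matrix.one_apply_ne hab.ne, Pi.single_eq_same,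
      Pi.single_eq_of_ne hab.ne, mul_one, add_zero, sub_zero]
  · subst h2
    rw [Matrix.one_apply_eq, Pi.single_eq_same, Pi.single_eq_of_ne hab.ne', mul_one, zero_sub]
  · rw [Matrix.one_apply_eq, Pi.single_eq_of_ne h1, Pi.single_eq_of_ne h2, sub_zero, tPow_zero]

theorem lowerTri_rightMat : LowerTri (rightMat R a b) := by
  intro i j hij
  have e : rightMat R a b i j = (1 * rightMat R a b) i j := by rw [one_mul]
  rw [e, mul_rightMat_apply hab.ne]
  split_ifs with h1 h2
  · rw [Matrix.one_apply_ne (by order), Matrix.one_apply_ne (by order), mul_zero, sub_zero]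
  · rw [Matrix.one_apply_ne (by order), mul_zero]
  · exact Matrix.one_apply_ne hij.ne

theorem rightMat_apply_self (i : Fin (n + 1)) : rightMat R a b i i = tPow R (-coroot a b i) := by
  have h1 := congrFun (congrFun (rightMat_mul_rightInv (R := R) hab.ne) i) i
  rw [(lowerTri_rightMat hab).mul_diag (lowerTri_rightInv hab), rightInv_apply_self hab,
    Matrix.one_apply_eq] at h1
  have h2 := tPow_mul_tPow (R := R) (-coroot a b i) (coroot a b i)
  rw [neg_add_cancel, tPow_zero] at h2
  exact (isUnit_tPow (coroot a b i)).mul_right_cancel (h1.trans h2.symm)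

omit hab in
/-- The point of a slice found from the Gauss decomposition of the matrix `K` close to `1`, when
the translate `A u` of the upper factor is `L K T`, with `T` lower triangular of diagonal
`t^(μ'-μ)`. -/
theorem exists_related_of_closeToOne {μ μ' : Fin (n + 1) → ℤ} (x : Coord n → R)
    {A K T L : LMat n R}
    (hK : CloseToOne K) (hT : LowerTri T) (hTd : ∀ i, T i i = tPow R (μ' i - μ i))
    (hL : UpperUni L) (hL' : CloseToOne L) (e : A * upMat x = L * K * T) :
    ∃ (y : Coord n → R) (U B : LMat n R), Related μ μ' A x y ∧ upMat y = L * U ∧ K = U * B ∧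
      CloseToOne U ∧ LowerTri B ∧ CloseToOne B := by
  obtain ⟨U, B, hU, hU', hB, hB', eK⟩ := exists_gauss hK
  have hTB := lowerTri_borMat μ x
  have hd : ∀ i, OrdGe 1 (B i i * torEntry x i - 1) := fun i => by
    have e : B i i * torEntry x i - 1 = (B i i - 1) * torEntry x i + (torEntry x i - 1) := by ring
    rw [e]
    exact ((hB' i).mul' (ordGe_torEntry x i) (by norm_num)).add (ordGe_torEntry_sub_one x i)
  obtain ⟨y, c, ci, q, hy, hc, hq, hq', e'⟩ := exists_sliceMat_mul μ' (hL.mul hU) (hL'.mul hU')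
    (hB.mul (hT.mul hTB)) hd fun i => by
      rw [hB.mul_diag (hT.mul hTB), hT.mul_diag hTB, hTd, borMat,
        (lowerTri_torMat μ x).mul_diag (lowerUni_lowMat x).1, (lowerUni_lowMat x).2, torMat,
        Matrix.diagonal_apply_eq]
      have := tPow_mul_tPow (R := R) (μ' i - μ i) (μ i)
      rw [sub_add_cancel] at this
      linear_combination B i i * torEntry x i * this
  refine ⟨y, U, B, ⟨c, ci, q, hc, hq, hq', ?_⟩, hy, eK, hU', hB, ?_⟩
  · rw [e', sliceMat_eq, ← mul_assoc A, e, eK]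
    noncomm_ring
  · have hUi := hU.mul_inv
    have : B = U⁻¹ * K := by rw [eK, ← mul_assoc, mul_eq_one_comm.mp hUi, one_mul]
    rw [this]
    exact (hU'.of_mul_eq_one hU.det hUi).mul hK

theorem levelMat_apply_of_le {i j : Fin (n + 1)} (hij : j ≤ i) :
    levelMat R a b i j = (1 : LMat n R) i j := by
  rw [levelMat, Matrix.add_apply, Matrix.single_apply, if_neg (by rintro ⟨rfl, rfl⟩; order),
    add_zero]

theorem upperUni_levelMat : UpperUni (levelMat R a b) :=
  ⟨fun i j hij => by rw [levelMat_apply_of_le hab hij.le, Matrix.one_apply_ne hij.ne'],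
    fun i => by rw [levelMat_apply_of_le hab le_rfl, Matrix.one_apply_eq]⟩

omit hab in
theorem closeToOne_levelMat : CloseToOne (levelMat R a b) := by
  intro i j
  rw [levelMat, add_sub_cancel_left, Matrix.single_apply]
  split_ifs
  · intro m hm
    rw [tPow, neg_neg, HahnSeries.coeff_single, if_neg hm.ne]
  · exact ordGe_zero 1

/-- Every point of the level set corresponds to a point of `Gr_{μ+α}`. -/
theorem exists_corresponds_of_onLevel [Algebra ℂ R] (μ : Fin (n + 1) → ℤ) {x : Coord n → R}
    (hx : OnLevel a b x) : ∃ z, Corresponds μ a b x z := by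
  -- `A u = A (1 + t⁻¹ E_ab) + A V`, where the first term is `t^α (1 + t E_ba)` for
  -- `A = (1 + t E_ab) w`; relative to it the second one is congruent to a correction modulo `t⁻¹`
  set V := upMat x - levelMat R a b with hV
  have hV0 : StrictUpper V := fun i j hij => by
    rw [hV, Matrix.sub_apply, levelMat_apply_of_le hab hij, ← Matrix.sub_apply,
      (upperUni_upMat x).strictUpper_sub_one i j hij]
  have hV1 : MatGe 1 V := by
    rw [hV, ← sub_sub_sub_cancel_right _ _ 1]
    exact MatGe.sub (closeToOne_upMat x) closeToOne_levelMat
  have hVb : ∀ j, a ≤ j → OrdGe 2 (V j b) := by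
    intro j hj m hm
    rcases (show m ≤ 1 by omega).lt_or_eq with h | rfl
    · exact hV1 j b m h
    · rcases lt_or_ge j b with hjb | hjb
      · have e := upMat_momentCoord x ⟨j, hj, hjb⟩
        rw [hx, chi] at e
        rw [hV, Matrix.sub_apply, HahnSeries.coeff_sub, e, levelMat, Matrix.add_apply,
          Matrix.one_apply_ne hjb.ne, zero_add, Matrix.single_apply]
        by_cases h : j = a
        · rw [if_pos h, if_pos ⟨h.symm, rfl⟩, tPow, neg_neg, HahnSeries.coeff_single, if_pos rfl,
            map_one, sub_self]
        · rw [if_neg h, if_neg (fun h' => h h'.1.symm), map_zero, HahnSeries.coeff_zero, sub_self]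
      · rw [hV0 j b hjb]
        rfl
  have hM := ordGe_leftMat_mul_rightMat hab hV0 hV1 hVb
  have hLi := leftMat_mul_leftInv (R := R) hab.ne
  have hRi := rightMat_mul_rightInv (R := R) hab.ne
  have eM : leftMat R a b * upMat x * rightMat R a b =
      1 + leftMat R a b * V * rightMat R a b := by
    have e1 : leftMat R a b * levelMat R a b * rightMat R a b = 1 := by
      rw [← leftInv_mul_rightInv hab.ne, ← mul_assoc, hLi, one_mul, mul_eq_one_comm.mp hRi]
    rw [← e1, ← add_mul, ← mul_add, hV, add_sub_cancel]
  obtain ⟨p, q, hK⟩ := exists_closeToOne_corrMat hab (fun i j => (hM i j).1) fun i j => (hM i j).2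
  rw [← eM] at hK
  obtain ⟨z, U, B, h, -⟩ := exists_related_of_closeToOne (μ := μ) (μ' := μ + coroot a b) x
    (A := (1 - corrMat a b p q) * leftMat R a b) hK (lowerTri_rightInv hab)
    (fun i => by rw [rightInv_apply_self hab, Pi.add_apply, add_sub_cancel_left]) upperUni_one
    closeToOne_one (by
      rw [one_mul]
      calc _ = (1 - corrMat a b p q) * (leftMat R a b * upMat x) *
            (rightMat R a b * rightInv R a b) := by rw [hRi, mul_one, mul_assoc]
        _ = _ := by noncomm_ring)
  refine ⟨z, p, q, ?_⟩
  rw [← leftInv_mul_one_add_corrMat hab]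
  refine h.symm ?_
  have h1 := one_add_corrMat_mul hab p q (-p) (-q)
  rw [← corrMat_neg, add_neg_cancel, add_neg_cancel, corrMat_zero, add_zero, ← sub_eq_add_neg] at h1
  calc _ = leftInv R a b * ((1 + corrMat a b p q) * (1 - corrMat a b p q)) * leftMat R a b := by
        noncomm_ring
    _ = 1 := by rw [h1, mul_one, mul_eq_one_comm.mp hLi]

/-- Every point of `Gr_{μ+α}` corresponds to a point of the level set. -/
theorem exists_corresponds [Algebra ℂ R] (μ : Fin (n + 1) → ℤ) (z : Coord n → R) :
    ∃ x, OnLevel a b x ∧ Corresponds μ a b x z := by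
  set V := upMat z - 1 with hV
  have hV0 : StrictUpper V := (upperUni_upMat z).strictUpper_sub_one
  have hV1 : MatGe 1 V := closeToOne_upMat z
  -- the correction cancels the constant terms which arise in the row `b` and in the column `a`
  -- when these are multiplied by `t`
  set p : Fin (n + 1) → R := fun j => (V b j).coeff 1 with hp
  set q : Fin (n + 1) → R := fun i => -(V i a).coeff 1 with hq
  set k := corrMat a b p q with hk
  have hk0 : StrictUpper k := strictUpper_corrMat hab p q
  set X := k + V + k * V with hX
  have hX1 : (1 + k) * upMat z = 1 + X := by
    have e : upMat z = 1 + V := by rw [hV, add_sub_cancel]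
    rw [e, hX]
    noncomm_ring
  have hX0 : StrictUpper X := fun i j hij => by
    rw [hX, Matrix.add_apply, Matrix.add_apply, hk0 i j hij, hV0 i j hij,
      hk0.mul_upperTri hV0.upperTri i j hij, add_zero, add_zero]
  have hZ := matGe_rightMat_mul_rightInv hab (V := V) hX0 hk
    (by
      have e : X - k = V + k * V := by rw [hX]; abel
      rw [e]
      exact hV1.add ((MatGe.mul (k := 0) (l := 1) (matGe_corrMat p q) hV1)))
    (fun j => by
      rw [hX, Matrix.add_apply, Matrix.add_apply, Matrix.mul_apply,
        Finset.sum_eq_zero fun l _ => by rw [hk, corrMat_apply_last hab, zero_mul], hk,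
        corrMat_apply_last hab, zero_add, add_zero])
    (fun i => by
      have h0 : (k * V) i a = 0 := by
        rw [Matrix.mul_apply]
        refine Finset.sum_eq_zero fun l _ => ?_
        by_cases hl : a ≤ l
        · rw [hV0 l a hl, mul_zero]
        · rw [hk, corrMat_apply_of_not (by rintro (⟨-, h⟩ | ⟨-, h⟩) <;> order), zero_mul]
      rw [hX, Matrix.add_apply, Matrix.add_apply, h0, hk, corrMat_apply_first hab, zero_add,
        add_zero]) hV1 (fun _ => rfl) fun _ => rfl
  have hRi := rightMat_mul_rightInv (R := R) hab.ne
  have eZ : rightMat R a b * (1 + X) * rightInv R a b =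
      1 + rightMat R a b * X * rightInv R a b := by
    rw [mul_add, add_mul, mul_one, hRi]
  have hK : CloseToOne (rightMat R a b * (1 + X) * rightInv R a b) := by
    rw [CloseToOne, eZ, add_sub_cancel_left]
    exact hZ.1
  have eL : leftInv R a b = levelMat R a b * rightMat R a b := by
    rw [← leftInv_mul_rightInv hab.ne, mul_assoc, mul_eq_one_comm.mp hRi, mul_one]
  obtain ⟨x, U, B, h, hU, eK, hU', hB, hB'⟩ := exists_related_of_closeToOne (μ := μ + coroot a b)
    (μ' := μ) z (A := leftInv R a b * (1 + k)) hK (lowerTri_rightMat hab)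
    (fun i => by rw [rightMat_apply_self hab, Pi.add_apply, sub_add_cancel_left])
    (upperUni_levelMat hab) closeToOne_levelMat (by
      rw [mul_assoc, hX1, eL]
      calc _ = levelMat R a b * rightMat R a b * (1 + X) * (rightInv R a b * rightMat R a b) := by
            rw [mul_eq_one_comm.mp hRi, mul_one]
        _ = _ := by noncomm_ring)
  refine ⟨x, fun j => ?_, p, q, by rwa [← leftInv_mul_one_add_corrMat hab]⟩
  have hjb := j.2.2
  have hUj : (U j.1 b).coeff 1 = 0 := by
    have e := congrArg (fun M : LMat n R => (M j.1 b).coeff 1) eK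
    simp only [coeff_one_mul hU' hB' hjb.ne, hB j.1 b hjb, HahnSeries.coeff_zero, add_zero] at e
    rw [← e, eZ, Matrix.add_apply, Matrix.one_apply_ne hjb.ne, zero_add]
    exact hZ.2 j.1 j.2.1 hjb 1 (by norm_num)
  rw [← upMat_momentCoord x j, hU, coeff_one_mul closeToOne_levelMat hU' hjb.ne, hUj, add_zero,
    levelMat, Matrix.add_apply, Matrix.one_apply_ne hjb.ne, zero_add, Matrix.single_apply, chi]
  by_cases h : j.1 = a
  · rw [if_pos ⟨h.symm, rfl⟩, if_pos h, tPow, neg_neg, HahnSeries.coeff_single, if_pos rfl, map_one]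
  · rw [if_neg (fun h' => h h'.1.symm), if_neg h, map_zero]
    rfl

end Correspondence
/-! ### Orbits and fibres -/

section Orbits

variable {n : ℕ} {R S : Type*} [CommRing R] [CommRing S] {a b : Fin (n + 1)}
  (hab : a < b) {μ : Fin (n + 1) → ℤ} {x y z z' : Coord n → R}
include hab

/-- Two points of `Gr_{μ+α}` which are related by gauge matrices to the same point of `Gr_μ` agree,
and so do the gauge matrices. -/
theorem Related.eq_of_gaugeMat {p q p' q' : Fin (n + 1) → R}
    (h : Related (μ + coroot a b) μ (weylInv R a b * gaugeMat a b p q) z x)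
    (h' : Related (μ + coroot a b) μ (weylInv R a b * gaugeMat a b p' q') z' x) :
    z = z' ∧ gaugeMat a b p q = gaugeMat a b p' q' := by
  obtain ⟨Y, hY, hYu, hYp⟩ := exists_gaugeMat_right_inv hab p' q'
  have hw := weylMat_mul_weylInv (R := R) hab.ne
  have h1 := h.trans (h'.symm (B := Y * weylMat R a b) (by
    calc _ = Y * (weylMat R a b * weylInv R a b) * gaugeMat a b p' q' := by noncomm_ring
      _ = 1 := by rw [hw, mul_one, mul_eq_one_comm.mp hY]))
  have e : Y * weylMat R a b * (weylInv R a b * gaugeMat a b p q) = Y * gaugeMat a b p q := by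
    calc _ = Y * (weylMat R a b * weylInv R a b) * gaugeMat a b p q := by noncomm_ring
      _ = _ := by rw [hw, mul_one]
  rw [e] at h1
  obtain ⟨h2, h3⟩ := h1.eq_of_upper (hYu.mul (upperUni_gaugeMat hab p q))
    (hYp.mul (polyMat_gaugeMat p q))
  refine ⟨h2, ?_⟩
  calc gaugeMat a b p q = gaugeMat a b p' q' * Y * gaugeMat a b p q := by rw [hY, one_mul]
    _ = _ := by rw [mul_assoc, h3, mul_one]

/-- A point of `Gr_μ` corresponds to at most one point of `Gr_{μ+α}`. -/
theorem Corresponds.unique (h : Corresponds μ a b x z) (h' : Corresponds μ a b x z') :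
    z = z' := by
  obtain ⟨p, q, h⟩ := h
  obtain ⟨p', q', h'⟩ := h'
  exact (h.eq_of_gaugeMat hab h').1

variable [Algebra ℂ R]

/-- The points which correspond to the same point of `Gr_{μ+α}` form an orbit. -/
theorem Corresponds.exists_act_eq (h : Corresponds μ a b x z) (h' : Corresponds μ a b y z) :
    ∃ v : Root a b → R, y = (translationMap μ a b).act v x := by
  obtain ⟨p, q, h⟩ := h
  obtain ⟨p', q', h'⟩ := h'
  refine ⟨rootCorr a b (p' - p), eq_act_of_related (P := 1 + upperCorr a b (p' - p) (q' - q)) μ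
    ?_ (polyMat_one.add (polyMat_upperCorr _ _)) ?_⟩
  · have hs := strictUpper_upperCorr (a := a) (b := b) (p' - p) (q' - q)
    exact ⟨fun i j hij => by
      rw [Matrix.add_apply, Matrix.one_apply_ne hij.ne', hs i j hij.le, add_zero],
      fun i => by rw [Matrix.add_apply, Matrix.one_apply_eq, hs i i le_rfl, add_zero]⟩
  · obtain ⟨Y, hY, -⟩ := exists_gaugeMat_right_inv hab p q
    have hw := mul_eq_one_comm.mp (weylMat_mul_weylInv (R := R) hab.ne)
    have h1 := (h.symm (B := Y * weylMat R a b) (by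
      calc _ = Y * (weylMat R a b * weylInv R a b) * gaugeMat a b p q := by noncomm_ring
        _ = 1 := by rw [mul_eq_one_comm.mp hw, mul_one, mul_eq_one_comm.mp hY])).trans h'
    have e : gaugeMat a b p' q' = (1 + corrMat a b (p' - p) (q' - q)) * gaugeMat a b p q := by
      rw [one_add_corrMat_mul_gaugeMat hab, sub_add_cancel, sub_add_cancel]
    rw [← weylInv_mul_one_add_corrMat_mul hab]
    have e2 : weylInv R a b * gaugeMat a b p' q' * (Y * weylMat R a b) =
        weylInv R a b * (1 + corrMat a b (p' - p) (q' - q)) * weylMat R a b := by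
      rw [e]
      calc _ = weylInv R a b * (1 + corrMat a b (p' - p) (q' - q)) * (gaugeMat a b p q * Y) *
            weylMat R a b := by noncomm_ring
        _ = _ := by rw [hY, mul_one]
    rwa [← e2]

theorem related_act_of_related {p q : Fin (n + 1) → R} (v : Root a b → R)
    (h : Related (μ + coroot a b) μ (weylInv R a b * gaugeMat a b p q) z x) :
    Related (μ + coroot a b) μ (weylInv R a b * gaugeMat a b (corrOfRoot v + p) q) z
      ((translationMap μ a b).act v x) := by
  have h1 := h.trans (related_act μ v x)
  have h2 := one_add_corrMat_mul_gaugeMat hab (corrOfRoot v) 0 p q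
  rw [zero_add] at h2
  rwa [← mul_assoc, transMat_mul_weylInv hab, mul_assoc, h2] at h1

theorem Corresponds.act (h : Corresponds μ a b x z) (v : Root a b → R) :
    Corresponds μ a b ((translationMap μ a b).act v x) z := by
  obtain ⟨p, q, h⟩ := h
  exact ⟨_, _, related_act_of_related hab v h⟩

/-- The action is free at the points which correspond to a point of `Gr_{μ+α}`. -/
theorem Corresponds.eq_zero_of_act_eq (h : Corresponds μ a b x z) {v : Root a b → R}
    (hv : (translationMap μ a b).act v x = x) : v = 0 := by
  obtain ⟨p, q, h⟩ := h
  have h1 := related_act_of_related hab v h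
  rw [hv] at h1
  have h2 := (h1.eq_of_gaugeMat hab h).2
  have h3 : corrMat a b (corrOfRoot v) (0 : Fin (n + 1) → R) = 0 := by
    have e := corrMat_add (a := a) (b := b) (corrOfRoot v) 0 p q
    rw [zero_add] at e
    rw [gaugeMat, gaugeMat, add_right_inj, ← e] at h2
    exact add_eq_right.mp h2
  rw [← rootCorr_corrOfRoot v]
  have h4 : ∀ j, a < j → (corrOfRoot v : Fin (n + 1) → R) j = 0 := fun j hj => by
    have := congrFun (congrFun h3 a) j
    rw [corrMat_apply, if_pos ⟨rfl, hj⟩] at this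
    exact HahnSeries.C_injective (this.trans (map_zero _).symm)
  funext j
  rw [rootCorr]
  split_ifs with h
  · rw [h4 b hab, neg_zero]
    rfl
  · rw [h4 _ (lt_of_le_of_ne j.2.1 (Ne.symm h)), neg_zero]
    rfl

end Orbits
/-! ### The quotient of the level set -/

section Quotient

variable {n : ℕ} (μ : Fin (n + 1) → ℤ) {a b : Fin (n + 1)} (hab : a < b)
  {R S : Type*} [CommRing R] [Algebra ℂ R] [CommRing S] [Algebra ℂ S]

theorem comp_aeval_apply (φ : R →ₐ[ℂ] S) (x : Coord n → R) (f : CoordRing n) :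
    φ (MvPolynomial.aeval x f) = MvPolynomial.aeval (φ ∘ x) f := by
  rw [← AlgHom.comp_apply, MvPolynomial.comp_aeval]
  rfl

theorem OnLevel.map {x : Coord n → R} (h : OnLevel a b x) (φ : R →ₐ[ℂ] S) :
    OnLevel a b (φ ∘ x) := fun j => by
  rw [Function.comp_apply, h j, AlgHom.commutes]

theorem OnLevel.aeval_eq_zero {x : Coord n → R} (h : OnLevel a b x) {f : CoordRing n}
    (hf : f ∈ levelIdeal a b) : MvPolynomial.aeval x f = 0 := by
  have : levelIdeal a b ≤ RingHom.ker (MvPolynomial.aeval x : CoordRing n →ₐ[ℂ] R) := by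
    rw [levelIdeal, Ideal.span_le]
    rintro _ ⟨j, rfl⟩
    rw [SetLike.mem_coe, RingHom.mem_ker, map_sub, MvPolynomial.aeval_X, MvPolynomial.aeval_C, h j,
      sub_self]
  exact this hf

/-- The coordinate ring of the level set. -/
abbrev LevelRing (a b : Fin (n + 1)) : Type := CoordRing n ⧸ levelIdeal a b

/-- The homomorphism from the coordinate ring of the level set which is given by a point. -/
def OnLevel.lift {x : Coord n → R} (h : OnLevel a b x) : LevelRing a b →ₐ[ℂ] R :=
  Ideal.Quotient.liftₐ (levelIdeal a b) (MvPolynomial.aeval x) fun _ hf => h.aeval_eq_zero hf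

theorem OnLevel.lift_mk {x : Coord n → R} (h : OnLevel a b x) (f : CoordRing n) :
    h.lift (Ideal.Quotient.mkₐ ℂ (levelIdeal a b) f) = MvPolynomial.aeval x f :=
  Ideal.Quotient.liftₐ_apply _ _ _ _

/-- The universal point of the level set. -/
def levelPoint (a b : Fin (n + 1)) : Coord n → LevelRing a b :=
  Ideal.Quotient.mkₐ ℂ (levelIdeal a b) ∘ univ n

theorem aeval_levelPoint (f : CoordRing n) : MvPolynomial.aeval (levelPoint a b) f =
    Ideal.Quotient.mkₐ ℂ (levelIdeal a b) f := by
  rw [levelPoint, ← comp_aeval_apply, MvPolynomial.aeval_X_left_apply]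

theorem onLevel_levelPoint : OnLevel a b (levelPoint a b) := fun j => by
  have h : MvPolynomial.X (momentCoord j) - MvPolynomial.C (chi j) ∈ levelIdeal a b :=
    Ideal.subset_span ⟨j, rfl⟩
  exact Ideal.Quotient.eq.mpr h

theorem OnLevel.lift_comp_levelPoint {x : Coord n → R} (h : OnLevel a b x) :
    h.lift ∘ levelPoint a b = x := by
  funext c
  exact (h.lift_mk _).trans (MvPolynomial.aeval_X _ c)

theorem OnLevel.act {x : Coord n → R} (h : OnLevel a b x) (v : Root a b → R) :
    OnLevel a b ((translationMap μ a b).act v x) := fun j => by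
  rw [(related_act μ v x).momentCoord_eq, h j]

include hab in
/-- A point of the level set over the universal point of `Gr_{μ+α}`. -/
theorem exists_sectionMap : ∃ x : Coord n → CoordRing n, OnLevel a b x ∧
    Corresponds μ a b x (univ n) := exists_corresponds hab μ (univ n)

/-- A section of the quotient map over `Gr_{μ+α}`. -/
def sectionMap : Coord n → CoordRing n := (exists_sectionMap μ hab).choose

/-- The section over the point `z` of `Gr_{μ+α}`. -/
def sectionAt (z : Coord n → R) : Coord n → R := MvPolynomial.aeval z ∘ sectionMap μ hab

theorem onLevel_sectionMap : OnLevel a b (sectionMap μ hab) :=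
  (exists_sectionMap μ hab).choose_spec.1

theorem aeval_comp_univ (z : Coord n → R) :
    (MvPolynomial.aeval z : CoordRing n →ₐ[ℂ] R) ∘ univ n = z :=
  funext fun c => MvPolynomial.aeval_X z c

theorem corresponds_sectionAt (z : Coord n → R) : Corresponds μ a b (sectionAt μ hab z) z := by
  have h := (exists_sectionMap μ hab).choose_spec.2.map
    ((MvPolynomial.aeval z : CoordRing n →ₐ[ℂ] R) : CoordRing n →+* R)
  have e : ((MvPolynomial.aeval z : CoordRing n →ₐ[ℂ] R) : CoordRing n →+* R) ∘ univ n = z :=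
    aeval_comp_univ z
  rwa [e] at h

theorem onLevel_sectionAt (z : Coord n → R) : OnLevel a b (sectionAt μ hab z) :=
  (onLevel_sectionMap μ hab).map _

theorem aeval_sectionAt (z : Coord n → R) (f : CoordRing n) :
    MvPolynomial.aeval (sectionAt μ hab z) f =
      MvPolynomial.aeval z (MvPolynomial.aeval (sectionMap μ hab) f) :=
  (comp_aeval_apply _ _ f).symm

/-- The quotient map from the level set to `Gr_{μ+α}`. -/
def quotientMap : Coord n → LevelRing a b :=
  (exists_corresponds_of_onLevel hab μ onLevel_levelPoint).choose

theorem corresponds_quotientMap : Corresponds μ a b (levelPoint a b) (quotientMap μ hab) :=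
  (exists_corresponds_of_onLevel hab μ onLevel_levelPoint).choose_spec

theorem OnLevel.corresponds {x : Coord n → R} (h : OnLevel a b x) :
    Corresponds μ a b x (h.lift ∘ quotientMap μ hab) := by
  have h1 := (corresponds_quotientMap μ hab).map (h.lift : LevelRing a b →+* R)
  have e : (h.lift : LevelRing a b →+* R) ∘ levelPoint a b = x := h.lift_comp_levelPoint
  rwa [e] at h1

theorem lift_comp_quotientMap_act {x : Coord n → R} (h : OnLevel a b x) (v : Root a b → R) :
    (h.act μ v).lift ∘ quotientMap μ hab = h.lift ∘ quotientMap μ hab :=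
  ((h.act μ v).corresponds μ hab).unique hab ((h.corresponds μ hab).act hab v)

/-- A function on the level set which is pulled back from `Gr_{μ+α}` is invariant. -/
theorem mem_invariants {F f : CoordRing n} (h : Ideal.Quotient.mkₐ ℂ (levelIdeal a b) F =
    MvPolynomial.aeval (quotientMap μ hab) f) : F ∈ (translationMap μ a b).invariants := by
  intro R _ _ v x hx
  rw [← (hx.act μ v).lift_mk, ← hx.lift_mk, h, comp_aeval_apply, comp_aeval_apply,
    lift_comp_quotientMap_act]

/-- An invariant function on the level set is the pullback of its restriction to the section. -/
theorem mk_eq_of_mem_invariants {F : CoordRing n} (hF : F ∈ (translationMap μ a b).invariants) :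
    Ideal.Quotient.mkₐ ℂ (levelIdeal a b) F =
      MvPolynomial.aeval (quotientMap μ hab) (MvPolynomial.aeval (sectionMap μ hab) F) := by
  obtain ⟨v, hv⟩ := (corresponds_sectionAt μ hab (quotientMap μ hab)).exists_act_eq hab
    (corresponds_quotientMap μ hab)
  rw [← aeval_sectionAt, ← hF _ v _ (onLevel_sectionAt μ hab _), ← hv, aeval_levelPoint]

theorem lift_sectionMap_comp_quotientMap :
    (onLevel_sectionMap μ hab).lift ∘ quotientMap μ hab = univ n :=
  ((onLevel_sectionMap μ hab).corresponds μ hab).unique hab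
    (exists_sectionMap μ hab).choose_spec.2

theorem aeval_quotientMap_mem (f : CoordRing n) :
    MvPolynomial.aeval (quotientMap μ hab) f ∈ (translationMap μ a b).reducedRing := by
  obtain ⟨F, hF⟩ := Ideal.Quotient.mkₐ_surjective ℂ (levelIdeal a b)
    (MvPolynomial.aeval (quotientMap μ hab) f)
  exact Subalgebra.mem_map.mpr ⟨F, mem_invariants μ hab hF, hF⟩

/-- The pullback of functions from `Gr_{μ+α}` to the reduction. -/
def reducedHom : CoordRing n →ₐ[ℂ] (translationMap μ a b).reducedRing :=
  (MvPolynomial.aeval (quotientMap μ hab)).codRestrict _ (aeval_quotientMap_mem μ hab)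

theorem coe_reducedHom (f : CoordRing n) :
    (reducedHom μ hab f).1 = MvPolynomial.aeval (quotientMap μ hab) f := rfl

theorem toReduced_eq (F : (translationMap μ a b).invariants) :
    (translationMap μ a b).toReduced F =
      reducedHom μ hab (MvPolynomial.aeval (sectionMap μ hab) F.1) :=
  Subtype.ext (mk_eq_of_mem_invariants μ hab F.2)

theorem reducedHom_bijective : Function.Bijective (reducedHom μ hab) := by
  constructor
  · intro f g h
    have h1 := congrArg (fun q => (onLevel_sectionMap μ hab).lift q.1) h
    simp only [coe_reducedHom, comp_aeval_apply, lift_sectionMap_comp_quotientMap,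
      MvPolynomial.aeval_X_left_apply] at h1
    exact h1
  · rintro ⟨q, hq⟩
    obtain ⟨F, hF, rfl⟩ := Subalgebra.mem_map.mp hq
    exact ⟨_, (toReduced_eq μ hab ⟨F, hF⟩).symm⟩

/-- The isomorphism of the coordinate rings of `Gr_{μ+α}` and of the reduction. -/
def reducedEquiv : CoordRing n ≃ₐ[ℂ] (translationMap μ a b).reducedRing :=
  AlgEquiv.ofBijective (reducedHom μ hab) (reducedHom_bijective μ hab)

include hab in
theorem isFreeQuotient : IsFreeQuotient (translationMap μ a b) where
  free R _ _ v x hx hv := (hx.corresponds μ hab).eq_zero_of_act_eq hab hv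
  fibre R _ _ x y hx hy h := by
    have e : hx.lift ∘ quotientMap μ hab = hy.lift ∘ quotientMap μ hab := by
      funext c
      obtain ⟨F, hF⟩ := Ideal.Quotient.mkₐ_surjective ℂ (levelIdeal a b) (quotientMap μ hab c)
      have hF' := mem_invariants μ hab (F := F) (f := MvPolynomial.X c)
        (hF.trans (MvPolynomial.aeval_X _ c).symm)
      rw [Function.comp_apply, Function.comp_apply, ← hF, hx.lift_mk, hy.lift_mk, h F hF']
    have h1 := hx.corresponds μ hab
    rw [e] at h1
    obtain ⟨v, hv⟩ := h1.exists_act_eq hab (hy.corresponds μ hab)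
    exact ⟨v, hv.symm⟩
  surjective R _ _ φ := by
    refine ⟨sectionAt μ hab ((φ.comp (reducedHom μ hab)) ∘ univ n), onLevel_sectionAt μ hab _,
      fun F => ?_⟩
    rw [toReduced_eq μ hab, aeval_sectionAt, ← comp_aeval_apply, MvPolynomial.aeval_X_left_apply]
    rfl

end Quotient
/-! ### Comparison of the brackets -/

section Comparison

variable {n : ℕ} (μ : Fin (n + 1) → ℤ) {a b : Fin (n + 1)} (hab : a < b)

section Infinitesimal

variable {R : Type} [CommRing R] [Algebra ℂ R]

open TrivSqZeroExt in
/-- The first order part of a function of `(v, x)` in the direction `j` at `v = 0`. -/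
theorem snd_aeval_dualNumber (j : Root a b) (x : Coord n → R) (f : ActionRing n a b) :
    (MvPolynomial.aeval (Sum.elim (fun k => if k = j then DualNumber.eps else 0)
      (fun c => inl (x c))) f : DualNumber R).snd =
      MvPolynomial.aeval x (derivAtZero a b j f) := by
  set φ : ActionRing n a b →ₐ[ℂ] DualNumber R := MvPolynomial.aeval (Sum.elim
    (fun k => if k = j then DualNumber.eps else 0) (fun c => inl (x c))) with hφ
  have hfst : ∀ f, (φ f).fst = MvPolynomial.aeval x (evalAtZero a b f) := by
    have h : (fstHom ℂ R R).comp φ = (MvPolynomial.aeval x).comp (evalAtZero a b) := by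
      refine MvPolynomial.algHom_ext fun s => ?_
      rw [AlgHom.comp_apply, AlgHom.comp_apply, hφ, evalAtZero, MvPolynomial.aeval_X,
        MvPolynomial.aeval_X]
      rcases s with k | c
      · rw [Sum.elim_inl, Sum.elim_inl, Pi.zero_apply, map_zero]
        split_ifs
        · exact DualNumber.fst_eps
        · exact map_zero _
      · rw [Sum.elim_inr, Sum.elim_inr, MvPolynomial.aeval_X]
        rfl
    exact fun f => DFunLike.congr_fun h f
  induction f using MvPolynomial.induction_on with
  | C z =>
    rw [derivAtZero_C, map_zero, hφ, MvPolynomial.aeval_C]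
    rfl
  | add f g hf hg => rw [map_add, snd_add, hf, hg, map_add, map_add]
  | mul_X f s hf =>
    have hX : (φ (MvPolynomial.X s)).snd =
        MvPolynomial.aeval x (derivAtZero a b j (MvPolynomial.X s)) := by
      rw [hφ, MvPolynomial.aeval_X]
      rcases s with k | c
      · rw [Sum.elim_inl, derivAtZero_X]
        split_ifs
        · rw [DualNumber.snd_eps, map_one]
        · rw [map_zero]
          rfl
      · have h := derivAtZero_rename (a := a) (b := b) j (MvPolynomial.X c)
        rw [MvPolynomial.rename_X] at h
        rw [Sum.elim_inr, snd_inl, h, map_zero]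
    rw [map_mul, snd_mul, hX, hf, hfst, hfst, derivAtZero_mul, map_add, map_mul, map_mul,
      smul_eq_mul, op_smul_eq_smul, smul_eq_mul]
    ring

/-- The infinitesimal action annihilates a function with invariant restriction to the level set,
along the level set. -/
theorem aeval_infinitesimal_eq_zero {ρ : ActionMap n a b} {F : CoordRing n}
    (hF : F ∈ ρ.invariants) {x : Coord n → R} (hx : OnLevel a b x) (j : Root a b) :
    MvPolynomial.aeval x (ρ.infinitesimal j F) = 0 := by
  have h1 := snd_aeval_dualNumber j x (MvPolynomial.aeval ρ F)
  have h2 : OnLevel a b fun c => (TrivSqZeroExt.inl (x c) : DualNumber R) :=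
    hx.map (TrivSqZeroExt.inlAlgHom ℂ R R)
  have h3 := hF (DualNumber R) (fun k => if k = j then DualNumber.eps else 0) _ h2
  have h4 : (MvPolynomial.aeval (fun c => (TrivSqZeroExt.inl (x c) : DualNumber R)) F).snd = 0 := by
    have e : (MvPolynomial.aeval (fun c => (TrivSqZeroExt.inl (x c) : DualNumber R)) F) =
        TrivSqZeroExt.inlAlgHom ℂ R R (MvPolynomial.aeval x F) :=
      (comp_aeval_apply (TrivSqZeroExt.inlAlgHom ℂ R R) x F).symm
    rw [e]
    exact TrivSqZeroExt.snd_inl _ _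
  rw [← h3] at h4
  refine h1.symm.trans (Eq.trans ?_ h4)
  rw [← AlgHom.comp_apply, MvPolynomial.comp_aeval]
  rfl

end Infinitesimal

/-- The element of the root group in the universal family. -/
def groupPoint (a b : Fin (n + 1)) : Root a b → ActionRing n a b := fun j =>
  MvPolynomial.X (Sum.inl j)

/-- The point of `Gr_{μ+α}` in the universal family. -/
def basePoint (a b : Fin (n + 1)) : Coord n → ActionRing n a b :=
  fun c => MvPolynomial.X (Sum.inr c)

/-- The universal family of points of the level set: the translate of the section by an element of
the root group. It trivializes the quotient map. -/
def levelFamily : Coord n → ActionRing n a b :=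
  (translationMap μ a b).act (groupPoint a b) (sectionAt μ hab (basePoint a b))

theorem onLevel_levelFamily : OnLevel a b (levelFamily μ hab) :=
  (onLevel_sectionAt μ hab _).act μ _

theorem corresponds_levelFamily : Corresponds μ a b (levelFamily μ hab) (basePoint a b) :=
  (corresponds_sectionAt μ hab _).act hab _

theorem lift_comp_quotientMap_levelFamily :
    (onLevel_levelFamily μ hab).lift ∘ quotientMap μ hab = basePoint a b :=
  ((onLevel_levelFamily μ hab).corresponds μ hab).unique hab (corresponds_levelFamily μ hab)

/-- The trivialization of the quotient map: the level set is isomorphic to `G_α × Gr_{μ+α}`, by the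
universal family in one direction and by `η` in the other. -/
theorem exists_trivialization : ∃ η : ActionRing n a b →ₐ[ℂ] LevelRing a b,
    η ∘ levelFamily μ hab = levelPoint a b ∧ η ∘ basePoint a b = quotientMap μ hab ∧
      ∀ e, (onLevel_levelFamily μ hab).lift (η e) = e := by
  obtain ⟨v, hv⟩ := (corresponds_sectionAt μ hab (quotientMap μ hab)).exists_act_eq hab
    (corresponds_quotientMap μ hab)
  set η : ActionRing n a b →ₐ[ℂ] LevelRing a b :=
    MvPolynomial.aeval (Sum.elim v (quotientMap μ hab)) with hη
  have h1 : η ∘ groupPoint a b = v := funext fun j => MvPolynomial.aeval_X _ _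
  have h2 : η ∘ basePoint a b = quotientMap μ hab := funext fun j => MvPolynomial.aeval_X _ _
  have hs : ∀ {R S : Type} [CommRing R] [Algebra ℂ R] [CommRing S] [Algebra ℂ S] (φ : R →ₐ[ℂ] S)
      (z : Coord n → R), φ ∘ sectionAt μ hab z = sectionAt μ hab (φ ∘ z) := fun φ z =>
    funext fun c => comp_aeval_apply φ z _
  have h3 : η ∘ levelFamily μ hab = levelPoint a b := by
    rw [levelFamily, act_map, hs, h1, h2, hv]
  refine ⟨η, h3, h2, ?_⟩
  set L := (onLevel_levelFamily μ hab).lift with hL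
  have h4 : L ∘ quotientMap μ hab = basePoint a b := lift_comp_quotientMap_levelFamily μ hab
  have h5 : L ∘ v = groupPoint a b := by
    have e1 : (translationMap μ a b).act (L ∘ v) (sectionAt μ hab (basePoint a b)) =
        (translationMap μ a b).act (groupPoint a b) (sectionAt μ hab (basePoint a b)) := by
      rw [← h4, ← hs, ← act_map, ← hv, hs, h4]
      exact (onLevel_levelFamily μ hab).lift_comp_levelPoint
    have e2 : (translationMap μ a b).act (-groupPoint a b + L ∘ v)
        (sectionAt μ hab (basePoint a b)) = sectionAt μ hab (basePoint a b) := by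
      rw [add_act, e1, ← add_act, neg_add_cancel, zero_act]
    exact (neg_add_eq_zero.mp
      ((corresponds_sectionAt μ hab (basePoint a b)).eq_zero_of_act_eq hab e2)).symm
  have h6 : L.comp η = AlgHom.id ℂ _ := by
    refine MvPolynomial.algHom_ext fun s => ?_
    rw [AlgHom.comp_apply, hη, MvPolynomial.aeval_X]
    rcases s with j | c
    · exact congrFun h5 j
    · exact congrFun h4 c
  exact fun e => DFunLike.congr_fun h6 e

theorem aeval_levelFamily_surjective :
    Function.Surjective (MvPolynomial.aeval (levelFamily μ hab) : CoordRing n →ₐ[ℂ] _) := by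
  obtain ⟨η, -, -, h⟩ := exists_trivialization μ hab
  intro e
  obtain ⟨F, hF⟩ := Ideal.Quotient.mkₐ_surjective ℂ (levelIdeal a b) (η e)
  exact ⟨F, by rw [← (onLevel_levelFamily μ hab).lift_mk, hF, h]⟩

theorem mem_levelIdeal_of_aeval_levelFamily {F : CoordRing n}
    (h : MvPolynomial.aeval (levelFamily μ hab) F = 0) : F ∈ levelIdeal a b := by
  obtain ⟨η, h1, -, -⟩ := exists_trivialization μ hab
  have h2 := congrArg η h
  rw [comp_aeval_apply, h1, aeval_levelPoint, map_zero] at h2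
  exact Ideal.Quotient.eq_zero_iff_mem.mp h2

/-- The Hamiltonian field of an invariant function is tangent to the level set. -/
theorem aeval_hamiltonianField_eq_zero {R : Type} [CommRing R] [Algebra ℂ R] {F f : CoordRing n}
    (hF : F ∈ (translationMap μ a b).invariants) {x : Coord n → R} (hx : OnLevel a b x)
    (hf : f ∈ levelIdeal a b) : MvPolynomial.aeval x (hamiltonianField μ F f) = 0 := by
  induction hf using Submodule.span_induction with
  | mem f hf =>
    obtain ⟨j, rfl⟩ := hf
    have h := aeval_infinitesimal_eq_zero hF hx j
    rw [infinitesimal_eq_bracket] at h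
    rw [map_sub, MvPolynomial.derivation_C, sub_zero]
    exact h
  | zero => rw [map_zero, map_zero]
  | add f g _ _ hf hg => rw [map_add, map_add, hf, hg, add_zero]
  | smul c f hf' hf =>
    rw [smul_eq_mul, Derivation.leibniz, map_add, smul_eq_mul, smul_eq_mul, map_mul, map_mul, hf,
      hx.aeval_eq_zero hf', mul_zero, zero_mul, add_zero]

end Comparison
/-! ### The bracket of the reduction -/

section CorrectionTerm

variable {n : ℕ} {R S : Type*} [CommRing R] [CommRing S] {a b : Fin (n + 1)}

variable (a b) in
/-- The inverse of `gaugeMat`. -/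
def gaugeInv (p q : Fin (n + 1) → R) : LMat n R :=
  1 + Matrix.single a b (tPow R 1) - corrMat a b p q

/-- When an upper triangular matrix which vanishes at `t = ∞` is conjugated by a gauge matrix, its
polynomial part becomes a constant correction. -/
theorem exists_polyPart_gaugeMat_conj (hab : a < b) {X : LMat n R} (hX : UpperTri X)
    (h1 : MatGe 1 X) (p q : Fin (n + 1) → R) : ∃ p' q',
      polyPart (gaugeMat a b p q * X * gaugeInv a b p q) = corrMat a b p' q' := by
  set t : LMat n R := Matrix.single a b (tPow R 1) with ht
  set k := corrMat a b p q with hk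
  -- the quadratic terms vanish: rows have index at most `a`, columns have index larger than `a`
  have hquad : (t - k) * X * (t - k) = 0 := by
    have hz : ∀ i l, ¬ (i ≤ a ∧ a < l) → (t - k) i l = 0 := fun i l h => by
      rw [Matrix.sub_apply, ht, hk, Matrix.single_apply,
        if_neg (by rintro ⟨rfl, rfl⟩; exact h ⟨le_rfl, hab⟩), corrMat_apply_of_not, sub_zero]
      rintro (⟨rfl, h'⟩ | ⟨h', rfl⟩)
      · exact h ⟨le_rfl, h'⟩
      · exact h ⟨h'.le, hab⟩
    ext1 i j
    rw [Matrix.mul_apply]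
    refine Finset.sum_eq_zero fun l _ => ?_
    by_cases hl : a < l
    · rw [hz l j (fun h => by order), mul_zero]
    · rw [Matrix.mul_apply, Finset.sum_eq_zero fun m _ => ?_, zero_mul]
      by_cases hm : a < m
      · rw [hX m l (by order), mul_zero]
      · rw [hz i m (fun h => hm h.2), zero_mul]
  set M := X * t - t * X with hM
  have e : gaugeMat a b p q * X * gaugeInv a b p q = X + (k * X - X * k) + M := by
    have e1 : gaugeMat a b p q = 1 - (t - k) := by rw [gaugeMat]; abel
    have e2 : gaugeInv a b p q = 1 + (t - k) := by rw [gaugeInv]; abel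
    have e3 : (1 - (t - k)) * X * (1 + (t - k)) =
        X + (k * X - X * k) + (X * t - t * X) - (t - k) * X * (t - k) := by noncomm_ring
    rw [e1, e2, e3, hquad, sub_zero]
  have hord : MatGe 1 (X + (k * X - X * k)) := by
    have hk0 : MatGe 0 k := matGe_corrMat p q
    exact h1.add ((MatGe.mul (k := 0) (l := 1) hk0 h1).sub (MatGe.mul (k := 1) (l := 0) h1 hk0))
  have hM1 : ∀ i j, M i j = (if j = b then X i a * tPow R 1 else 0) -
      if i = a then tPow R 1 * X b j else 0 := fun i j => by
    rw [hM, Matrix.sub_apply, ht, mul_single_apply', single_mul_apply']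
  have ht0 : ∀ f : LaurentSeries R, OrdGe 1 f → OrdGe 0 (tPow R 1 * f) := fun f hf =>
    ordGe_tPow_mul 1 hf
  have hM0 : MatGe 0 M := fun i j => by
    rw [hM1]
    refine OrdGe.sub ?_ ?_
    · split_ifs
      · rw [mul_comm]
        exact ht0 _ (h1 i a)
      · exact ordGe_zero 0
    · split_ifs
      · exact ht0 _ (h1 b j)
      · exact ordGe_zero 0
  obtain ⟨p', q', h⟩ := exists_matGe_sub_corrMat (a := a) (b := b) hM0 fun i j hij => by
    have z1 : (if j = b then X i a * tPow R 1 else 0) = 0 := by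
      split_ifs with h
      · rw [hX i a, zero_mul]
        by_contra h'
        rcases (not_lt.mp h').lt_or_eq with h' | rfl
        · exact hij (Or.inr ⟨h', h⟩)
        · exact hij (Or.inl ⟨rfl, h ▸ hab⟩)
      · rfl
    have z2 : (if i = a then tPow R 1 * X b j else 0) = 0 := by
      split_ifs with h
      · rw [hX b j, mul_zero]
        by_contra h'
        exact hij (Or.inl ⟨h, hab.trans_le (not_lt.mp h')⟩)
      · rfl
    rw [hM1, z1, z2, sub_zero]
    exact ordGe_zero 1
  refine ⟨p', q', ?_⟩
  have h2 := truncMat_eq_self (hord.add h)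
  rw [← add_sub_assoc, map_sub, truncMat_eq_zero (polyMat_corrMat p' q'), sub_zero] at h2
  rw [e, polyPart, h2, sub_sub_cancel]

theorem gaugeMat_mul_gaugeInv (hab : a < b) (p q : Fin (n + 1) → R) :
    gaugeMat a b p q * gaugeInv a b p q = 1 := by
  have h1 := corrMat_mul_corrMat hab p q p q
  have h2 := single_mul_corrMat hab (tPow R 1) p q
  have h3 := corrMat_mul_single hab (tPow R 1) p q
  have h4 : (Matrix.single a b (tPow R 1) * Matrix.single a b (tPow R 1) : LMat n R) = 0 :=
    single_mul_single_self hab _ _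
  rw [gaugeMat, gaugeInv]
  simp only [mul_add, mul_sub, sub_mul, add_mul, one_mul, mul_one, h1, h2, h3, h4]
  abel

theorem corrMat_mul_gaugeInv (hab : a < b) (p q p' q' : Fin (n + 1) → R) :
    corrMat a b p q * gaugeInv a b p' q' = corrMat a b p q := by
  have h1 := corrMat_mul_corrMat hab p q p' q'
  have h3 := corrMat_mul_single hab (tPow R 1) p q
  rw [gaugeInv]
  simp only [mul_add, mul_sub, mul_one, h1, h3]
  abel

section

variable {E : Type*} [CommRing E] [Algebra ℂ E]

theorem constMat_weylMat : ConstMat (weylMat E a b) :=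
  (((constMat_one.sub (constMat_single_one a a)).sub (constMat_single_one b b)).add
    (constMat_single_one b a)).sub (constMat_single_one a b)

theorem constMat_weylInv : ConstMat (weylInv E a b) :=
  (((constMat_one.sub (constMat_single_one a a)).sub (constMat_single_one b b)).add
    (constMat_single_one a b)).sub (constMat_single_one b a)

end

theorem dmap_gaugeMat {E : Type*} [CommRing E] [Algebra ℂ E] (D : Derivation ℂ E E)
    (p q : Fin (n + 1) → E) :
    dmap (D : E →+ E) (gaugeMat a b p q) = corrMat a b (D ∘ p) (D ∘ q) := by
  have h1 : dmap (D : E →+ E) (1 - Matrix.single a b (tPow E 1) : LMat n E) = 0 := by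
    rw [map_sub, constMat_one.dmap_eq_zero, zero_sub, neg_eq_zero]
    ext1 i j
    rw [dmap_apply, Matrix.single_apply]
    split_ifs
    · refine HahnSeries.ext (funext fun m => ?_)
      rw [coeff_cmap, tPow, HahnSeries.coeff_single]
      split_ifs
      · exact D.map_one_eq_zero
      · exact map_zero _
    · exact map_zero _
  rw [gaugeMat, map_add, h1, zero_add]
  ext1 i j
  rw [dmap_apply, corrMat_apply, corrMat_apply]
  refine HahnSeries.ext (funext fun m => ?_)
  rw [coeff_cmap]
  split_ifs
  · rw [HahnSeries.C_apply, HahnSeries.C_apply, HahnSeries.coeff_single, HahnSeries.coeff_single]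
    split_ifs
    · rfl
    · exact map_zero _
  · rw [HahnSeries.C_apply, HahnSeries.C_apply, HahnSeries.coeff_single, HahnSeries.coeff_single]
    split_ifs
    · rfl
    · exact map_zero _
  · exact map_zero _

/-- A correction, conjugated by `w`, is orthogonal to `Y = g (grad F)` when `F` is invariant under
the root group: its part in `𝔫` is orthogonal to all gradients, and the pairings with `E_bj` are
the derivatives of `F` in the directions of the root group. -/
theorem res_weylInv_mul_corrMat_mul (hab : a < b) (p q : Fin (n + 1) → R) {Y : LMat n R}
    (hY : LowerIsPoly Y) (hY' : ∀ j : Root a b, (Y j.1 b).coeff 1 = 0) :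
    res (weylInv R a b * corrMat a b p q * weylMat R a b * Y) = 0 := by
  rw [weylInv_mul_corrMat_mul hab, add_mul, map_add,
    res_strictUpper_mul (strictUpper_upperCorr p q) (polyMat_upperCorr p q) hY, zero_add, rootMat,
    Finset.sum_mul, map_sum]
  refine Finset.sum_eq_zero fun j _ => ?_
  rw [res_comm, res_mul_single, HahnSeries.C_apply, HahnSeries.coeff_mul_single_zero, hY', zero_mul]

end CorrectionTerm

section ReducedBracket

variable {n : ℕ} (μ : Fin (n + 1) → ℤ) {a b : Fin (n + 1)} (hab : a < b)

/-- The bracket of `Gr_{μ+α}` is induced by the bracket of `Gr_μ`. The two brackets are compared on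
the universal family of points of the level set, where the gauge matrix varies only in its
constant correction. -/
theorem mk_bracket {F₁ F₂ : CoordRing n} (hF₁ : F₁ ∈ (translationMap μ a b).invariants)
    (hF₂ : F₂ ∈ (translationMap μ a b).invariants) :
    Ideal.Quotient.mkₐ ℂ (levelIdeal a b) (bracket μ F₁ F₂) =
      MvPolynomial.aeval (quotientMap μ hab) (bracket (μ + coroot a b)
        (MvPolynomial.aeval (sectionMap μ hab) F₁) (MvPolynomial.aeval (sectionMap μ hab) F₂)) := by
  set f₁ := MvPolynomial.aeval (sectionMap μ hab) F₁ with hf₁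
  set f₂ := MvPolynomial.aeval (sectionMap μ hab) F₂ with hf₂
  set θ : CoordRing n →ₐ[ℂ] ActionRing n a b := MvPolynomial.aeval (levelFamily μ hab) with hθ
  set ι : CoordRing n →ₐ[ℂ] ActionRing n a b := MvPolynomial.aeval (basePoint a b) with hι
  suffices h : θ (bracket μ F₁ F₂) = ι (bracket (μ + coroot a b) f₁ f₂) by
    obtain ⟨η, h1, h2, -⟩ := exists_trivialization μ hab
    have h3 := congrArg η h
    rwa [hθ, hι, comp_aeval_apply, comp_aeval_apply, h1, h2, aeval_levelPoint] at h3
  have hrestr : ∀ {F}, F ∈ (translationMap μ a b).invariants →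
      θ F = ι (MvPolynomial.aeval (sectionMap μ hab) F) := fun {F} hF => by
    rw [hθ, hι, ← aeval_sectionAt]
    exact hF _ _ _ (onLevel_sectionAt μ hab _)
  have hx := onLevel_levelFamily μ hab
  have hker : ∀ x, θ x = 0 → θ (hamiltonianField μ F₂ x) = 0 := fun x h =>
    aeval_hamiltonianField_eq_zero μ hF₂ hx (mem_levelIdeal_of_aeval_levelFamily μ hab h)
  -- the Hamiltonian field of `F₂` is tangent to the level set, that of `f₁` is lifted to
  -- the product with the root group as a horizontal field
  set D₁ := Derivation.liftOfSurjective (aeval_levelFamily_surjective μ hab) hker with hD₁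
  set D₂ : Derivation ℂ (ActionRing n a b) (ActionRing n a b) := MvPolynomial.mkDerivation ℂ
    (Sum.elim 0 fun c => ι (hamiltonianField (μ + coroot a b) f₁ (MvPolynomial.X c))) with hD₂
  have hD₂' : ∀ x, D₂ (ι x) = ι (hamiltonianField (μ + coroot a b) f₁ x) := by
    intro x
    induction x using MvPolynomial.induction_on with
    | C z =>
      rw [MvPolynomial.derivation_C, map_zero, hι, MvPolynomial.aeval_C]
      exact MvPolynomial.derivation_C _ _
    | add x y hx hy => simp only [map_add, hx, hy]
    | mul_X x c hx =>
      have hc : D₂ (ι (MvPolynomial.X c)) =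
          ι (hamiltonianField (μ + coroot a b) f₁ (MvPolynomial.X c)) := by
        rw [hι, MvPolynomial.aeval_X, hD₂, basePoint, MvPolynomial.mkDerivation_X, Sum.elim_inr]
      rw [map_mul, Derivation.leibniz, hx, hc, Derivation.leibniz, map_add, smul_eq_mul,
        smul_eq_mul, smul_eq_mul, smul_eq_mul, map_mul, map_mul]
  obtain ⟨p, q, hrel⟩ := corresponds_levelFamily μ hab
  rw [← aeval_comp_univ (levelFamily μ hab), ← aeval_comp_univ (basePoint a b)] at hrel
  have hgi := gaugeMat_mul_gaugeInv hab p q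
  have hu := upperUni_gaugeMat hab p q
  obtain ⟨q', qi, c, ci, G⟩ := hrel.exists_gaugeRelated (weylMat_mul_weylInv hab.ne)
    constMat_weylMat constMat_weylInv (mul_eq_one_comm.mp hgi) (hu.of_mul_eq_one hgi)
    ((polyMat_gaugeMat p q).of_mul_eq_one hu.det hgi)
  refine G.bracket_eq (hrestr hF₁) (hrestr hF₂) (D₁ := D₁) (D₂ := D₂)
    (fun x => Derivation.liftOfSurjective_apply _ hker x) hD₂' ?_
  obtain ⟨p₁, q₁, e₁⟩ := exists_polyPart_gaugeMat_conj hab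
    (X := truncMat (GaugeRelated.point (μ + coroot a b) ι *
      GaugeRelated.gradAt (μ + coroot a b) ι f₁))
    (by
      rw [GaugeRelated.truncMat_point_mul]
      exact (upperTri_gradLeft _ f₁).smap _) (matGe_truncMat _) p q
  rw [e₁, dmap_gaugeMat, corrMat_mul_gaugeInv hab, corrMat_add]
  refine res_weylInv_mul_corrMat_mul hab _ _ (GaugeRelated.lowerIsPoly_point_mul μ θ F₂) fun j => ?_
  have h := aeval_infinitesimal_eq_zero hF₂ hx j
  rw [infinitesimal_eq_bracket, bracket_momentCoord] at h
  rw [GaugeRelated.point, GaugeRelated.gradAt, ← map_mul]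
  exact h

end ReducedBracket
/-! ### The Poisson structure of the reduction -/

section ReducedPoisson

variable {n : ℕ} (μ : Fin (n + 1) → ℤ) {a b : Fin (n + 1)} (hab : a < b)

/-- The bracket on the coordinate ring of the reduction, transported from `Gr_{μ+α}`. -/
def reducedBracket (p q : (translationMap μ a b).reducedRing) :
    (translationMap μ a b).reducedRing :=
  reducedEquiv μ hab (bracket (μ + coroot a b) ((reducedEquiv μ hab).symm p)
    ((reducedEquiv μ hab).symm q))

theorem reducedBracket_reducedEquiv (f g : CoordRing n) :
    reducedBracket μ hab (reducedEquiv μ hab f) (reducedEquiv μ hab g) =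
      reducedEquiv μ hab (bracket (μ + coroot a b) f g) := by
  rw [reducedBracket, AlgEquiv.symm_apply_apply, AlgEquiv.symm_apply_apply]

theorem isReducedBracket : IsReducedBracket μ (translationMap μ a b) (reducedBracket μ hab) := by
  intro F G
  rw [mk_bracket μ hab F.2 G.2, toReduced_eq μ hab F, toReduced_eq μ hab G]
  exact congrArg Subtype.val (reducedBracket_reducedEquiv μ hab _ _)

theorem IsPoissonBracket.of_equiv {A B : Type*} [CommRing A] [Algebra ℂ A] [CommRing B]
    [Algebra ℂ B] {β : A → A → A} (h : IsPoissonBracket β) (e : A ≃ₐ[ℂ] B) :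
    IsPoissonBracket fun p q => e (β (e.symm p) (e.symm q)) where
  add_left f g k := by rw [map_add, h.add_left, map_add]
  smul_left c f g := by rw [map_smul, h.smul_left, map_smul]
  leibniz f g k := by
    rw [map_mul, h.leibniz, map_add, map_mul, map_mul, AlgEquiv.apply_symm_apply,
      AlgEquiv.apply_symm_apply]
  skew f g := by rw [h.skew, map_neg]
  jacobi f g k := by
    rw [AlgEquiv.symm_apply_apply, AlgEquiv.symm_apply_apply, AlgEquiv.symm_apply_apply, ← map_add,
      ← map_add, h.jacobi, map_zero]

theorem isPoissonBracket_reducedBracket : IsPoissonBracket (reducedBracket μ hab) :=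
  (isPoissonBracket_bracket (μ + coroot a b)).of_equiv (reducedEquiv μ hab)

end ReducedPoisson
end GrSlice

end

theorem mainTheorem7 (n : ℕ) (μ : Fin (n + 1) → ℤ) (a b : Fin (n + 1)) (hab : a < b) :
    GrSlice.IsPoissonBracket (GrSlice.bracket μ) ∧
    ∃ ρ : GrSlice.ActionMap n a b,
      GrSlice.IsTranslationAction μ ρ ∧
      GrSlice.IsHamiltonian μ ρ ∧
      GrSlice.IsFreeQuotient ρ ∧
      ∃ B : ρ.reducedRing → ρ.reducedRing → ρ.reducedRing,
        GrSlice.IsReducedBracket μ ρ B ∧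
        GrSlice.IsPoissonBracket B ∧
        ∃ e : GrSlice.CoordRing n ≃ₐ[ℂ] ρ.reducedRing,
          ∀ f g : GrSlice.CoordRing n,
            e (GrSlice.bracket (μ + GrSlice.coroot a b) f g) = B (e f) (e g) := by
  refine ⟨GrSlice.isPoissonBracket_bracket μ, GrSlice.translationMap μ a b,
    GrSlice.isTranslationAction μ, GrSlice.isHamiltonian μ, GrSlice.isFreeQuotient μ hab,
    GrSlice.reducedBracket μ hab, GrSlice.isReducedBracket μ hab,
    GrSlice.isPoissonBracket_reducedBracket μ hab, GrSlice.reducedEquiv μ hab, fun f g => ?_⟩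
  exact (GrSlice.reducedBracket_reducedEquiv μ hab f g).symm
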